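/- **Setting.** $\mathcal D$ is a distribution on $\mathcal X\times\{0,1\}$ with marginal $\mathcal D_{\mathcal X}$ on $\mathcal X$, $\mathcal H$ is a class of functions $h:\mathcal X\to[0,1]$, and losses are functions $\ell:[0,1]\times\{0,1\}\to[-1,1]$ (everything measurable). Put $\Delta\ell(p)=\ell(p,1)-\ell(p,0)$. For each $\ell$ in a loss class $\mathcal L$ let $k_\ell:[0,1]\to[0,1]$ satisfy $k_\ell(p)\in\arg\min_{q\in[0,1]}\mathbb E_{y\sim\mathrm{Ber}(p)}[\ell(q,y)]$ for all $p$. Let $\mathcal G=\{g_\omega:\omega\in\Omega\}$ be a nonempty class of losses indexed by a measurable space $\Omega$. $\mathcal L$ is *$(\mathcal G,\varepsilon)$-spanned with coefficient norm $\lambda$* if for each $\ell\in\mathcal L$ there is a signed measure $c_\ell$ on $\Omega$ with $|c_\ell|(\Omega)\le\lambda$ and $|\ell(p,y)-\int_\Omega g_\omega(p,y)\,dc_\ell(\omega)|\le\varepsilon$ for all $p,y$. Put $\mathcal C=\Delta\mathcal G\circ\mathcal H=\{\Delta g\circ h: g\in\mathcal G,\,h\in\mathcal H\}$ and $$\mathsf{rad}_T(\mathcal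 C)=\mathbb E_{x_1,\dots,x_T\sim\mathcal D_{\mathcal X}}\ \mathbb E_{\sigma\in\{\pm1\}^T}\ \sup_{c\in\mathcal C}\tfrac1T\sum_{i=1}^T\sigma_ic(x_i),$$ the suprema over $\mathcal C$ of $\sum_i w_ic(x_i)$, $w\in\mathbb R^T$, being measurable in the i.i.d. sample. **Online weak agnostic learner (OWAL).** In round $t=1,\dots,T$ the learner has a randomized strategy $Q_t$, a distribution over functions $\mathcal X\to[-1,1]$ determined by the interaction (contexts, labels and its own random seeds) in rounds $1,\dots,t-1$. An adaptive adversary picks $(x_t,y_t)\in\mathcal X\times[-1,1]$ from the same past, without access to the realization $q_t\sim Q_t$. The learner is an OWAL for a class $\mathcal C'$ with failure probability $\delta'$ and regret bound $R$ if against every such adversary, with probability at least $1-\delta'$, $\sum_t c(x_t)y_t\le\sum_t\mathbb E_{q\sim Q_t}[q(x_t)]\,y_t+R$ for all $c\in\mathcal C'$. **Algorithm.** Write $\mathrm{Th}_v(p)=1$ if $p\ge v$ and $-1$ otherwise, $[1/T]=\{0,\frac1T,\dots,1\}$, $\eta=\sqrt{\log T/T}$. Start with all weights $w^1_{v,s}$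 ($v\in[1/T]$, $s\in\{\pm1\}$) and $w^1_{\mathrm{sma}}$ equal to $\frac1{2T+3}$. In round $t$: 1. Let $q_t$ be the average of $k$ independent predictors drawn from the learner's strategy $Q_t$, where $k\ge T\log(T/\delta)$. Draw $\zeta_t$ uniformly from $[0,1]$. For $q\in[-1,1]$ and $j\in[1/T]$ put $f_t(q,j)=w^t_{\mathrm{sma}}q+\sum_{v,s}s\,w^t_{v,s}\mathrm{Th}_v(j)$ and $j^+=\min\{j+\frac1T,1\}$. Define $(j,\mu)$ as follows: $(0,0)$ if $f_t(q,0)\le0$; otherwise the least $j\in[1/T]$, $j<1$, with $f_t(q,j)f_t(q,j^+)\le0$ together with $\mu=\frac{|f_t(q,j)|}{|f_t(q,j)|+|f_t(q,j^+)|}$; and $(1,1)$ if there is no such $j$. Let $v_t(q)=j$ if $\mu<\zeta_t$ and $v_t(q)=j^+$ if $\mu\ge\zeta_t$. 2. Output the predictor $p_t=v_t\circ q_t$. 3. Receive a sample $(x_t,y_t)$. Multiply $w^t_{v,s}$ by $\exp(\eta\,s\,(y_t-p_t(x_t))\,\mathrm{Th}_v(p_t(x_t)))$ and $w^t_{\mathrm{sma}}$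 by $\exp(\eta\,(y_t-p_t(x_t))\,q_t(x_t))$, and normalize to total weight $1$ to get $w^{t+1}$. Give the learner the labelled example $(x_t,\,y_t-p_t(x_t))$. **Theorem.** There is an absolute constant $K>0$ such that the following holds. Let $T\ge2$, $\delta\in(0,1)$, and let $\mathcal L$ be $(\mathcal G,\varepsilon)$-spanned with coefficient norm $\lambda\ge1$ for some $\varepsilon\le T^{-1/2}$. Run the algorithm on $T$ i.i.d. samples $(x_t,y_t)\sim\mathcal D$ with an OWAL for $\{-1,+1\}\cdot\Delta\mathcal G\circ\mathcal H$ that has failure probability $\delta/2$ and regret bound $\mathrm{OracleReg}(T)$ over $T$ rounds. Then with probability at least $1-\delta$ over the randomness of the algorithm and the sample, the randomized predictor $\hat{\mathbf p}=\mathrm{unif}\{p_1,\dots,p_T\}$ satisfies, simultaneously for all $\ell\in\mathcal L$, $$\mathbb E_{p\sim\hat{\mathbf p}}\,\mathbb E_{(x,y)\sim\mathcal D}[\ell(k_\ell(p(x)),y)]\le\inf_{h\in\mathcal H}\mathbb E_{(x,y)\sim\mathcal D}[\ell(h(x),y)]+K\left(\lambda\,\mathsf{rad}_T(\Delta\mathcal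 G\circ\mathcal H)+\lambda\sqrt{\tfrac{\ln(T/\delta)}T}\right)+\tfrac{\lambda}{T}\,\mathrm{OracleReg}(T).$$ Moreover each $p_t$ has the form $v_t\circ q_t$, where $q_t:\mathcal X\to[-1,1]$ is the predictor returned by the (resampled) OWAL in round $t$ and $v_t:[-1,1]\to[0,1]$ is a post-processing function. -/

import Mathlib

open MeasureTheory
open scoped unitInterval

noncomputable section

namespace Omni

/-! ### Losses, hypotheses, best responses -/

/-- A loss function `ℓ(p, y)` with `p ∈ [0,1]` and a binary outcome `y`
(`true` stands for `1`, `false` for `0`). -/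
abbrev Loss := I → Bool → ℝ

/-- The outcome `y ∈ {0,1}` as a real number. -/
def outcome (y : Bool) : ℝ := if y then 1 else 0

/-- `ℓ` takes values in `[-1,1]`. -/
def Loss.IsBounded (l : Loss) : Prop := ∀ p y, l p y ∈ Set.Icc (-1 : ℝ) 1

/-- The discrete derivative `Δℓ(p) = ℓ(p,1) - ℓ(p,0)`. -/
def Loss.delta (l : Loss) (p : I) : ℝ := l p true - l p false

/-- `E_{y ∼ Ber(p)} [ℓ(q, y)]`. -/
def Loss.berRisk (l : Loss) (p q : I) : ℝ := (p : ℝ) * l q true + (1 - (p : ℝ)) * l q false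

/-- `k(p) ∈ argmin_{q ∈ [0,1]} E_{y ∼ Ber(p)} [ℓ(q, y)]` for every `p ∈ [0,1]`. -/
def Loss.IsBestResponse (l : Loss) (k : I → I) : Prop :=
  ∀ p q : I, l.berRisk p (k p) ≤ l.berRisk p q

/-- `E_{(x,y) ∼ D} [ℓ(f(x), y)]`. -/
def risk {X : Type*} [MeasurableSpace X] (D : Measure (X × Bool)) (l : Loss) (f : X → I) : ℝ :=
  ∫ z, l (f z.1) z.2 ∂D

/-- The class `ΔG ∘ H` for a family `G = (g_ω)` of losses and a class `H` of hypotheses. -/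
def deltaComp {X Ω : Type*} (g : Ω → Loss) (H : Set (X → I)) : Set (X → ℝ) :=
  {c | ∃ ω, ∃ h ∈ H, c = fun x => (g ω).delta (h x)}

/-- The class `{-1,+1} · C`. -/
def signed {X : Type*} (C : Set (X → ℝ)) : Set (X → ℝ) :=
  {f | ∃ s : ℤˣ, ∃ c ∈ C, f = fun x => ((s : ℤ) : ℝ) * c x}

/-! ### Spanned classes -/

/-- The integral of `f` against a signed measure, through its Jordan decomposition. -/
def signedIntegral {Ω : Type*} [MeasurableSpace Ω] (c : SignedMeasure Ω) (f : Ω → ℝ) : ℝ :=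
  (∫ ω, f ω ∂c.toJordanDecomposition.posPart) - ∫ ω, f ω ∂c.toJordanDecomposition.negPart

/-- The class `F` of functions on `Γ` is `(G, ε)`-spanned with coefficient norm `lam`, where
`G = (g_ω)_{ω ∈ Ω}`. -/
def IsSpanned {Γ Ω : Type*} [MeasurableSpace Ω] (F : Set (Γ → ℝ)) (g : Ω → Γ → ℝ)
    (ε lam : ℝ) : Prop :=
  ∀ f ∈ F, ∃ c : SignedMeasure Ω, c.totalVariation Set.univ ≤ ENNReal.ofReal lam ∧
    ∀ x, |f x - signedIntegral c (fun ω => g ω x)| ≤ ε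

/-- A loss as a function on `[0,1] × {0,1}`. -/
def Loss.uncurried (l : Loss) : I × Bool → ℝ := fun z => l z.1 z.2

/-! ### Rademacher complexity -/

/-- The empirical Rademacher complexity of `C` on the sample `x`; the average is over all sign
vectors. -/
def empRad {X : Type*} (C : Set (X → ℝ)) {m : ℕ} (x : Fin m → X) : ℝ :=
  (∑ s : Fin m → ℤˣ, ⨆ c : C, (1 / (m : ℝ)) * ∑ i, ((s i : ℤ) : ℝ) * c.1 (x i)) / 2 ^ m

/-- The statistical Rademacher complexity `rad_m(C)` for i.i.d. samples from `μ`. -/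
def rad {X : Type*} [MeasurableSpace X] (μ : Measure X) (C : Set (X → ℝ)) (m : ℕ) : ℝ :=
  ∫ x, empRad C x ∂(Measure.pi fun _ : Fin m => μ)

/-- The usual measurability convention for suprema over `C`: for all weights `w`, the supremum
over `c ∈ C` of `∑ w_i c(x_i)` is a (completion) measurable function of the i.i.d. sample. -/
def SupMeasurable {X : Type*} [MeasurableSpace X] (μ : Measure X) (C : Set (X → ℝ)) (m : ℕ) :
    Prop :=
  ∀ w : Fin m → ℝ, AEMeasurable (fun x : Fin m → X => ⨆ c : C, ∑ i, w i * c.1 (x i))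
    (Measure.pi fun _ => μ)

/-! ### Online weak agnostic learners -/

/-- The public history of the first `t` rounds: contexts, labels, and the learner's seeds. -/
abbrev Hist (X Ξ : Type*) (t : ℕ) := Fin t → X × ℝ × Ξ

/-- A randomized online learner. In round `t` (counted from `0`), after history `hist`, its
strategy `Q_t` is the law of the random predictor `predict t hist r : X → [-1,1]`, where the
seed `r` has law `ν`. -/
structure Learner (X Ξ : Type*) [MeasurableSpace X] [MeasurableSpace Ξ] (ν : Measure Ξ) where
  predict : (t : ℕ) → Hist X Ξ t → Ξ → X → ℝ
  predict_mem : ∀ t hist r x, predict t hist r x ∈ Set.Icc (-1 : ℝ) 1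
  measurable_predict : ∀ t, Measurable fun z : Hist X Ξ t × Ξ × X => predict t z.1 z.2.1 z.2.2

/-- `E_{q ∼ Q_t} [q(x)]` for the strategy `Q_t` after history `hist`. -/
def Learner.mean {X Ξ : Type*} [MeasurableSpace X] [MeasurableSpace Ξ] {ν : Measure Ξ}
    (A : Learner X Ξ ν) {t : ℕ} (hist : Hist X Ξ t) (x : X) : ℝ :=
  ∫ r, A.predict t hist r x ∂ν

/-- An adaptive adversary in the simultaneous-move protocol: in round `t` it picks
`(x_t, y_t) ∈ X × [-1,1]` from the learner's seeds of the earlier rounds. These determine, together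
with its own earlier moves, all earlier strategies and realizations and the strategy `Q_t`, but
not the realization in round `t`. -/
structure Adversary (X Ξ : Type*) [MeasurableSpace X] [MeasurableSpace Ξ] where
  move : (t : ℕ) → (Fin t → Ξ) → X × ℝ
  label_mem : ∀ t r, (move t r).2 ∈ Set.Icc (-1 : ℝ) 1
  measurable_move : ∀ t, Measurable (move t)

/-- The first `t` entries of a sequence of length `T`. -/
def pre {α : Type*} {T : ℕ} (r : Fin T → α) (t : Fin T) : Fin t → α :=
  fun i => r (Fin.castLE t.isLt.le i)

/-- The history produced by an adversary on the learner's seeds of the first `t` rounds. -/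
def Adversary.hist {X Ξ : Type*} [MeasurableSpace X] [MeasurableSpace Ξ]
    (B : Adversary X Ξ) {t : ℕ} (r : Fin t → Ξ) : Hist X Ξ t :=
  fun s => ((B.move s (pre r s)).1, (B.move s (pre r s)).2, r s)

/-- `A` is an online weak agnostic learner for `C` over `T` rounds with failure probability `δ`
and regret bound `reg`: against every adaptive adversary, with probability at least `1 - δ`,
`max_{c ∈ C} ∑ c(x_t) y_t ≤ ∑ E_{q ∼ Q_t}[q(x_t) y_t] + reg`. -/
def Learner.IsOWAL {X Ξ : Type*} [MeasurableSpace X] [MeasurableSpace Ξ] {ν : Measure Ξ}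
    (A : Learner X Ξ ν) (C : Set (X → ℝ)) (T : ℕ) (δ reg : ℝ) : Prop :=
  ∀ B : Adversary X Ξ,
    (Measure.pi fun _ : Fin T => ν) {r | ¬ ∀ c ∈ C,
      ∑ t : Fin T, c (B.move t (pre r t)).1 * (B.move t (pre r t)).2 ≤
        ∑ t : Fin T, A.mean (B.hist (pre r t)) (B.move t (pre r t)).1 * (B.move t (pre r t)).2
          + reg} ≤ ENNReal.ofReal δ

/-! ### Augmented proper calibration -/

/-- The threshold function `Th_θ(p) = sgn(p - θ)` with `sgn 0 = 1`. -/
def Th (θ p : ℝ) : ℝ := if θ ≤ p then 1 else -1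

/-- The weights `w_{v,s}` for `v ∈ {0, 1/T, …, 1}` (index `v` stands for `v/T`), `s ∈ {±1}`, and
the weight `w_sma`. -/
structure Weights (T : ℕ) where
  cal : Fin (T + 1) → ℤˣ → ℝ
  sma : ℝ

/-- The uniform initial weights. -/
def Weights.init (T : ℕ) : Weights T where
  cal _ _ := 1 / (2 * (T : ℝ) + 3)
  sma := 1 / (2 * (T : ℝ) + 3)

/-- The function `f_t(q, j/T) = w_sma q + ∑ s w_{v,s} Th_v(j/T)`. -/
def Weights.f {T : ℕ} (w : Weights T) (q : ℝ) (j : ℕ) : ℝ :=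
  w.sma * q + ∑ v : Fin (T + 1), ∑ s : ℤˣ,
    ((s : ℤ) : ℝ) * w.cal v s * Th ((v : ℕ) / (T : ℝ)) ((j : ℝ) / T)

/-- The interpolation `g_t(q, j/T, lam)` between the grid points `j/T` and `min(j/T + 1/T, 1)`. -/
def Weights.g {T : ℕ} (w : Weights T) (q : ℝ) (j : ℕ) (lam : ℝ) : ℝ :=
  (1 - lam) * w.f q j + lam * w.f q (min (j + 1) T)

open Classical in
/-- The procedure MinZeroCrossing; the first component `j` of the result stands for `j/T`. -/
def Weights.minZeroCrossing {T : ℕ} (w : Weights T) (q : ℝ) : ℕ × ℝ :=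
  if w.g q 0 0 ≤ 0 then (0, 0)
  else if h : ∃ j, j < T ∧ w.g q j 0 * w.g q j 1 ≤ 0 then
    (Nat.find h, |w.g q (Nat.find h) 0| / (|w.g q (Nat.find h) 0| + |w.g q (Nat.find h) 1|))
  else (T, 1)

/-- The randomized post-processing map with random threshold `ζ`: the grid point `j/T` if
`lam < ζ` and the next one (capped at `1`) otherwise, where `(j, lam)` is the zero crossing. -/
def Weights.remap {T : ℕ} (w : Weights T) (ζ : I) (q : ℝ) : I :=
  Set.projIcc (0 : ℝ) 1 zero_le_one
    ((if (w.minZeroCrossing q).2 < (ζ : ℝ) then ((w.minZeroCrossing q).1 : ℝ)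
      else ((min ((w.minZeroCrossing q).1 + 1) T : ℕ) : ℝ)) / T)

/-- The exponential weight update with learning rate `η = √(log T / T)` after the predictor value
`p = p_t(x_t)`, the auxiliary value `q = q_t(x_t)` and the outcome `y = y_t`; the payoffs are
`s (y - p) Th_v(p)` and `(y - p) q`. -/
def Weights.update {T : ℕ} (w : Weights T) (p q y : ℝ) : Weights T :=
  let η : ℝ := √(Real.log T / T)
  let cal' : Fin (T + 1) → ℤˣ → ℝ := fun v s =>
    Real.exp (η * (((s : ℤ) : ℝ) * (y - p) * Th ((v : ℕ) / (T : ℝ)) p)) * w.cal v s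
  let sma' : ℝ := Real.exp (η * ((y - p) * q)) * w.sma
  let W : ℝ := sma' + ∑ v, ∑ s, cal' v s
  { cal := fun v s => cal' v s / W
    sma := sma' / W }

/-! ### The online omniprediction algorithm, run on an i.i.d. sample -/

/-- All random inputs of one round: the sample `(x_t, y_t)`, the random threshold `ζ_t` of the
calibrator, the learner's own seed, and the seeds of `k` independent resamples from `Q_t`. -/
abbrev RoundInput (X Ξ : Type*) (k : ℕ) := (X × Bool) × I × Ξ × (Fin k → Ξ)

/-- The joint law of the random inputs of `T` rounds; `ζ_t` is uniform on `[0,1]`. -/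
def runMeasure {X Ξ : Type*} [MeasurableSpace X] [MeasurableSpace Ξ] (D : Measure (X × Bool))
    (ν : Measure Ξ) (T k : ℕ) : Measure (Fin T → RoundInput X Ξ k) :=
  Measure.pi fun _ =>
    D.prod ((volume : Measure I).prod (ν.prod (Measure.pi fun _ : Fin k => ν)))

section Run

variable {X Ξ : Type*} [MeasurableSpace X] [MeasurableSpace Ξ] {ν : Measure Ξ}

/-- The resampled predictor: the average of `k` independent predictors drawn from `Q_t`. -/
def Learner.average (A : Learner X Ξ ν) {k t : ℕ} (hist : Hist X Ξ t) (rs : Fin k → Ξ) (x : X) :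
    ℝ :=
  (∑ j, A.predict t hist (rs j) x) / k

/-- The state before round `t`: the weights of the calibrator and the learner's history. -/
abbrev State (X Ξ : Type*) (T t : ℕ) := Weights T × Hist X Ξ t

/-- The predictor `q_t` obtained from the learner in round `t`. -/
def roundQ (A : Learner X Ξ ν) {T k t : ℕ} (st : State X Ξ T t) (u : RoundInput X Ξ k) : X → ℝ :=
  A.average st.2 u.2.2.2

/-- The predictor `p_t` of round `t`. -/
def roundP (A : Learner X Ξ ν) {T k t : ℕ} (st : State X Ξ T t) (u : RoundInput X Ξ k) : X → I :=
  fun x => st.1.remap u.2.1 (roundQ A st u x)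

/-- One round: the calibrator observes `(x_t, y_t)` and updates its weights, and the learner
receives the labelled example `(x_t, y_t - p_t(x_t))`. -/
def step (A : Learner X Ξ ν) {T k t : ℕ} (st : State X Ξ T t) (u : RoundInput X Ξ k) :
    State X Ξ T (t + 1) :=
  let x : X := u.1.1
  let y : ℝ := outcome u.1.2
  let p : ℝ := roundP A st u x
  (st.1.update p (roundQ A st u x) y,
    Fin.snoc (α := fun _ => X × ℝ × Ξ) st.2 (x, y - p, u.2.2.1))

/-- The state after `t` rounds. -/
def run (A : Learner X Ξ ν) (T k : ℕ) : (t : ℕ) → (Fin t → RoundInput X Ξ k) → State X Ξ T t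
  | 0, _ => (Weights.init T, Fin.elim0)
  | t + 1, u => step A (run A T k t (fun i => u i.castSucc)) (u (Fin.last t))

/-- The predictor `q_t` which the learner returns in round `t` of the algorithm. -/
def outQ (A : Learner X Ξ ν) {T k : ℕ} (u : Fin T → RoundInput X Ξ k) (t : Fin T) : X → ℝ :=
  roundQ A (run A T k t (pre u t)) (u t)

/-- The predictor `p_t` which the algorithm outputs in round `t`. -/
def outP (A : Learner X Ξ ν) {T k : ℕ} (u : Fin T → RoundInput X Ξ k) (t : Fin T) : X → I :=
  roundP A (run A T k t (pre u t)) (u t)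

/-- `E_{p ∼ unif{p_1,…,p_T}} E_{(x,y) ∼ D} [ℓ(k(p(x)), y)]`. -/
def mixtureRisk {T : ℕ} (D : Measure (X × Bool)) (l : Loss) (k : I → I) (p : Fin T → X → I) : ℝ :=
  (1 / (T : ℝ)) * ∑ t, risk D l (fun x => k (p t x))

end Run

end Omni

end

open Omni

open scoped ENNReal

noncomputable section

namespace Omni

/-! ### Products over `Fin (n + 1)` -/

section PiFin

variable {U : Type*} [MeasurableSpace U] (P : Measure U) [IsProbabilityMeasure P]

/-! A loss splits as `l q y = l.berRisk p q + (outcome y - p) * l.delta q`, and a best response to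
`p` minimises the first term. So the excess loss of `κ ∘ p_t` over `h` is at most the correlation of
the residual `y - p_t(x)` with `Δl ∘ κ ∘ p_t`, minus its correlation with `Δl ∘ h`
(`Loss.IsBestResponse.sub_le`). The first function is antitone in the prediction, hence on the grid
a combination of thresholds with bounded coefficients (`exists_threshold_coeff`). The second is, up
to `2ε`, an integral of `Δg_ω ∘ h` against a signed measure of mass at most `lam`. All losses and
hypotheses are thus handled by the correlations under `D` of the residual with thresholds and with
the class `C = ΔG ∘ H` (`sum_risk_sub_le`).

On the realised sample, exponential weights compare the payoff of every threshold, and that of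
`q_t`, with the payoff of the weighted average of the experts. The randomized zero crossing keeps
the latter at most `1/T` in expectation over `ζ_t`, whatever the outcome
(`Weights.IsProb.integral_crossing_le`). Resampling makes `q_t` close to the mean of the learner's
strategy. The learner's guarantee, applied to the run viewed as an adversary
(`measure_oracle_fail_le`), then passes from this mean to every `c ∈ C`.

It remains to pass from the sample to `D`. For thresholds, a martingale Chernoff bound and a union
bound suffice. Over `C` a uniform bound is needed although the multipliers, the residuals, depend on
the past and on the current sample; still only the ordinary Rademacher complexity appears
(`measure_exists_sum_ge_le`). With a ghost sample, multipliers are exchanged for random signs from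
the last round to the first. When round `j` is treated, later rounds already carry signs that ignore
the data, and earlier multipliers do not see round `j`; so swapping the sample of round `j` with its
ghost is a symmetry, and convexity of the exponential does the rest
(`sum_lintegral_hybrid_succ_le`). What is left is the exponential moment of a Rademacher supremum,
bounded by McDiarmid's inequality (`sum_lintegral_exp_supSum_signs_le`). The two halves of the
rounds are treated separately, so that sample points and ghosts together fill one i.i.d. sample of
size `T`, the size for which suprema are assumed measurable. -/

lemma measurePreserving_cons (n : ℕ) :
    MeasurePreserving (fun z : U × (Fin n → U) => (Fin.cons z.1 z.2 : Fin (n + 1) → U))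
      (P.prod (Measure.pi fun _ => P)) (Measure.pi fun _ => P) := by
  have h := (measurePreserving_piFinSuccAbove (fun _ : Fin (n + 1) => P) 0).symm
  convert h using 1
  ext z i
  simp [MeasurableEquiv.piFinSuccAbove]

lemma measurePreserving_snoc (n : ℕ) :
    MeasurePreserving (fun z : U × (Fin n → U) => (Fin.snoc z.2 z.1 : Fin (n + 1) → U))
      (P.prod (Measure.pi fun _ => P)) (Measure.pi fun _ => P) := by
  have h := (measurePreserving_piFinSuccAbove (fun _ : Fin (n + 1) => P) (Fin.last n)).symm
  convert h using 1
  ext z i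
  simp [MeasurableEquiv.piFinSuccAbove]

lemma measurable_pre {α : Type*} [MeasurableSpace α] {T : ℕ} (t : Fin T) :
    Measurable fun r : Fin T → α => pre r t :=
  measurable_pi_lambda _ fun _ => measurable_pi_apply _

lemma pre_snoc_castSucc {α : Type*} {n : ℕ} (r : Fin n → α) (a : α) (t : Fin n) :
    pre (Fin.snoc r a : Fin (n + 1) → α) t.castSucc = pre r t := by
  ext i
  exact Fin.snoc_castSucc (α := fun _ => α) a r (Fin.castLE t.isLt.le i)

lemma pre_snoc_last {α : Type*} {n : ℕ} (r : Fin n → α) (a : α) :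
    pre (Fin.snoc r a : Fin (n + 1) → α) (Fin.last n) = r := by
  ext i
  exact Fin.snoc_castSucc (α := fun _ => α) a r i

/-- Tonelli, with the last round innermost: given the past, its factor integrates to at most `b`, so
each round contributes one factor `b`. -/
lemma lintegral_prod_pre_le (G : (t : ℕ) → (Fin t → U) → U → ℝ≥0∞)
    (hG : ∀ t, Measurable fun z : (Fin t → U) × U => G t z.1 z.2) (b : ℝ≥0∞)
    (hb : ∀ t past, ∫⁻ u, G t past u ∂P ≤ b) (n : ℕ) :
    ∫⁻ u, ∏ t : Fin n, G t (pre u t) (u t) ∂(Measure.pi fun _ => P) ≤ b ^ n := by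
  induction n with
  | zero => simp
  | succ n ih =>
    have hm : ∀ m, Measurable fun u : Fin m → U => ∏ t : Fin m, G t (pre u t) (u t) := fun m =>
      Finset.measurable_prod _ fun t _ =>
        (hG t).comp ((measurable_pre t).prodMk (measurable_pi_apply t))
    rw [← (measurePreserving_snoc P n).lintegral_comp (hm _)]
    simp_rw [Fin.prod_univ_castSucc, pre_snoc_castSucc, pre_snoc_last, Fin.snoc_castSucc,
      Fin.snoc_last]
    have hG' : Measurable fun z : U × (Fin n → U) => G n z.2 z.1 :=
      (hG n).comp (measurable_snd.prodMk measurable_fst)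
    have hmG : Measurable fun z : U × (Fin n → U) =>
        (∏ t : Fin n, G t (pre z.2 t) (z.2 t)) * G n z.2 z.1 :=
      ((hm n).comp measurable_snd).mul hG'
    refine (lintegral_prod_symm' _ hmG).trans_le ?_
    calc _ = ∫⁻ r : Fin n → U, (∏ t : Fin n, G t (pre r t) (r t)) * ∫⁻ u, G n r u ∂P
            ∂(Measure.pi fun _ => P) := by
          refine lintegral_congr fun r => ?_
          have hGr : Measurable fun u => G n r u := (hG n).comp measurable_prodMk_left
          exact lintegral_const_mul (∏ t : Fin n, G t (pre r t) (r t)) hGr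
      _ ≤ ∫⁻ r : Fin n → U, (∏ t : Fin n, G t (pre r t) (r t)) * b ∂(Measure.pi fun _ => P) := by
          gcongr with r
          exact hb n r
      _ ≤ b ^ (n + 1) := by
          rw [lintegral_mul_const _ (hm n), pow_succ]
          gcongr

/-- Chernoff bound for sums of adapted terms. -/
lemma measure_sum_pre_ge_le (F : (t : ℕ) → (Fin t → U) → U → ℝ)
    (hF : ∀ t, Measurable fun z : (Fin t → U) × U => F t z.1 z.2) {θ b : ℝ} (hθ : 0 < θ)
    (hb : ∀ t past, ∫⁻ u, ENNReal.ofReal (Real.exp (θ * F t past u)) ∂P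
      ≤ ENNReal.ofReal (Real.exp b)) (n : ℕ) (a : ℝ) :
    (Measure.pi fun _ : Fin n => P) {u | a ≤ ∑ t : Fin n, F t (pre u t) (u t)}
      ≤ ENNReal.ofReal (Real.exp (n * b - θ * a)) := by
  have hm : Measurable fun u : Fin n → U =>
      ENNReal.ofReal (Real.exp (θ * ∑ t : Fin n, F t (pre u t) (u t))) := by
    refine (Real.measurable_exp.comp (measurable_const.mul ?_)).ennreal_ofReal
    exact Finset.measurable_sum _ fun t _ =>
        (hF t).comp ((measurable_pre t).prodMk (measurable_pi_apply t))
  have h1 := lintegral_prod_pre_le P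
    (fun t past u => ENNReal.ofReal (Real.exp (θ * F t past u)))
    (fun t => (Real.measurable_exp.comp (measurable_const.mul (hF t))).ennreal_ofReal) _ hb n
  have h2 := mul_meas_ge_le_lintegral₀ (μ := Measure.pi fun _ : Fin n => P) hm.aemeasurable
    (ENNReal.ofReal (Real.exp (θ * a)))
  have h3 : ∀ u : Fin n → U, ∏ t : Fin n, ENNReal.ofReal (Real.exp (θ * F t (pre u t) (u t)))
      = ENNReal.ofReal (Real.exp (θ * ∑ t : Fin n, F t (pre u t) (u t))) := fun u => by
    rw [← ENNReal.ofReal_prod_of_nonneg fun _ _ => (Real.exp_pos _).le, ← Real.exp_sum,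
      Finset.mul_sum]
  simp_rw [h3] at h1
  have h4 := h2.trans h1
  rw [← ENNReal.ofReal_pow (Real.exp_pos _).le, ← Real.exp_nat_mul] at h4
  have hset : {u : Fin n → U | a ≤ ∑ t : Fin n, F t (pre u t) (u t)} ⊆
      {u | ENNReal.ofReal (Real.exp (θ * a)) ≤
        ENNReal.ofReal (Real.exp (θ * ∑ t : Fin n, F t (pre u t) (u t)))} := fun u hu =>
    ENNReal.ofReal_le_ofReal (Real.exp_le_exp.2 (mul_le_mul_of_nonneg_left hu hθ.le))
  refine (measure_mono hset).trans ?_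
  rw [Real.exp_sub, ENNReal.ofReal_div_of_pos (Real.exp_pos _)]
  rw [ENNReal.le_div_iff_mul_le (Or.inl (by simp [Real.exp_pos])) (Or.inl ENNReal.ofReal_ne_top),
    mul_comm]
  exact h4

end PiFin

/-! ### Moment generating functions under bounded differences -/

section BoundedDifferences

variable {Y : Type*} [MeasurableSpace Y] (μ : Measure Y) [IsProbabilityMeasure μ]

lemma integrable_of_abs_le {μ : Measure Y} [IsFiniteMeasure μ] {g : Y → ℝ} (hg : Measurable g)
    {B : ℝ} (hB : ∀ a, |g a| ≤ B) : Integrable g μ :=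
  Integrable.of_bound hg.aestronglyMeasurable B (Filter.Eventually.of_forall hB)

lemma integrable_exp_of_abs_le {μ : Measure Y} [IsFiniteMeasure μ] {g : Y → ℝ}
    (hg : Measurable g) {B : ℝ} (hB : ∀ a, |g a| ≤ B) (θ : ℝ) :
    Integrable (fun a => Real.exp (θ * g a)) μ := by
  refine integrable_of_abs_le (Real.measurable_exp.comp (measurable_const.mul hg))
    (B := Real.exp (|θ| * B)) fun a => ?_
  rw [Real.abs_exp]
  refine Real.exp_le_exp.2 ((le_abs_self _).trans ?_)
  rw [abs_mul]
  exact mul_le_mul_of_nonneg_left (hB a) (abs_nonneg _)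

lemma exp_integral_le {μ : Measure Y} [IsProbabilityMeasure μ] {g : Y → ℝ} (hg : Measurable g)
    {B : ℝ} (hB : ∀ a, |g a| ≤ B) (θ : ℝ) :
    Real.exp (θ * ∫ a, g a ∂μ) ≤ ∫ a, Real.exp (θ * g a) ∂μ := by
  rw [← integral_const_mul]
  exact convexOn_exp.map_integral_le Real.continuous_exp.continuousOn isClosed_univ
    (Filter.Eventually.of_forall fun _ => Set.mem_univ _)
    ((integrable_of_abs_le hg hB).const_mul θ) (integrable_exp_of_abs_le hg hB θ)

/-- Symmetrization: the product of the moments at `θ` and `-θ` is the mean of `cosh (θ (g - g'))`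
for an independent copy `g'`, hence at most `exp (θ²c²/2)`. Jensen bounds the moment at `-θ` from
below. -/
lemma integral_exp_le_of_sub_le {g : Y → ℝ} (hg : Measurable g) {B : ℝ} (hB : ∀ a, |g a| ≤ B)
    {c : ℝ} (hc : ∀ᵐ p ∂μ.prod μ, |g p.1 - g p.2| ≤ c) (θ : ℝ) :
    ∫ a, Real.exp (θ * g a) ∂μ ≤ Real.exp (θ * ∫ a, g a ∂μ + θ ^ 2 * c ^ 2 / 2) := by
  have hi := fun θ => integrable_exp_of_abs_le (μ := μ) hg hB θ
  have hJ := exp_integral_le (μ := μ) hg hB (-θ)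
  have hprod : ∀ θ : ℝ, (∫ a, Real.exp (θ * g a) ∂μ) * ∫ a, Real.exp (-θ * g a) ∂μ
      = ∫ p, Real.exp (θ * (g p.1 - g p.2)) ∂μ.prod μ := fun θ => by
    rw [← integral_prod_mul]
    refine integral_congr_ae (Filter.Eventually.of_forall fun p => ?_)
    simp only
    rw [← Real.exp_add]
    ring_nf
  have hint : ∀ θ : ℝ, Integrable (fun p : Y × Y => Real.exp (θ * (g p.1 - g p.2)))
      (μ.prod μ) := fun θ => by
    have := (hi θ).mul_prod (hi (-θ))
    refine this.congr (Filter.Eventually.of_forall fun p => ?_)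
    simp only
    rw [← Real.exp_add]
    ring_nf
  have h2 : (∫ a, Real.exp (θ * g a) ∂μ) * ∫ a, Real.exp (-θ * g a) ∂μ ≤
      Real.exp (θ ^ 2 * c ^ 2 / 2) := by
    have hs := hprod (-θ)
    rw [neg_neg, mul_comm] at hs
    have : 2 * ((∫ a, Real.exp (θ * g a) ∂μ) * ∫ a, Real.exp (-θ * g a) ∂μ) =
        ∫ p, 2 * Real.cosh (θ * (g p.1 - g p.2)) ∂μ.prod μ := by
      rw [two_mul]
      nth_rewrite 1 [hprod θ]
      rw [hs, ← integral_add (hint θ) (hint (-θ))]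
      refine integral_congr_ae (Filter.Eventually.of_forall fun p => ?_)
      simp only
      rw [Real.cosh_eq]
      ring_nf
    have h3 : ∫ p, 2 * Real.cosh (θ * (g p.1 - g p.2)) ∂μ.prod μ ≤
        ∫ _p : Y × Y, 2 * Real.exp (θ ^ 2 * c ^ 2 / 2) ∂μ.prod μ := by
      refine integral_mono_ae ?_ (integrable_const _) ?_
      · refine ((hint θ).add (hint (-θ))).congr (Filter.Eventually.of_forall fun p => ?_)
        simp only [Pi.add_apply]
        rw [Real.cosh_eq]
        ring_nf
      · filter_upwards [hc] with p hp
        have h4 := Real.cosh_le_exp_half_sq (θ * (g p.1 - g p.2))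
        have h5 : (θ * (g p.1 - g p.2)) ^ 2 ≤ θ ^ 2 * c ^ 2 := by
          rw [mul_pow]
          refine mul_le_mul_of_nonneg_left ?_ (sq_nonneg _)
          rw [← sq_abs]
          exact pow_le_pow_left₀ (abs_nonneg _) hp 2
        have h6 := Real.exp_le_exp.2 (div_le_div_of_nonneg_right h5 (zero_le_two (α := ℝ)))
        linarith
    simp only [integral_const, probReal_univ, one_smul] at h3
    linarith
  rw [Real.exp_add]
  have hpos : 0 < Real.exp (-θ * ∫ a, g a ∂μ) := Real.exp_pos _
  have h0 : 0 ≤ ∫ a, Real.exp (θ * g a) ∂μ := integral_nonneg fun _ => (Real.exp_pos _).le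
  have h7 : (∫ a, Real.exp (θ * g a) ∂μ) * Real.exp (-θ * ∫ a, g a ∂μ) ≤
      Real.exp (θ ^ 2 * c ^ 2 / 2) := (mul_le_mul_of_nonneg_left hJ h0).trans h2
  have h8 : Real.exp (θ * ∫ a, g a ∂μ) * Real.exp (-θ * ∫ a, g a ∂μ) = 1 := by
    rw [← Real.exp_add]
    simp
  calc _ = Real.exp (θ * ∫ a, g a ∂μ) *
        ((∫ a, Real.exp (θ * g a) ∂μ) * Real.exp (-θ * ∫ a, g a ∂μ)) := by
        rw [mul_left_comm, h8, mul_one]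
    _ ≤ _ := mul_le_mul_of_nonneg_left h7 (Real.exp_pos _).le

/-- McDiarmid's inequality for moment generating functions. -/
lemma integral_exp_le_of_boundedDifferences {n : ℕ} {f : (Fin n → Y) → ℝ} (hf : Measurable f)
    {B : ℝ} (hB : ∀ x, |f x| ≤ B) {c : ℝ}
    (hc : ∀ i, ∀ᵐ p ∂(Measure.pi fun _ : Fin n => μ).prod μ,
      |f p.1 - f (Function.update p.1 i p.2)| ≤ c) (θ : ℝ) :
    ∫ x, Real.exp (θ * f x) ∂(Measure.pi fun _ => μ) ≤
      Real.exp (θ * ∫ x, f x ∂(Measure.pi fun _ => μ) + n * (θ ^ 2 * c ^ 2 / 2)) := by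
  induction n with
  | zero =>
    have h : f = fun _ => f default := funext fun x => congrArg f (Subsingleton.elim _ _)
    rw [h]
    simp
  | succ n ih =>
    have hcons := measurePreserving_cons μ n
    have hfc : Measurable fun z : Y × (Fin n → Y) => f (Fin.cons z.1 z.2) :=
      hf.comp hcons.measurable
    have hfa : ∀ a, Measurable fun x : Fin n → Y => f (Fin.cons a x) := fun a =>
      hfc.comp measurable_prodMk_left
    have hI : ∀ F : (Fin (n + 1) → Y) → ℝ, Measurable F →
        ∫ x, F x ∂(Measure.pi fun _ => μ) =
          ∫ z, F (Fin.cons z.1 z.2) ∂μ.prod (Measure.pi fun _ => μ) := fun F hF => by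
      rw [← hcons.map_eq, integral_map hcons.measurable.aemeasurable hF.aestronglyMeasurable]
    -- Averaging over all coordinates but the first keeps the bounded difference in that coordinate;
    -- the others are handled by the induction hypothesis for almost every fixed first coordinate.
    set g : Y → ℝ := fun a => ∫ x, f (Fin.cons a x) ∂(Measure.pi fun _ : Fin n => μ) with hgdef
    have hg : Measurable g :=
      (hfc.stronglyMeasurable.integral_prod_right' (ν := Measure.pi fun _ : Fin n => μ)).measurable
    have hgB : ∀ a, |g a| ≤ B := fun a => by
      have := norm_integral_le_of_norm_le_const (μ := Measure.pi fun _ : Fin n => μ)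
        (f := fun x => f (Fin.cons a x)) (C := B) (Filter.Eventually.of_forall fun x => hB _)
      simpa using this
    have hgc : ∀ᵐ p ∂μ.prod μ, |g p.1 - g p.2| ≤ c := by
      have h0 := hc 0
      -- The hypothesis at coordinate `0` compares two first entries with a common tail. Putting the
      -- tail last in the product lets Fubini average over it.
      have hmp : MeasurePreserving
          (fun z : (Y × Y) × (Fin n → Y) => ((Fin.cons z.1.1 z.2 : Fin (n + 1) → Y), z.1.2))
          ((μ.prod μ).prod (Measure.pi fun _ => μ)) ((Measure.pi fun _ => μ).prod μ) := by
        have e1 : MeasurePreserving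
            (fun z : (Y × Y) × (Fin n → Y) => ((z.1.1, z.2), z.1.2))
            ((μ.prod μ).prod (Measure.pi fun _ : Fin n => μ))
            ((μ.prod (Measure.pi fun _ : Fin n => μ)).prod μ) := by
          have a1 := measurePreserving_prodAssoc μ μ (Measure.pi fun _ : Fin n => μ)
          have a2 := (MeasurePreserving.id μ).prod
            (Measure.measurePreserving_swap (μ := μ) (ν := Measure.pi fun _ : Fin n => μ))
          have a3 := (measurePreserving_prodAssoc μ (Measure.pi fun _ : Fin n => μ) μ).symm
          exact a3.comp (a2.comp a1)
        exact (hcons.prod (MeasurePreserving.id μ)).comp e1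
      have h1 := Measure.ae_ae_of_ae_prod (hmp.quasiMeasurePreserving.ae h0)
      filter_upwards [h1] with p hp
      rw [hgdef]
      simp only
      rw [← integral_sub (integrable_of_abs_le (hfa _) fun _ => hB _)
        (integrable_of_abs_le (hfa _) fun _ => hB _)]
      have := norm_integral_le_of_norm_le_const (μ := Measure.pi fun _ : Fin n => μ)
        (f := fun x => f (Fin.cons p.1 x) - f (Fin.cons p.2 x)) (C := c) (by
          filter_upwards [hp] with x hx
          simpa [Fin.update_cons_zero] using hx)
      simpa using this
    have hsec : ∀ᵐ a ∂μ, ∫ x, Real.exp (θ * f (Fin.cons a x)) ∂(Measure.pi fun _ : Fin n => μ) ≤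
        Real.exp (θ * g a + n * (θ ^ 2 * c ^ 2 / 2)) := by
      have h1 : ∀ i : Fin n, ∀ᵐ a ∂μ, ∀ᵐ p ∂(Measure.pi fun _ : Fin n => μ).prod μ,
          |f (Fin.cons a p.1) - f (Fin.cons a (Function.update p.1 i p.2))| ≤ c := fun i => by
        have hmp : MeasurePreserving
            (fun z : Y × ((Fin n → Y) × Y) => ((Fin.cons z.1 z.2.1 : Fin (n + 1) → Y), z.2.2))
            (μ.prod ((Measure.pi fun _ => μ).prod μ)) ((Measure.pi fun _ => μ).prod μ) :=
          (hcons.prod (MeasurePreserving.id μ)).comp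
            (measurePreserving_prodAssoc μ (Measure.pi fun _ : Fin n => μ) μ).symm
        have h2 := Measure.ae_ae_of_ae_prod (hmp.quasiMeasurePreserving.ae (hc i.succ))
        filter_upwards [h2] with a ha
        filter_upwards [ha] with p hp
        simpa [Fin.cons_update] using hp
      filter_upwards [ae_all_iff.2 h1] with a ha
      exact ih (hfa a) (fun _ => hB _) ha
    have hE : Integrable (fun z : Y × (Fin n → Y) => Real.exp (θ * f (Fin.cons z.1 z.2)))
        (μ.prod (Measure.pi fun _ : Fin n => μ)) :=
      integrable_exp_of_abs_le hfc (fun _ => hB _) θ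
    rw [hI (fun x => Real.exp (θ * f x)) (Real.measurable_exp.comp (measurable_const.mul hf)), hI _ hf, integral_prod _ hE,
      integral_prod _ (integrable_of_abs_le hfc fun _ => hB _)]
    calc _ ≤ ∫ a, Real.exp (θ * g a) * Real.exp (n * (θ ^ 2 * c ^ 2 / 2)) ∂μ := by
          refine integral_mono_ae hE.integral_prod_left
            ((integrable_exp_of_abs_le hg hgB θ).mul_const _) ?_
          filter_upwards [hsec] with a ha
          rw [← Real.exp_add]
          exact ha
      _ ≤ Real.exp (θ * ∫ a, g a ∂μ + θ ^ 2 * c ^ 2 / 2) * Real.exp (n * (θ ^ 2 * c ^ 2 / 2)) := by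
          rw [integral_mul_const]
          exact mul_le_mul_of_nonneg_right (integral_exp_le_of_sub_le μ hg hgB hgc θ)
            (Real.exp_pos _).le
      _ ≤ _ := by
          rw [← Real.exp_add]
          refine Real.exp_le_exp.2 (le_of_eq ?_)
          push_cast
          ring

end BoundedDifferences

/-! ### Suprema of weighted sums over a class -/

section SupSum

variable {X : Type*} {C : Set (X → ℝ)} {T : ℕ}

/-- The supremum over `c ∈ C` of `∑ w_i c(x_i)`. -/
def supSum (C : Set (X → ℝ)) (w : Fin T → ℝ) (x : Fin T → X) : ℝ :=
  ⨆ c : C, ∑ i, w i * c.1 (x i)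

lemma abs_sum_mul_le (hC : ∀ c ∈ C, ∀ x, |c x| ≤ 2) {c : X → ℝ} (hc : c ∈ C) (w : Fin T → ℝ)
    (x : Fin T → X) : |∑ i, w i * c (x i)| ≤ 2 * ∑ i, |w i| := by
  rw [Finset.mul_sum]
  refine (Finset.abs_sum_le_sum_abs _ _).trans (Finset.sum_le_sum fun i _ => ?_)
  rw [abs_mul, mul_comm]
  exact mul_le_mul_of_nonneg_right (hC c hc _) (abs_nonneg _)

lemma bddAbove_range_sum_mul (hC : ∀ c ∈ C, ∀ x, |c x| ≤ 2) (w : Fin T → ℝ) (x : Fin T → X) :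
    BddAbove (Set.range fun c : C => ∑ i, w i * c.1 (x i)) :=
  ⟨2 * ∑ i, |w i|, by
    rintro _ ⟨c, rfl⟩
    exact (le_abs_self _).trans (abs_sum_mul_le hC c.2 w x)⟩

lemma le_supSum (hC : ∀ c ∈ C, ∀ x, |c x| ≤ 2) {c : X → ℝ} (hc : c ∈ C) (w : Fin T → ℝ)
    (x : Fin T → X) : ∑ i, w i * c (x i) ≤ supSum C w x :=
  le_ciSup (bddAbove_range_sum_mul hC w x) ⟨c, hc⟩

lemma supSum_le (hne : C.Nonempty) {w : Fin T → ℝ} {x : Fin T → X} {a : ℝ}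
    (h : ∀ c ∈ C, ∑ i, w i * c (x i) ≤ a) : supSum C w x ≤ a :=
  haveI := hne.to_subtype
  ciSup_le fun c => h c.1 c.2

lemma abs_supSum_le (hne : C.Nonempty) (hC : ∀ c ∈ C, ∀ x, |c x| ≤ 2) (w : Fin T → ℝ)
    (x : Fin T → X) : |supSum C w x| ≤ 2 * ∑ i, |w i| := by
  obtain ⟨c, hc⟩ := hne
  refine abs_le.2 ⟨(neg_le_of_abs_le (abs_sum_mul_le hC hc w x)).trans (le_supSum hC hc w x),
    supSum_le ⟨c, hc⟩ fun c hc => (le_abs_self _).trans (abs_sum_mul_le hC hc w x)⟩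

lemma supSum_le_add (hne : C.Nonempty) (hC : ∀ c ∈ C, ∀ x, |c x| ≤ 2) (w w' : Fin T → ℝ)
    (x : Fin T → X) : supSum C w x ≤ supSum C w' x + 2 * ∑ i, |w i - w' i| := by
  refine supSum_le hne fun c hc => ?_
  have h1 := le_supSum hC hc w' x
  have h2 := (le_abs_self _).trans (abs_sum_mul_le hC hc (fun i => w i - w' i) x)
  simp only [sub_mul, Finset.sum_sub_distrib] at h2
  linarith

lemma supSum_convex (hne : C.Nonempty) (hC : ∀ c ∈ C, ∀ x, |c x| ≤ 2) {a b : ℝ} (ha : 0 ≤ a)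
    (hb : 0 ≤ b) {w w₁ w₂ : Fin T → ℝ} (hw : ∀ i, w i = a * w₁ i + b * w₂ i) (x : Fin T → X) :
    supSum C w x ≤ a * supSum C w₁ x + b * supSum C w₂ x := by
  refine supSum_le hne fun c hc => ?_
  have h : ∑ i, w i * c (x i) = a * ∑ i, w₁ i * c (x i) + b * ∑ i, w₂ i * c (x i) := by
    simp_rw [Finset.mul_sum, ← Finset.sum_add_distrib, hw]
    exact Finset.sum_congr rfl fun i _ => by ring
  rw [h]
  exact add_le_add (mul_le_mul_of_nonneg_left (le_supSum hC hc _ _) ha)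
    (mul_le_mul_of_nonneg_left (le_supSum hC hc _ _) hb)

lemma supSum_const_mul {a : ℝ} (ha : 0 ≤ a) (w : Fin T → ℝ) (x : Fin T → X) :
    supSum C (fun i => a * w i) x = a * supSum C w x := by
  simp_rw [supSum, Real.mul_iSup_of_nonneg ha, Finset.mul_sum, mul_assoc]

/-- The supremum is sublinear in the weights and `exp` is convex and increasing. This is what allows
a bounded weight to be replaced by a mixture of extreme ones. -/
lemma exp_supSum_convex (hne : C.Nonempty) (hC : ∀ c ∈ C, ∀ x, |c x| ≤ 2) {θ : ℝ} (hθ : 0 ≤ θ)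
    {a b : ℝ} (ha : 0 ≤ a) (hb : 0 ≤ b) (hab : a + b = 1) {w w₁ w₂ : Fin T → ℝ}
    (hw : ∀ i, w i = a * w₁ i + b * w₂ i) (x : Fin T → X) :
    Real.exp (θ * supSum C w x) ≤
      a * Real.exp (θ * supSum C w₁ x) + b * Real.exp (θ * supSum C w₂ x) := by
  have h1 := convexOn_exp.2 (Set.mem_univ (θ * supSum C w₁ x)) (Set.mem_univ (θ * supSum C w₂ x))
    ha hb hab
  simp only [smul_eq_mul] at h1
  refine le_trans (Real.exp_le_exp.2 ?_) h1
  have := mul_le_mul_of_nonneg_left (supSum_convex hne hC ha hb hw x) hθ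
  linarith

lemma continuous_supSum (hne : C.Nonempty) (hC : ∀ c ∈ C, ∀ x, |c x| ≤ 2) (x : Fin T → X) :
    Continuous fun w : Fin T → ℝ => supSum C w x := by
  refine continuous_iff_continuousAt.2 fun w₀ => ?_
  have h0 : Filter.Tendsto (fun w : Fin T → ℝ => 2 * ∑ i, |w i - w₀ i|) (nhds w₀) (nhds 0) := by
    have : Continuous fun w : Fin T → ℝ => 2 * ∑ i, |w i - w₀ i| := by fun_prop
    simpa using this.tendsto w₀
  refine tendsto_iff_dist_tendsto_zero.2 (squeeze_zero (fun _ => dist_nonneg) (fun w => ?_) h0)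
  rw [Real.dist_eq, abs_sub_le_iff]
  have h1 := supSum_le_add hne hC w w₀ x
  have h2 := supSum_le_add hne hC w₀ w x
  simp_rw [abs_sub_comm (w₀ _)] at h2
  constructor <;> linarith

variable [MeasurableSpace X]

/-- On a measurable set of full measure the supremum is jointly measurable in the weights and the
sample. -/
lemma exists_measurable_indicator_supSum {μ : Measure X} (hne : C.Nonempty)
    (hC : ∀ c ∈ C, ∀ x, |c x| ≤ 2) (hS : SupMeasurable μ C T) :
    ∃ G : Set (Fin T → X), MeasurableSet G ∧ (∀ᵐ x ∂(Measure.pi fun _ => μ), x ∈ G) ∧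
      Measurable fun p : (Fin T → ℝ) × (Fin T → X) => G.indicator (supSum C p.1) p.2 := by
  have hS' : ∀ w : Fin T → ℝ, AEMeasurable (supSum C w) (Measure.pi fun _ => μ) := hS
  -- One null set has to serve all weights at once: it is chosen for a countable dense family, and
  -- continuity in the weights does the rest.
  let D := TopologicalSpace.denseSeq (Fin T → ℝ)
  have hae : ∀ᵐ x ∂(Measure.pi fun _ : Fin T => μ), ∀ n, supSum C (D n) x = (hS' (D n)).mk _ x :=
    ae_all_iff.2 fun n => (hS' (D n)).ae_eq_mk
  set N := {x | ¬ ∀ n, supSum C (D n) x = (hS' (D n)).mk _ x} with hN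
  refine ⟨(toMeasurable (Measure.pi fun _ => μ) N)ᶜ, (measurableSet_toMeasurable _ _).compl, ?_, ?_⟩
  · rw [ae_iff]
    simp only [Set.mem_compl_iff, not_not, Set.ofPred_mem_eq]
    rw [measure_toMeasurable]
    exact hae
  set G := (toMeasurable (Measure.pi fun _ => μ) N)ᶜ with hGdef
  have hG : MeasurableSet G := (measurableSet_toMeasurable _ _).compl
  have hGN : ∀ x ∈ G, ∀ n, supSum C (D n) x = (hS' (D n)).mk _ x := fun x hx => by
    by_contra h
    exact hx (subset_toMeasurable _ _ h)
  have hD : ∀ n, Measurable (G.indicator (supSum C (D n))) := fun n => by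
    have : G.indicator (supSum C (D n)) = G.indicator ((hS' (D n)).mk _) :=
      Set.indicator_congr fun x hx => hGN x hx n
    rw [this]
    exact (hS' (D n)).measurable_mk.indicator hG
  have hcont : ∀ x, Continuous fun w => G.indicator (supSum C w) x := fun x => by
    by_cases hx : x ∈ G
    · simpa only [Set.indicator_of_mem hx] using continuous_supSum hne hC x
    · simpa only [Set.indicator_of_notMem hx] using continuous_const
  refine measurable_uncurry_of_continuous_of_measurable
    (u := fun w x => G.indicator (supSum C w) x) hcont fun w => ?_
  obtain ⟨s, hs, hlim⟩ := mem_closure_iff_seq_limit.1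
    (TopologicalSpace.denseRange_denseSeq (Fin T → ℝ) w)
  refine measurable_of_tendsto_metrizable (f := fun k => G.indicator (supSum C (s k)))
    (fun k => ?_) (tendsto_pi_nhds.2 fun x => ((hcont x).tendsto w).comp hlim)
  obtain ⟨n, hn⟩ := hs k
  rw [← hn]
  exact hD n

/-- The weights may depend on the same randomness as the points, which is the situation of adaptive
multipliers. -/
lemma aemeasurable_supSum_comp {Ω' : Type*} [MeasurableSpace Ω'] {μ : Measure X}
    {P : Measure Ω'} (hne : C.Nonempty) (hC : ∀ c ∈ C, ∀ x, |c x| ≤ 2)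
    (hS : SupMeasurable μ C T) {w : Ω' → Fin T → ℝ} (hw : Measurable w) {x : Ω' → Fin T → X}
    (hx : Measure.QuasiMeasurePreserving x P (Measure.pi fun _ => μ)) :
    AEMeasurable (fun ω => supSum C (w ω) (x ω)) P := by
  obtain ⟨G, hG, hGae, hm⟩ := exists_measurable_indicator_supSum hne hC hS
  refine ⟨_, hm.comp (hw.prodMk hx.measurable), ?_⟩
  filter_upwards [hx.ae hGae] with ω hω
  simp [Set.indicator_of_mem hω]

end SupSum

/-! ### Symmetrization for adaptive multipliers -/

lemma lintegral_comp_of_measurePreserving {α β : Type*} [MeasurableSpace α] [MeasurableSpace β]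
    {μ : Measure α} {ν : Measure β} {f : β → ℝ≥0∞} (hf : AEMeasurable f ν) {g : α → β}
    (hg : MeasurePreserving g μ ν) : ∫⁻ a, f (g a) ∂μ = ∫⁻ b, f b ∂ν := by
  rw [← hg.map_eq] at hf ⊢
  exact (lintegral_map' hf hg.measurable.aemeasurable).symm

section Ghost

variable {X Z O : Type*} [MeasurableSpace X] [MeasurableSpace Z] [MeasurableSpace O] {T : ℕ}
  (B : Fin T → Prop) [DecidablePred B]

/-- The sample point in the rounds of `B`; the other positions hold the ghost points of the
reversed rounds. -/
def ghostPoints (φ : Z → X) (v : Fin T → (Z × O) × Z) : Fin T → X := fun i =>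
  if B i then φ (v i).1.1 else φ (v i.rev).2

/-- Exchange a sample with its ghost. -/
def ghostSwap (a : (Z × O) × Z) : (Z × O) × Z := ((a.2, a.1.2), a.1.1)

/-- Exchange a sample with its ghost in round `j`. -/
def ghostSwapAt (j : Fin T) (v : Fin T → (Z × O) × Z) : Fin T → (Z × O) × Z :=
  Function.update v j (ghostSwap (v j))

variable (D : Measure Z) [IsProbabilityMeasure D] (P' : Measure O) [IsProbabilityMeasure P']

/-- No sample and no ghost is read at two positions, so the positions are independent with law
`D.map φ`. This holds for any `B`. -/
lemma measurePreserving_ghostPoints {φ : Z → X} (hφ : Measurable φ) :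
    MeasurePreserving (ghostPoints (O := O) B φ) (Measure.pi fun _ => (D.prod P').prod D)
      (Measure.pi fun _ => D.map φ) := by
  have : IsProbabilityMeasure (D.map φ) := Measure.isProbabilityMeasure_map hφ.aemeasurable
  have hm : Measurable (ghostPoints (O := O) B φ) := by
    refine measurable_pi_lambda _ fun i => ?_
    unfold ghostPoints
    split_ifs
    · exact hφ.comp (measurable_fst.comp (measurable_fst.comp (measurable_pi_apply i)))
    · exact hφ.comp (measurable_snd.comp (measurable_pi_apply i.rev))
  refine ⟨hm, (Measure.pi_eq fun s hs => ?_).symm⟩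
  rw [Measure.map_apply hm (MeasurableSet.univ_pi hs)]
  have hpre : ghostPoints (O := O) B φ ⁻¹' (Set.univ.pi s) = Set.univ.pi fun k =>
      ((if B k then φ ⁻¹' s k else Set.univ) ×ˢ Set.univ) ×ˢ
        (if B k.rev then Set.univ else φ ⁻¹' s k.rev) := by
    ext v
    simp only [Set.mem_preimage, Set.mem_univ_pi, Set.mem_prod, ghostPoints]
    constructor
    · intro h k
      refine ⟨⟨?_, trivial⟩, ?_⟩
      · have := h k
        split_ifs with hk
        · simpa [hk] using this
        · trivial
      · have := h k.rev
        split_ifs with hk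
        · trivial
        · simpa [hk] using this
    · intro h k
      split_ifs with hk
      · have := (h k).1.1
        simpa [hk] using this
      · have := (h k.rev).2
        simpa [hk] using this
  rw [hpre, Measure.pi_pi]
  simp_rw [Measure.prod_prod, measure_univ, mul_one]
  have hrev : ∏ k : Fin T, D (if B k.rev then Set.univ else φ ⁻¹' s k.rev) =
      ∏ k : Fin T, D (if B k then Set.univ else φ ⁻¹' s k) :=
    Equiv.prod_comp Fin.revPerm (fun k => D (if B k then Set.univ else φ ⁻¹' s k))
  rw [Finset.prod_mul_distrib, hrev, ← Finset.prod_mul_distrib]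
  refine Finset.prod_congr rfl fun k _ => ?_
  rw [Measure.map_apply hφ (hs k)]
  split_ifs <;> simp

lemma measurePreserving_ghostSwap :
    MeasurePreserving (ghostSwap (Z := Z) (O := O)) ((D.prod P').prod D) ((D.prod P').prod D) := by
  have a1 := measurePreserving_prodAssoc D P' D
  have a2 := Measure.measurePreserving_swap (μ := D) (ν := P'.prod D)
  have a3 := (Measure.measurePreserving_swap (μ := P') (ν := D)).prod (MeasurePreserving.id D)
  exact a3.comp (a2.comp a1)

lemma measurePreserving_ghostSwapAt (j : Fin T) :
    MeasurePreserving (ghostSwapAt (Z := Z) (O := O) j)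
      (Measure.pi fun _ => (D.prod P').prod D) (Measure.pi fun _ => (D.prod P').prod D) := by
  have := measurePreserving_pi (fun _ : Fin T => (D.prod P').prod D)
    (fun _ : Fin T => (D.prod P').prod D) (f := fun i => if i = j then ghostSwap else id)
    (fun i => by
      split_ifs
      · exact measurePreserving_ghostSwap D P'
      · exact MeasurePreserving.id _)
  convert this using 1
  ext v i : 2
  unfold ghostSwapAt
  by_cases h : i = j
  · subst h
    simp
  · simp [h]

/-- The multiplier of round `j`. -/
def mult (W : (t : ℕ) → (Fin t → Z × O) → Z × O → ℝ) (v : Fin T → (Z × O) × Z) (j : Fin T) : ℝ :=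
  W j (pre (fun k => (v k).1) j) (v j).1

/-- The multiplier of round `j`, evaluated at the ghost sample. -/
def ghostMult (W : (t : ℕ) → (Fin t → Z × O) → Z × O → ℝ) (v : Fin T → (Z × O) × Z)
    (j : Fin T) : ℝ :=
  W j (pre (fun k => (v k).1) j) ((v j).2, (v j).1.2)

lemma measurable_pre_fst (j : Fin T) :
    Measurable fun v : Fin T → (Z × O) × Z => pre (fun k => (v k).1) j :=
  (measurable_pre j).comp
    (measurable_pi_lambda _ fun k => measurable_fst.comp (measurable_pi_apply k))

lemma measurable_mult {W : (t : ℕ) → (Fin t → Z × O) → Z × O → ℝ}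
    (hW : ∀ t, Measurable fun z : (Fin t → Z × O) × (Z × O) => W t z.1 z.2) (j : Fin T) :
    Measurable fun v : Fin T → (Z × O) × Z => mult W v j :=
  (hW j).comp ((measurable_pre_fst j).prodMk (measurable_fst.comp (measurable_pi_apply j)))

lemma measurable_ghostMult {W : (t : ℕ) → (Fin t → Z × O) → Z × O → ℝ}
    (hW : ∀ t, Measurable fun z : (Fin t → Z × O) × (Z × O) => W t z.1 z.2) (j : Fin T) :
    Measurable fun v : Fin T → (Z × O) × Z => ghostMult W v j :=
  (hW j).comp ((measurable_pre_fst j).prodMk ((measurable_snd.comp (measurable_pi_apply j)).prodMk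
    (measurable_snd.comp (measurable_fst.comp (measurable_pi_apply j)))))

omit [MeasurableSpace Z] [MeasurableSpace O] in
-- The past of a round stops before that round, hence the case `k = j` is included.
lemma pre_ghostSwapAt {j k : Fin T} (hk : (k : ℕ) ≤ j) (v : Fin T → (Z × O) × Z) :
    pre (fun l => (ghostSwapAt j v l).1) k = pre (fun l => (v l).1) k := by
  ext1 l
  have hl : (Fin.castLE k.isLt.le l) ≠ j := fun h => by
    have := congrArg Fin.val h
    have h2 := l.isLt
    simp at this
    omega
  simp only [pre, ghostSwapAt, Function.update_of_ne hl]

omit [MeasurableSpace Z] [MeasurableSpace O] in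
lemma mult_ghostSwapAt (W : (t : ℕ) → (Fin t → Z × O) → Z × O → ℝ) (v : Fin T → (Z × O) × Z)
    (j : Fin T) : mult W (ghostSwapAt j v) j = ghostMult W v j := by
  rw [mult, ghostMult, pre_ghostSwapAt le_rfl]
  simp [ghostSwapAt, ghostSwap]

omit [MeasurableSpace Z] [MeasurableSpace O] in
lemma ghostMult_ghostSwapAt (W : (t : ℕ) → (Fin t → Z × O) → Z × O → ℝ)
    (v : Fin T → (Z × O) × Z) (j : Fin T) : ghostMult W (ghostSwapAt j v) j = mult W v j := by
  rw [mult, ghostMult, pre_ghostSwapAt le_rfl]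
  simp [ghostSwapAt, ghostSwap]

/-- The weights of the hybrid in which the rounds `i ≥ n` carry independent signs. -/
def hybridWeights (W : (t : ℕ) → (Fin t → Z × O) → Z × O → ℝ) (n : ℕ) (ε : Fin T → ℤˣ)
    (v : Fin T → (Z × O) × Z) : Fin T → ℝ := fun i =>
  if B i then
    if (i : ℕ) < n then -mult W v i else 2 * ((ε i : ℤ) : ℝ)
  else if B i.rev ∧ (i.rev : ℕ) < n then ghostMult W v i.rev
  else 0

lemma measurable_hybridWeights {W : (t : ℕ) → (Fin t → Z × O) → Z × O → ℝ}
    (hW : ∀ t, Measurable fun z : (Fin t → Z × O) × (Z × O) => W t z.1 z.2) (n : ℕ)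
    (ε : Fin T → ℤˣ) : Measurable (hybridWeights B W n ε) := by
  refine measurable_pi_lambda _ fun i => ?_
  unfold hybridWeights
  split_ifs
  · exact (measurable_mult hW i).neg
  · exact measurable_const
  · exact measurable_ghostMult hW i.rev
  · exact measurable_const

/-- Replace the weights of round `j` and of its ghost. -/
def setPair (j : Fin T) (w : Fin T → ℝ) (a b : ℝ) : Fin T → ℝ :=
  Function.update (Function.update w j a) j.rev b

variable {B}

omit [MeasurableSpace X] [MeasurableSpace Z] [MeasurableSpace O] in
-- The exchange makes the points at `j` and `j.rev` trade places and changes nothing else: earlier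
-- multipliers do not see round `j`, and later rounds carry signs. Trading the two weights therefore
-- undoes it.
lemma supSum_setPair_ghostSwapAt {C : Set (X → ℝ)} (φ : Z → X)
    (W : (t : ℕ) → (Fin t → Z × O) → Z × O → ℝ) (hB : ∀ i, B i → ¬ B i.rev) {j : Fin T}
    (hj : B j) (ε : Fin T → ℤˣ) (v : Fin T → (Z × O) × Z) (a b : ℝ) :
    supSum C (setPair j (hybridWeights B W j ε (ghostSwapAt j v)) a b)
        (ghostPoints B φ (ghostSwapAt j v)) =
      supSum C (setPair j (hybridWeights B W j ε v) b a) (ghostPoints B φ v) := by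
  have hjr : j.rev ≠ j := fun h => hB j hj (h.symm ▸ hj)
  have hjrB := hB j hj
  have hne : ∀ i, i ≠ j → ghostSwapAt j v i = v i := fun i hi => Function.update_of_ne hi _ _
  unfold supSum
  congr 1
  ext c
  rw [← Equiv.sum_comp (Equiv.swap j j.rev)]
  refine Finset.sum_congr rfl fun i _ => ?_
  rcases eq_or_ne i j with rfl | hij
  · rw [Equiv.swap_apply_left]
    simp [setPair, ghostPoints, hj, hjrB, ghostSwapAt, ghostSwap, hjr.symm]
  rcases eq_or_ne i j.rev with rfl | hir
  · rw [Equiv.swap_apply_right]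
    simp [setPair, ghostPoints, hj, hjrB, ghostSwapAt, ghostSwap, hjr.symm]
  · rw [Equiv.swap_apply_of_ne_of_ne hij hir]
    have hir' : i.rev ≠ j := fun h => hir (by rw [← h, Fin.rev_rev])
    have h1 : hybridWeights B W j ε (ghostSwapAt j v) i = hybridWeights B W j ε v i := by
      unfold hybridWeights
      split_ifs with h1 h2 h3
      · rw [mult, mult, pre_ghostSwapAt h2.le, hne i hij]
      · rfl
      · rw [ghostMult, ghostMult, pre_ghostSwapAt h3.2.le, hne _ hir']
      · rfl
    have h2 : ghostPoints B φ (ghostSwapAt j v) i = ghostPoints B φ v i := by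
      unfold ghostPoints
      rw [hne i hij, hne _ hir']
    simp only [setPair, Function.update_of_ne hir, Function.update_of_ne hij, h1, h2]

lemma measurable_setPair {α : Type*} [MeasurableSpace α] (j : Fin T) {w : α → Fin T → ℝ}
    (hw : Measurable w) {a b : α → ℝ} (ha : Measurable a) (hb : Measurable b) :
    Measurable fun v => setPair j (w v) (a v) (b v) := by
  refine measurable_pi_lambda _ fun i => ?_
  unfold setPair
  rcases eq_or_ne i j.rev with rfl | h
  · simpa using hb
  rcases eq_or_ne i j with rfl | h'
  · simpa [Function.update_of_ne h] using ha
  · simpa [Function.update_of_ne h, Function.update_of_ne h', Function.comp_def] using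
      (measurable_pi_apply i).comp hw

lemma setPair_convex (j : Fin T) (w : Fin T → ℝ) {s t a b a₁ a₂ b₁ b₂ : ℝ} (hst : s + t = 1)
    (ha : a = s * a₁ + t * a₂) (hb : b = s * b₁ + t * b₂) (i : Fin T) :
    setPair j w a b i = s * setPair j w a₁ b₁ i + t * setPair j w a₂ b₂ i := by
  rcases eq_or_ne i j.rev with rfl | h
  · simpa [setPair] using hb
  rcases eq_or_ne i j with rfl | h'
  · simpa [setPair, h] using ha
  · simp only [setPair, Function.update_of_ne h, Function.update_of_ne h']
    rw [← add_mul, hst, one_mul]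

/-- Exchanging a round of multipliers for a random sign increases the moment generating
function. -/
lemma sum_lintegral_hybrid_succ_le {C : Set (X → ℝ)} (hne : C.Nonempty)
    (hC : ∀ c ∈ C, ∀ x, |c x| ≤ 2) {φ : Z → X} (hφ : Measurable φ)
    (hS : SupMeasurable (D.map φ) C T) {W : (t : ℕ) → (Fin t → Z × O) → Z × O → ℝ}
    (hW : ∀ t, Measurable fun z : (Fin t → Z × O) × (Z × O) => W t z.1 z.2)
    (hW1 : ∀ t p u, |W t p u| ≤ 1) (hB : ∀ i, B i → ¬ B i.rev) {θ : ℝ} (hθ : 0 ≤ θ)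
    {j : Fin T} (hj : B j) :
    ∑ ε, ∫⁻ v, ENNReal.ofReal (Real.exp (θ * supSum C (hybridWeights B W (j + 1) ε v)
        (ghostPoints B φ v))) ∂(Measure.pi fun _ => (D.prod P').prod D) ≤
      ∑ ε, ∫⁻ v, ENNReal.ofReal (Real.exp (θ * supSum C (hybridWeights B W j ε v)
        (ghostPoints B φ v))) ∂(Measure.pi fun _ => (D.prod P').prod D) := by
  have hjr : j.rev ≠ j := fun h => hB j hj (h.symm ▸ hj)
  have hjrB := hB j hj
  set Q : Measure (Fin T → (Z × O) × Z) := Measure.pi fun _ => (D.prod P').prod D with hQ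
  -- The hybrids `j + 1` and `j` differ only in the pair of weights at `j` and `j.rev`, so both are
  -- expressed through this pair.
  set e : (Fin T → ℤˣ) → ((Fin T → (Z × O) × Z) → ℝ) → ((Fin T → (Z × O) × Z) → ℝ) →
      (Fin T → (Z × O) × Z) → ℝ≥0∞ := fun ε a b v => ENNReal.ofReal (Real.exp (θ *
        supSum C (setPair j (hybridWeights B W j ε v) (a v) (b v)) (ghostPoints B φ v))) with he
  have hmp := measurePreserving_ghostPoints (O := O) B D P' hφ
  have heM : ∀ ε {a b}, Measurable a → Measurable b → AEMeasurable (e ε a b) Q :=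
    fun ε a b ha hb => (Real.measurable_exp.comp_aemeasurable ((aemeasurable_supSum_comp hne hC hS
      (measurable_setPair j (measurable_hybridWeights B hW j ε) ha hb)
      hmp.quasiMeasurePreserving).const_mul θ)).ennreal_ofReal
  have hsw : ∀ ε {a b}, Measurable a → Measurable b →
      ∫⁻ v, e ε a b v ∂Q = ∫⁻ v, e ε (fun v => b (ghostSwapAt j v))
        (fun v => a (ghostSwapAt j v)) v ∂Q := fun ε a b ha hb => by
    rw [← lintegral_comp_of_measurePreserving (heM ε ha hb) (measurePreserving_ghostSwapAt D P' j)]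
    refine lintegral_congr fun v => ?_
    simp only [he]
    rw [supSum_setPair_ghostSwapAt φ W hB hj]
  have hstart : ∀ ε v, setPair j (hybridWeights B W j ε v) (-mult W v j) (ghostMult W v j) =
      hybridWeights B W (j + 1) ε v := fun ε v => by
    ext i
    rcases eq_or_ne i j.rev with rfl | h
    · simp [setPair, hybridWeights, hjrB, hj]
    rcases eq_or_ne i j with rfl | h'
    · simp [setPair, hybridWeights, hj, h]
    · have h1 : ((i : ℕ) < j + 1) ↔ (i : ℕ) < j := by
        have : (i : ℕ) ≠ j := fun h => h' (Fin.ext h)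
        omega
      have h2 : ((i.rev : ℕ) < j + 1) ↔ (i.rev : ℕ) < j := by
        have : (i.rev : ℕ) ≠ j := fun h2 => h (by rw [← Fin.ext h2, Fin.rev_rev])
        omega
      simp only [setPair, Function.update_of_ne h, Function.update_of_ne h', hybridWeights, h1, h2]
  have hend : ∀ ε v, setPair j (hybridWeights B W j ε v) (2 * ((ε j : ℤ) : ℝ)) 0 =
      hybridWeights B W j ε v := fun ε v => by
    ext i
    rcases eq_or_ne i j.rev with rfl | h
    · simp [setPair, hybridWeights, hjrB]
    rcases eq_or_ne i j with rfl | h'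
    · simp [setPair, hybridWeights, hj, h]
    · simp only [setPair, Function.update_of_ne h, Function.update_of_ne h']
  -- Once the pair is set, the sign of round `j` no longer enters. The weights `2` and `-2` thus
  -- belong to `ε` and its flip, in some order, and flipping permutes the sum over all signs.
  let flip : (Fin T → ℤˣ) → (Fin T → ℤˣ) := fun ε => Function.update ε j (-ε j)
  have hflip : Function.Involutive flip := fun ε => by simp [flip]
  have hflipw : ∀ ε v a b, setPair j (hybridWeights B W j (flip ε) v) a b =
      setPair j (hybridWeights B W j ε v) a b := fun ε v a b => by
    ext i
    rcases eq_or_ne i j.rev with rfl | h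
    · simp [setPair]
    rcases eq_or_ne i j with rfl | h'
    · simp [setPair, h]
    · simp only [setPair, Function.update_of_ne h, Function.update_of_ne h', hybridWeights, flip]
  have hconv : ∀ ε v {s t a b a₁ a₂ b₁ b₂ : ℝ}, 0 ≤ s → 0 ≤ t → s + t = 1 →
      a = s * a₁ + t * a₂ → b = s * b₁ + t * b₂ →
      Real.exp (θ * supSum C (setPair j (hybridWeights B W j ε v) a b) (ghostPoints B φ v)) ≤
      s * Real.exp (θ * supSum C (setPair j (hybridWeights B W j ε v) a₁ b₁) (ghostPoints B φ v)) +
      t * Real.exp (θ * supSum C (setPair j (hybridWeights B W j ε v) a₂ b₂) (ghostPoints B φ v)) :=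
    fun ε v s t a b a₁ a₂ b₁ b₂ hs ht hst ha hb =>
      exp_supSum_convex hne hC hθ hs ht hst (setPair_convex j _ hst ha hb) _
  -- The pair `(-p, q)` is the midpoint of `(-2p, 0)` and `(0, 2q)`, each a mixture of extreme pairs
  -- `±2`. The mixing weights `(1 ± p)/2` and `(1 ± q)/2` depend on the data, but adding the
  -- reflected pair `(p, -q)` makes them sum to `1`, so the multipliers disappear pointwise.
  have hpt : ∀ ε v, 2 * e ε (fun v => -mult W v j) (fun v => ghostMult W v j) v +
      2 * e ε (fun v => mult W v j) (fun v => -ghostMult W v j) v ≤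
      (e ε (fun _ => 2) (fun _ => 0) v + e ε (fun _ => -2) (fun _ => 0) v) +
      (e ε (fun _ => 0) (fun _ => 2) v + e ε (fun _ => 0) (fun _ => -2) v) := fun ε v => by
    simp only [he]
    rw [show (2 : ℝ≥0∞) = ENNReal.ofReal 2 by simp]
    simp_rw [← ENNReal.ofReal_mul (zero_le_two (α := ℝ))]
    repeat rw [← ENNReal.ofReal_add (by positivity) (by positivity)]
    refine ENNReal.ofReal_le_ofReal ?_
    have b0 : |mult W v j| ≤ 1 := hW1 _ _ _
    have b1 : |ghostMult W v j| ≤ 1 := hW1 _ _ _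
    generalize mult W v j = p at b0
    generalize ghostMult W v j = q at b1
    rw [abs_le] at b0 b1
    have half : (0 : ℝ) ≤ 1 / 2 := by norm_num
    have h1 := hconv ε v (a := -p) (b := q) (a₁ := -2 * p) (b₁ := 0) (a₂ := 0) (b₂ := 2 * q)
      half half (by norm_num) (by ring) (by ring)
    have h2 := hconv ε v (a := p) (b := -q) (a₁ := 2 * p) (b₁ := 0) (a₂ := 0) (b₂ := -2 * q)
      half half (by norm_num) (by ring) (by ring)
    have h3 := hconv ε v (s := (1 + p) / 2) (t := (1 - p) / 2) (a := 2 * p) (b := 0) (a₁ := 2)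
      (b₁ := 0) (a₂ := -2) (b₂ := 0) (by linarith) (by linarith) (by ring) (by ring) (by ring)
    have h4 := hconv ε v (s := (1 - p) / 2) (t := (1 + p) / 2) (a := -2 * p) (b := 0) (a₁ := 2)
      (b₁ := 0) (a₂ := -2) (b₂ := 0) (by linarith) (by linarith) (by ring) (by ring) (by ring)
    have h5 := hconv ε v (s := (1 + q) / 2) (t := (1 - q) / 2) (b := 2 * q) (a := 0) (b₁ := 2)
      (a₁ := 0) (b₂ := -2) (a₂ := 0) (by linarith) (by linarith) (by ring) (by ring) (by ring)
    have h6 := hconv ε v (s := (1 - q) / 2) (t := (1 + q) / 2) (b := -2 * q) (a := 0) (b₁ := 2)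
      (a₁ := 0) (b₂ := -2) (a₂ := 0) (by linarith) (by linarith) (by ring) (by ring) (by ring)
    linarith
  have hmm := measurable_mult hW j
  have hgm := measurable_ghostMult hW j
  have hmn : Measurable fun v : Fin T → (Z × O) × Z => -mult W v j := hmm.neg
  have hgn : Measurable fun v : Fin T → (Z × O) × Z => -ghostMult W v j := hgm.neg
  -- Under the swap the reflected pair has the same integral as the original one, and `(0, ±2)` the
  -- same as `(±2, 0)`; a common factor `2` then cancels.
  have key : ∀ ε, 2 * ∫⁻ v, e ε (fun v => -mult W v j) (fun v => ghostMult W v j) v ∂Q ≤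
      ∫⁻ v, e ε (fun _ => 2) (fun _ => 0) v ∂Q + ∫⁻ v, e ε (fun _ => -2) (fun _ => 0) v ∂Q := by
    intro ε
    have h1 := lintegral_mono (μ := Q) (hpt ε)
    have hconst : ∀ a b : ℝ, AEMeasurable (e ε (fun _ => a) (fun _ => b)) Q := fun a b =>
      heM ε measurable_const measurable_const
    have hsum : AEMeasurable (fun v => e ε (fun _ => 2) (fun _ => 0) v +
        e ε (fun _ => -2) (fun _ => 0) v) Q := (hconst 2 0).add (hconst (-2) 0)
    rw [lintegral_add_left' ((heM ε hmn hgm).const_mul 2),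
      lintegral_const_mul'' _ (heM ε hmn hgm), lintegral_const_mul'' _ (heM ε hmm hgn),
      lintegral_add_left' hsum, lintegral_add_left' (hconst 2 0),
      lintegral_add_left' (hconst 0 2), hsw ε hmm hgn, hsw ε (a := fun _ => 0) measurable_const measurable_const,
      hsw ε (a := fun _ => 0) (b := fun _ => -2) measurable_const measurable_const] at h1
    simp only [mult_ghostSwapAt, ghostMult_ghostSwapAt, ← two_mul] at h1
    exact (ENNReal.mul_le_mul_iff_right two_ne_zero ENNReal.ofNat_ne_top).1 h1
  have hE : ∀ ε, ∫⁻ v, e ε (fun _ => 2) (fun _ => 0) v ∂Q +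
      ∫⁻ v, e ε (fun _ => -2) (fun _ => 0) v ∂Q =
      ∫⁻ v, ENNReal.ofReal (Real.exp (θ * supSum C (hybridWeights B W j ε v)
        (ghostPoints B φ v))) ∂Q +
      ∫⁻ v, ENNReal.ofReal (Real.exp (θ * supSum C (hybridWeights B W j (flip ε) v)
        (ghostPoints B φ v))) ∂Q := fun ε => by
    have h2 : ∀ ε', ∫⁻ v, ENNReal.ofReal (Real.exp (θ * supSum C (hybridWeights B W j ε' v)
        (ghostPoints B φ v))) ∂Q = ∫⁻ v, e ε' (fun _ => 2 * ((ε' j : ℤ) : ℝ)) (fun _ => 0) v ∂Q :=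
      fun ε' => by simp only [he, hend]
    have h3 : ∀ a b, e (flip ε) a b = e ε a b := fun a b => by
      funext v
      simp only [he, hflipw]
    rw [h2, h2, h3]
    rcases Int.units_eq_one_or (ε j) with h | h
    · simp [flip, h]
    · rw [add_comm]
      simp [flip, h]
  have hfin : 2 * ∑ ε, ∫⁻ v, e ε (fun v => -mult W v j) (fun v => ghostMult W v j) v ∂Q ≤
      2 * ∑ ε, ∫⁻ v, ENNReal.ofReal (Real.exp (θ * supSum C (hybridWeights B W j ε v)
        (ghostPoints B φ v))) ∂Q := by
    rw [Finset.mul_sum]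
    refine (Finset.sum_le_sum fun ε _ => (key ε).trans_eq (hE ε)).trans_eq ?_
    rw [Finset.sum_add_distrib, two_mul]
    congr 1
    exact Equiv.sum_comp hflip.toPerm (fun ε => ∫⁻ v, ENNReal.ofReal (Real.exp (θ *
      supSum C (hybridWeights B W j ε v) (ghostPoints B φ v))) ∂Q)
  have hfin' := (ENNReal.mul_le_mul_iff_right two_ne_zero ENNReal.ofNat_ne_top).1 hfin
  simp only [he, hstart] at hfin'
  exact hfin'

end Ghost

/-! ### Uniform convergence -/

section Update

variable {Y : Type*} [MeasurableSpace Y] (μ : Measure Y) [IsProbabilityMeasure μ]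

/-- Needed because bounded differences hold only almost everywhere: the modified sample must avoid
the exceptional null set too. -/
lemma measurePreserving_update {T : ℕ} (i : Fin T) :
    MeasurePreserving (fun p : (Fin T → Y) × Y => Function.update p.1 i p.2)
      ((Measure.pi fun _ => μ).prod μ) (Measure.pi fun _ => μ) := by
  have hm : Measurable fun p : (Fin T → Y) × Y => Function.update p.1 i p.2 := by
    refine measurable_pi_lambda _ fun k => ?_
    rcases eq_or_ne k i with rfl | h
    · simpa using measurable_snd
    · simpa [Function.update_of_ne h, Function.comp_def] using
        (measurable_pi_apply k).comp measurable_fst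
  refine ⟨hm, (Measure.pi_eq fun s hs => ?_).symm⟩
  rw [Measure.map_apply hm (MeasurableSet.univ_pi hs)]
  have hpre : (fun p : (Fin T → Y) × Y => Function.update p.1 i p.2) ⁻¹' (Set.univ.pi s) =
      (Set.univ.pi fun k => if k = i then Set.univ else s k) ×ˢ s i := by
    ext p
    simp only [Set.mem_preimage, Set.mem_univ_pi, Set.mem_prod]
    constructor
    · refine fun h => ⟨fun k => ?_, by simpa using h i⟩
      split_ifs with hk
      · trivial
      · simpa [Function.update_of_ne hk] using h k
    · rintro ⟨h1, h2⟩ k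
      rcases eq_or_ne k i with rfl | hk
      · simpa using h2
      · simpa [Function.update_of_ne hk, hk] using h1 k
  rw [hpre, Measure.prod_prod, Measure.pi_pi, ← Finset.prod_erase_mul _ _ (Finset.mem_univ i),
    ← Finset.prod_erase_mul Finset.univ (fun k => μ (s k)) (Finset.mem_univ i), if_pos rfl, measure_univ, mul_one]
  congr 1
  refine Finset.prod_congr rfl fun k hk => ?_
  rw [if_neg (Finset.ne_of_mem_erase hk)]

end Update

/-! ### Uniform random signs -/

section Signs

instance : MeasurableSingletonClass ℤˣ :=
  ⟨fun u => ⟨{(u : ℤ)}, measurableSet_singleton _, by ext v; simp [Units.ext_iff]⟩⟩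

/-- The uniform distribution on signs. -/
def signMeasure : Measure ℤˣ := (2 : ℝ≥0∞)⁻¹ • Measure.count

lemma signMeasure_singleton (s : ℤˣ) : signMeasure {s} = 2⁻¹ := by
  simp [signMeasure]

instance : IsProbabilityMeasure signMeasure :=
  ⟨by
    simp [signMeasure, Measure.count_univ, ENat.card_eq_coe_fintype_card,
      ENNReal.inv_mul_cancel]⟩

variable {X : Type*} [MeasurableSpace X] (μ : Measure X) [IsProbabilityMeasure μ] {T : ℕ}

lemma integral_signs {F : (Fin T → ℤˣ) → (Fin T → X) → ℝ} (hF : ∀ ε, Measurable (F ε)) {B : ℝ}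
    (hB : ∀ ε x, |F ε x| ≤ B) :
    ∫ y, F (fun i => (y i).2) (fun i => (y i).1) ∂(Measure.pi fun _ => μ.prod signMeasure) =
      (∑ ε, ∫ x, F ε x ∂(Measure.pi fun _ => μ)) / 2 ^ T := by
  have hm : Measurable fun p : (Fin T → X) × (Fin T → ℤˣ) => F p.2 p.1 :=
    measurable_from_prod_countable_left fun ε => hF ε
  have hmp := measurePreserving_arrowProdEquivProdArrow X ℤˣ (Fin T) (fun _ => μ)
    (fun _ => signMeasure)
  have h1 := integral_map (μ := Measure.pi fun _ => μ.prod signMeasure) hmp.measurable.aemeasurable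
    (f := fun p : (Fin T → X) × (Fin T → ℤˣ) => F p.2 p.1) hm.aestronglyMeasurable
  rw [hmp.map_eq] at h1
  refine h1.symm.trans ?_
  rw [integral_prod_symm _ (integrable_of_abs_le hm fun p => hB p.2 p.1), integral_fintype,
    Finset.sum_div]
  · refine Finset.sum_congr rfl fun ε _ => ?_
    have : (Measure.pi fun _ : Fin T => signMeasure).real {ε} = (2 ^ T)⁻¹ := by
      rw [measureReal_def, ← Set.univ_pi_singleton, Measure.pi_pi]
      simp [signMeasure_singleton]
    rw [this, smul_eq_mul, div_eq_inv_mul]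
  · exact Integrable.of_finite

end Signs

/-! ### Exponential moments of Rademacher suprema -/

section Rademacher

variable {X : Type*} [MeasurableSpace X] {C : Set (X → ℝ)} (μ : Measure X)
  [IsProbabilityMeasure μ] {T : ℕ}

/-- McDiarmid in the `T` independent pairs (point, sign): changing one pair moves the supremum by at
most `4`, whence `4²κ²/2 = 8κ²` per round, and the mean is `T * rad`. Summing over signs instead of
averaging gives the factor `2 ^ T`. -/
lemma sum_lintegral_exp_supSum_signs_le (hne : C.Nonempty) (hC : ∀ c ∈ C, ∀ x, |c x| ≤ 2)
    (hS : SupMeasurable μ C T) (hT : 0 < T) (κ : ℝ) :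
    ∑ ε : Fin T → ℤˣ, ∫⁻ x, ENNReal.ofReal (Real.exp (κ * supSum C (fun i => ((ε i : ℤ) : ℝ)) x))
        ∂(Measure.pi fun _ => μ) ≤
      2 ^ T * ENNReal.ofReal (Real.exp (κ * (T * rad μ C T) + T * (8 * κ ^ 2))) := by
  obtain ⟨G, hG, hGae, hm⟩ := exists_measurable_indicator_supSum hne hC hS
  set F : (Fin T → ℤˣ) → (Fin T → X) → ℝ := fun ε x =>
    G.indicator (supSum C (fun i => ((ε i : ℤ) : ℝ))) x with hFdef
  have hFm : ∀ ε, Measurable (F ε) := fun ε => hm.comp measurable_prodMk_left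
  have hFG : ∀ ε x, x ∈ G → F ε x = supSum C (fun i => ((ε i : ℤ) : ℝ)) x := fun ε x hx =>
    Set.indicator_of_mem hx _
  have hsgn : ∀ s : ℤˣ, |((s : ℤ) : ℝ)| = 1 := fun s => by
    rcases Int.units_eq_one_or s with rfl | rfl <;> simp
  have hFB : ∀ ε x, |F ε x| ≤ 2 * T := fun ε x => by
    by_cases hx : x ∈ G
    · rw [hFG ε x hx]
      refine (abs_supSum_le hne hC _ x).trans_eq ?_
      simp [hsgn]
    · simp only [hFdef, Set.indicator_of_notMem hx, abs_zero]
      positivity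
  have hfm : Measurable fun y : Fin T → X × ℤˣ => F (fun i => (y i).2) (fun i => (y i).1) := by
    have hm' : Measurable fun p : (Fin T → X) × (Fin T → ℤˣ) => F p.2 p.1 :=
      measurable_from_prod_countable_left fun ε => hFm ε
    exact hm'.comp (MeasurableEquiv.arrowProdEquivProdArrow X ℤˣ (Fin T)).measurable
  have hfst : MeasurePreserving (fun (y : Fin T → X × ℤˣ) i => (y i).1)
      (Measure.pi fun _ => μ.prod signMeasure) (Measure.pi fun _ => μ) :=
    measurePreserving_pi _ _ fun _ => measurePreserving_fst
  have hdiff : ∀ i : Fin T, ∀ᵐ p ∂(Measure.pi fun _ : Fin T => μ.prod signMeasure).prod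
      (μ.prod signMeasure),
      |F (fun k => (p.1 k).2) (fun k => (p.1 k).1) -
        F (fun k => (Function.update p.1 i p.2 k).2) (fun k => (Function.update p.1 i p.2 k).1)|
        ≤ 4 := fun i => by
    have h1 := (hfst.comp measurePreserving_fst).quasiMeasurePreserving.ae (μa :=
      (Measure.pi fun _ : Fin T => μ.prod signMeasure).prod (μ.prod signMeasure)) hGae
    have h2 := (hfst.comp (measurePreserving_update (μ.prod signMeasure) i)).quasiMeasurePreserving.ae
      hGae
    filter_upwards [h1, h2] with p hp1 hp2
    simp only [Function.comp_apply] at hp1 hp2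
    rw [hFG _ _ hp1, hFG _ _ hp2, abs_sub_le_iff]
    have key : ∀ y y' : Fin T → X × ℤˣ, (∀ k, k ≠ i → y k = y' k) →
        supSum C (fun k => (((y k).2 : ℤ) : ℝ)) (fun k => (y k).1) -
        supSum C (fun k => (((y' k).2 : ℤ) : ℝ)) (fun k => (y' k).1) ≤ 4 := fun y y' h => by
      rw [sub_le_iff_le_add']
      refine supSum_le hne fun c hc => ?_
      have h3 := le_supSum hC hc (fun k => (((y' k).2 : ℤ) : ℝ)) (fun k => (y' k).1)
      rw [← Finset.add_sum_erase _ _ (Finset.mem_univ i)] at h3 ⊢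
      have h4 : ∑ k ∈ Finset.univ.erase i, (((y k).2 : ℤ) : ℝ) * c (y k).1 =
          ∑ k ∈ Finset.univ.erase i, (((y' k).2 : ℤ) : ℝ) * c (y' k).1 :=
        Finset.sum_congr rfl fun k hk => by rw [h k (Finset.ne_of_mem_erase hk)]
      have h5 : ∀ z : X × ℤˣ, |((z.2 : ℤ) : ℝ) * c z.1| ≤ 2 := fun z => by
        rw [abs_mul, hsgn, one_mul]
        exact hC c hc _
      have h6 := abs_le.1 (h5 (y i))
      have h7 := abs_le.1 (h5 (y' i))
      linarith
    exact ⟨key _ _ fun k hk => by simp [Function.update_of_ne hk],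
      key _ _ fun k hk => by simp [Function.update_of_ne hk]⟩
  have hmc := integral_exp_le_of_boundedDifferences (μ.prod signMeasure) hfm
    (fun y => hFB _ _) hdiff κ
  rw [integral_signs μ (F := fun ε x => Real.exp (κ * F ε x))
    (fun ε => Real.measurable_exp.comp ((hFm ε).const_mul κ)) (B := Real.exp (|κ| * (2 * T)))
    (fun ε x => by
      rw [Real.abs_exp]
      refine Real.exp_le_exp.2 ((le_abs_self _).trans ?_)
      rw [abs_mul]
      exact mul_le_mul_of_nonneg_left (hFB ε x) (abs_nonneg _)), integral_signs μ hFm hFB] at hmc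
  have hrad : (∑ ε, ∫ x, F ε x ∂(Measure.pi fun _ : Fin T => μ)) / 2 ^ T = T * rad μ C T := by
    have hT' : (T : ℝ) ≠ 0 := by positivity
    have h1 : rad μ C T = ∫ x, (∑ ε, (1 / (T : ℝ)) * F ε x) / 2 ^ T
        ∂(Measure.pi fun _ : Fin T => μ) := by
      refine integral_congr_ae ?_
      filter_upwards [hGae] with x hx
      simp only [empRad, hFG _ _ hx]
      congr 1
      refine Finset.sum_congr rfl fun ε _ => ?_
      rw [supSum, Real.mul_iSup_of_nonneg (by positivity)]
    rw [h1, integral_div, integral_finsetSum _ fun ε _ =>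
      (integrable_of_abs_le (hFm ε) (hFB ε)).const_mul _]
    simp_rw [integral_const_mul]
    rw [← Finset.mul_sum]
    field_simp
  rw [hrad, div_le_iff₀ (by positivity)] at hmc
  have hlin : ∀ ε : Fin T → ℤˣ,
      ∫⁻ x, ENNReal.ofReal (Real.exp (κ * supSum C (fun i => ((ε i : ℤ) : ℝ)) x))
        ∂(Measure.pi fun _ => μ) =
      ENNReal.ofReal (∫ x, Real.exp (κ * F ε x) ∂(Measure.pi fun _ => μ)) := fun ε => by
    rw [ofReal_integral_eq_lintegral_ofReal (integrable_exp_of_abs_le (hFm ε) (hFB ε) κ)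
      (Filter.Eventually.of_forall fun _ => (Real.exp_pos _).le)]
    refine lintegral_congr_ae ?_
    filter_upwards [hGae] with x hx
    rw [hFG _ _ hx]
  simp_rw [hlin]
  rw [← ENNReal.ofReal_sum_of_nonneg fun ε _ => integral_nonneg fun _ => (Real.exp_pos _).le]
  refine (ENNReal.ofReal_le_ofReal hmc).trans_eq ?_
  rw [ENNReal.ofReal_mul (Real.exp_pos _).le, mul_comm, ENNReal.ofReal_pow zero_le_two]
  congr 3
  · simp
  · ring_nf

end Rademacher

/-! ### From the hybrids to a tail bound -/

section UniformConvergence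

variable {X Z O : Type*} [MeasurableSpace X] [MeasurableSpace Z] [MeasurableSpace O] {T : ℕ}
  {B : Fin T → Prop} [DecidablePred B]
  (D : Measure Z) [IsProbabilityMeasure D] (P' : Measure O) [IsProbabilityMeasure P']
  {C : Set (X → ℝ)}

omit [MeasurableSpace Z] [MeasurableSpace O] in
lemma hybridWeights_succ_of_not (W : (t : ℕ) → (Fin t → Z × O) → Z × O → ℝ) {n : ℕ}
    (hn : n < T) (hj : ¬ B ⟨n, hn⟩) (ε : Fin T → ℤˣ) (v : Fin T → (Z × O) × Z) :
    hybridWeights B W (n + 1) ε v = hybridWeights B W n ε v := by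
  have h1 : ∀ i : Fin T, B i → ((i : ℕ) < n + 1 ↔ (i : ℕ) < n) := fun i hi => by
    have h : (i : ℕ) ≠ n := by
      rintro rfl
      exact hj hi
    omega
  funext i
  by_cases hi : B i
  · simp only [hybridWeights, hi, h1 i hi, if_true]
  · by_cases hr : B i.rev
    · simp only [hybridWeights, hi, hr, h1 _ hr, if_false, true_and]
    · simp only [hybridWeights, hi, hr, false_and, if_false]

lemma sum_lintegral_hybrid_le (hne : C.Nonempty)
    (hC : ∀ c ∈ C, ∀ x, |c x| ≤ 2) {φ : Z → X} (hφ : Measurable φ)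
    (hS : SupMeasurable (D.map φ) C T) {W : (t : ℕ) → (Fin t → Z × O) → Z × O → ℝ}
    (hW : ∀ t, Measurable fun z : (Fin t → Z × O) × (Z × O) => W t z.1 z.2)
    (hW1 : ∀ t p u, |W t p u| ≤ 1) (hB : ∀ i, B i → ¬ B i.rev) {θ : ℝ} (hθ : 0 ≤ θ)
    {n : ℕ} (hn : n ≤ T) :
    ∑ ε, ∫⁻ v, ENNReal.ofReal (Real.exp (θ * supSum C (hybridWeights B W n ε v)
        (ghostPoints B φ v))) ∂(Measure.pi fun _ => (D.prod P').prod D) ≤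
      ∑ ε, ∫⁻ v, ENNReal.ofReal (Real.exp (θ * supSum C (hybridWeights B W 0 ε v)
        (ghostPoints B φ v))) ∂(Measure.pi fun _ => (D.prod P').prod D) := by
  induction n with
  | zero => exact le_rfl
  | succ n ih =>
    refine le_trans ?_ (ih (by omega))
    by_cases hj : B ⟨n, hn⟩
    · have key := sum_lintegral_hybrid_succ_le (j := ⟨n, hn⟩) D P' hne hC hφ hS hW hW1 hB hθ hj
      simp only at key
      exact key
    · simp_rw [hybridWeights_succ_of_not W hn hj]
      exact le_rfl

end UniformConvergence

section UniformConvergence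

variable {X Z O : Type*} [MeasurableSpace X] [MeasurableSpace Z] [MeasurableSpace O] {T : ℕ}
  {B : Fin T → Prop} [DecidablePred B]
  (D : Measure Z) [IsProbabilityMeasure D] (P' : Measure O) [IsProbabilityMeasure P']
  {C : Set (X → ℝ)}

/-- The weight `0` outside `B` is the midpoint of `2` and `-2` times a sign, so by convexity these
positions can be filled with signs. Flipping signs outside `B` permutes all sign vectors, and the
factor `2` moves into the exponent. -/
lemma sum_lintegral_hybrid_zero_le (hne : C.Nonempty) (hC : ∀ c ∈ C, ∀ x, |c x| ≤ 2) {φ : Z → X}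
    (hφ : Measurable φ) (hS : SupMeasurable (D.map φ) C T)
    (W : (t : ℕ) → (Fin t → Z × O) → Z × O → ℝ) {θ : ℝ} (hθ : 0 ≤ θ) :
    ∑ ε, ∫⁻ v, ENNReal.ofReal (Real.exp (θ * supSum C (hybridWeights B W 0 ε v)
        (ghostPoints B φ v))) ∂(Measure.pi fun _ => (D.prod P').prod D) ≤
      ∑ ε : Fin T → ℤˣ, ∫⁻ x, ENNReal.ofReal
        (Real.exp (2 * θ * supSum C (fun i => ((ε i : ℤ) : ℝ)) x))
        ∂(Measure.pi fun _ => D.map φ) := by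
  have : IsProbabilityMeasure (D.map φ) := Measure.isProbabilityMeasure_map hφ.aemeasurable
  have hmp := measurePreserving_ghostPoints (O := O) B D P' hφ
  have hmeas : ∀ w : Fin T → ℝ, ∀ κ : ℝ, AEMeasurable (fun x => ENNReal.ofReal
      (Real.exp (κ * supSum C w x))) (Measure.pi fun _ => D.map φ) := fun w κ =>
    (Real.measurable_exp.comp_aemeasurable ((show AEMeasurable (supSum C w) _ from
      hS w).const_mul κ)).ennreal_ofReal
  let flip : (Fin T → ℤˣ) → (Fin T → ℤˣ) := fun ε i => if B i then ε i else -ε i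
  have hflip : Function.Involutive flip := fun ε => by
    funext i
    by_cases h : B i <;> simp [flip, h]
  set E : (Fin T → ℤˣ) → ℝ≥0∞ := fun ε => ∫⁻ x, ENNReal.ofReal
    (Real.exp (2 * θ * supSum C (fun i => ((ε i : ℤ) : ℝ)) x))
        ∂(Measure.pi fun _ => D.map φ) with hE
  have hterm : ∀ ε : Fin T → ℤˣ, 2 * ∫⁻ v, ENNReal.ofReal (Real.exp (θ *
      supSum C (hybridWeights B W 0 ε v) (ghostPoints B φ v)))
        ∂(Measure.pi fun _ => (D.prod P').prod D) ≤ E ε + E (flip ε) := fun ε => by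
    have hw : ∀ v, hybridWeights B W 0 ε v = fun i => if B i then 2 * ((ε i : ℤ) : ℝ) else 0 :=
      fun v => by
        funext i
        by_cases h : B i <;> simp [hybridWeights, h]
    simp_rw [hw]
    rw [lintegral_comp_of_measurePreserving (f := fun x => ENNReal.ofReal (Real.exp (θ *
      supSum C (fun i => if B i then 2 * ((ε i : ℤ) : ℝ) else 0) x))) (hmeas _ θ) hmp,
      hE, ← lintegral_add_left' (hmeas _ _), ← lintegral_const_mul'' _ (hmeas _ _)]
    refine lintegral_mono fun x => ?_
    simp only
    rw [show (2 : ℝ≥0∞) = ENNReal.ofReal 2 by simp, ← ENNReal.ofReal_mul zero_le_two,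
      ← ENNReal.ofReal_add (Real.exp_pos _).le (Real.exp_pos _).le]
    refine ENNReal.ofReal_le_ofReal ?_
    have h1 := exp_supSum_convex hne hC hθ (a := 1 / 2) (b := 1 / 2) (by norm_num) (by norm_num)
      (by norm_num) (w := fun i => if B i then 2 * ((ε i : ℤ) : ℝ) else 0)
      (w₁ := fun i => 2 * ((ε i : ℤ) : ℝ)) (w₂ := fun i => 2 * ((flip ε i : ℤ) : ℝ)) (fun i => by
        by_cases h : B i
        · simp [flip, h]
          ring
        · simp [flip, h]) x
    rw [supSum_const_mul zero_le_two, supSum_const_mul zero_le_two] at h1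
    rw [mul_assoc, mul_assoc, mul_left_comm 2 θ, mul_left_comm 2 θ]
    linarith
  have hsum : 2 * ∑ ε, ∫⁻ v, ENNReal.ofReal (Real.exp (θ *
      supSum C (hybridWeights B W 0 ε v) (ghostPoints B φ v)))
        ∂(Measure.pi fun _ => (D.prod P').prod D) ≤ 2 * ∑ ε, E ε := by
    rw [Finset.mul_sum]
    refine (Finset.sum_le_sum fun ε _ => hterm ε).trans_eq ?_
    rw [Finset.sum_add_distrib, two_mul]
    congr 1
    exact Equiv.sum_comp hflip.toPerm E
  exact (ENNReal.mul_le_mul_iff_right two_ne_zero ENNReal.ofNat_ne_top).1 hsum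

omit [MeasurableSpace X] [MeasurableSpace Z] [MeasurableSpace O] in
-- Reindexing by reversal brings each ghost term, stored outside `B`, back to its own round.
lemma sum_hybridWeights_mul (hB : ∀ i, B i → ¬ B i.rev)
    (W : (t : ℕ) → (Fin t → Z × O) → Z × O → ℝ) (φ : Z → X) (c : X → ℝ) (ε : Fin T → ℤˣ)
    (v : Fin T → (Z × O) × Z) :
    ∑ i, hybridWeights B W T ε v i * c (ghostPoints B φ v i) =
      ∑ i, if B i then ghostMult W v i * c (φ (v i).2) - mult W v i * c (φ (v i).1.1) else 0 := by
  have h1 : ∀ i, hybridWeights B W T ε v i * c (ghostPoints B φ v i) =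
      (if B i then -(mult W v i * c (φ (v i).1.1)) else 0) +
        if B i.rev then ghostMult W v i.rev * c (φ (v i.rev).2) else 0 := fun i => by
    by_cases h : B i
    · simp [hybridWeights, ghostPoints, h, hB i h]
    · by_cases h' : B i.rev
      · simp only [hybridWeights, ghostPoints, h, h', Fin.is_lt]
        simp
      · simp [hybridWeights, h, h']
  have h2 : ∑ i : Fin T, (if B i.rev then ghostMult W v i.rev * c (φ (v i.rev).2) else 0) =
      ∑ i : Fin T, if B i then ghostMult W v i * c (φ (v i).2) else 0 :=
    Equiv.sum_comp Fin.revPerm (fun i => if B i then ghostMult W v i * c (φ (v i).2) else 0)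
  simp_rw [h1]
  rw [Finset.sum_add_distrib, h2, ← Finset.sum_add_distrib]
  refine Finset.sum_congr rfl fun i _ => ?_
  by_cases h : B i
  · simp only [h, if_true]
    ring
  · simp [h]

/-- Uniform convergence over `C` for adaptive multipliers, on the rounds of `B`. -/
lemma measure_exists_sum_ge_le (hT : 0 < T) (hne : C.Nonempty) (hC : ∀ c ∈ C, ∀ x, |c x| ≤ 2)
    (hCm : ∀ c ∈ C, Measurable c) {φ : Z → X} (hφ : Measurable φ)
    (hS : SupMeasurable (D.map φ) C T) {W : (t : ℕ) → (Fin t → Z × O) → Z × O → ℝ}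
    (hW : ∀ t, Measurable fun z : (Fin t → Z × O) × (Z × O) => W t z.1 z.2)
    (hW1 : ∀ t p u, |W t p u| ≤ 1) (hB : ∀ i, B i → ¬ B i.rev) {θ : ℝ} (hθ : 0 ≤ θ) (a : ℝ) :
    (Measure.pi fun _ : Fin T => D.prod P') {u | ∃ c ∈ C, a ≤ ∑ i, if B i then
      (∫ z, W i (pre u i) (z, (u i).2) * c (φ z) ∂D) - W i (pre u i) (u i) * c (φ (u i).1) else 0}
      ≤ ENNReal.ofReal (Real.exp (2 * θ * (T * rad (D.map φ) C T) + T * (32 * θ ^ 2) - θ * a)) := by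
  have : IsProbabilityMeasure (D.map φ) := Measure.isProbabilityMeasure_map hφ.aemeasurable
  -- At `n = T` no round carries a sign, so the sign vector `1` is a dummy.
  set Ψ : (Fin T → (Z × O) × Z) → ℝ≥0∞ := fun v => ENNReal.ofReal (Real.exp (θ *
    supSum C (hybridWeights B W T 1 v) (ghostPoints B φ v))) with hΨ
  have hΨm : AEMeasurable Ψ (Measure.pi fun _ => (D.prod P').prod D) :=
    (Real.measurable_exp.comp_aemeasurable ((aemeasurable_supSum_comp hne hC hS
      (measurable_hybridWeights B hW T 1) (measurePreserving_ghostPoints (O := O) B D P'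
        hφ).quasiMeasurePreserving).const_mul θ)).ennreal_ofReal
  have hmain : ∫⁻ v, Ψ v ∂(Measure.pi fun _ => (D.prod P').prod D) ≤
      ENNReal.ofReal (Real.exp (2 * θ * (T * rad (D.map φ) C T) + T * (32 * θ ^ 2))) := by
    have h1 := ((sum_lintegral_hybrid_le D P' hne hC hφ hS hW hW1 hB hθ le_rfl).trans
      (sum_lintegral_hybrid_zero_le D P' hne hC hφ hS W hθ)).trans
      (sum_lintegral_exp_supSum_signs_le (D.map φ) hne hC hS hT (2 * θ))
    have h2 : ∀ ε v, hybridWeights B W T ε v = hybridWeights B W T 1 v := fun ε v => by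
      funext i
      simp [hybridWeights]
    simp_rw [h2] at h1
    rw [Finset.sum_const, Finset.card_univ, Fintype.card_fun, Fintype.card_fin,
      show Fintype.card ℤˣ = 2 from rfl, nsmul_eq_mul, Nat.cast_pow, Nat.cast_ofNat,
      ENNReal.mul_le_mul_iff_right (by simp) (by simp)] at h1
    refine h1.trans_eq ?_
    congr 3
    ring
  have he := (measurePreserving_arrowProdEquivProdArrow (Z × O) Z (Fin T) (fun _ => D.prod P')
    (fun _ => D)).symm
  set e := (MeasurableEquiv.arrowProdEquivProdArrow (Z × O) Z (Fin T)).symm with hedef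
  have hgm : AEMeasurable (fun p => Ψ (e p))
      ((Measure.pi fun _ : Fin T => D.prod P').prod (Measure.pi fun _ : Fin T => D)) :=
    hΨm.comp_quasiMeasurePreserving he.quasiMeasurePreserving
  have hprod : ∫⁻ u, ∫⁻ z', Ψ (e (u, z')) ∂(Measure.pi fun _ : Fin T => D)
      ∂(Measure.pi fun _ : Fin T => D.prod P') ≤
      ENNReal.ofReal (Real.exp (2 * θ * (T * rad (D.map φ) C T) + T * (32 * θ ^ 2))) := by
    rw [← lintegral_prod _ hgm, lintegral_comp_of_measurePreserving hΨm he]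
    exact hmain
  -- Markov is applied to the average over ghosts, a function of `u` alone. The event with `∃ c`
  -- need not be measurable; it is only covered by a superlevel set.
  have hmarkov := (mul_meas_ge_le_lintegral₀ hgm.lintegral_prod_right'
    (ENNReal.ofReal (Real.exp (θ * a)))).trans hprod
  have hsub : {u : Fin T → Z × O | ∃ c ∈ C, a ≤ ∑ i, if B i then
      (∫ z, W i (pre u i) (z, (u i).2) * c (φ z) ∂D) - W i (pre u i) (u i) * c (φ (u i).1) else 0}
      ⊆ {u | ENNReal.ofReal (Real.exp (θ * a)) ≤
        ∫⁻ z', Ψ (e (u, z')) ∂(Measure.pi fun _ : Fin T => D)} := by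
    rintro u ⟨c, hc, hca⟩
    have hcm := hCm c hc
    have hWm : ∀ i : Fin T, Measurable fun z => W i (pre u i) (z, (u i).2) * c (φ z) := fun i =>
      ((hW i).comp (measurable_const.prodMk (measurable_id.prodMk measurable_const))).mul
        (hcm.comp hφ)
    have hWB : ∀ (i : Fin T) y x, |W i (pre u i) y * c x| ≤ 2 := fun i y x => by
      rw [abs_mul]
      calc _ ≤ 1 * (2 : ℝ) := mul_le_mul (hW1 _ _ _) (hC c hc _) (abs_nonneg _) zero_le_one
        _ = 2 := one_mul _
    -- For fixed `u` and `c`, the ghosts average `F` to the sum in the event. Jensen moves the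
    -- exponential inside this average, and only then is `c` replaced by the supremum.
    set F : (Fin T → Z) → ℝ := fun z' => ∑ i, if B i then
      W i (pre u i) (z' i, (u i).2) * c (φ (z' i)) - W i (pre u i) (u i) * c (φ (u i).1) else 0
      with hF
    have hFim : ∀ i, Measurable fun z' : Fin T → Z => if B i then
        W i (pre u i) (z' i, (u i).2) * c (φ (z' i)) - W i (pre u i) (u i) * c (φ (u i).1)
        else 0 := fun i => by
      by_cases h : B i
      · simp only [h, if_true]
        exact ((hWm i).comp (measurable_pi_apply i)).sub_const _
      · simp only [h, if_false]
        exact measurable_const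
    have hFiB : ∀ i, ∀ z' : Fin T → Z, |if B i then
        W i (pre u i) (z' i, (u i).2) * c (φ (z' i)) - W i (pre u i) (u i) * c (φ (u i).1)
        else 0| ≤ 4 := fun i z' => by
      by_cases h : B i
      · simp only [h, if_true]
        have h1 := abs_le.1 (hWB i (z' i, (u i).2) (φ (z' i)))
        have h2 := abs_le.1 (hWB i (u i) (φ (u i).1))
        rw [abs_le]
        constructor <;> linarith
      · simp [h]
    have hFm : Measurable F := Finset.measurable_sum _ fun i _ => hFim i
    have hFB : ∀ z', |F z'| ≤ T * 4 := fun z' => by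
      refine (Finset.abs_sum_le_sum_abs _ _).trans ((Finset.sum_le_sum fun i _ =>
        hFiB i z').trans_eq ?_)
      simp
    have hint : ∫ z', F z' ∂(Measure.pi fun _ : Fin T => D) = ∑ i, if B i then
        (∫ z, W i (pre u i) (z, (u i).2) * c (φ z) ∂D) - W i (pre u i) (u i) * c (φ (u i).1)
        else 0 := by
      rw [integral_finsetSum _ fun i _ => integrable_of_abs_le (hFim i) (hFiB i)]
      refine Finset.sum_congr rfl fun i _ => ?_
      by_cases h : B i
      · simp only [h, if_true]
        have h1 : Integrable (fun z' : Fin T → Z => W i (pre u i) (z' i, (u i).2) * c (φ (z' i)))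
            (Measure.pi fun _ : Fin T => D) :=
          integrable_of_abs_le ((hWm i).comp (measurable_pi_apply i)) fun z' => hWB i _ _
        rw [integral_sub h1 (integrable_const _), integral_const, probReal_univ, one_smul]
        congr 1
        have h2 := measurePreserving_eval (fun _ : Fin T => D) i
        have h3 := integral_map (μ := Measure.pi fun _ : Fin T => D) h2.measurable.aemeasurable
          (f := fun z => W i (pre u i) (z, (u i).2) * c (φ z)) (hWm i).aestronglyMeasurable
        rw [h2.map_eq] at h3
        exact h3.symm
      · simp [h]
    rw [← hint] at hca
    have h3 : Real.exp (θ * a) ≤ ∫ z', Real.exp (θ * F z') ∂(Measure.pi fun _ : Fin T => D) :=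
      (Real.exp_le_exp.2 (mul_le_mul_of_nonneg_left hca hθ)).trans (exp_integral_le hFm hFB θ)
    refine (ENNReal.ofReal_le_ofReal h3).trans ?_
    rw [ofReal_integral_eq_lintegral_ofReal (integrable_exp_of_abs_le hFm hFB θ)
      (Filter.Eventually.of_forall fun _ => (Real.exp_pos _).le)]
    refine lintegral_mono fun z' => ENNReal.ofReal_le_ofReal (Real.exp_le_exp.2
      (mul_le_mul_of_nonneg_left ?_ hθ))
    have h4 := le_supSum hC hc (hybridWeights B W T 1 (e (u, z'))) (ghostPoints B φ (e (u, z')))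
    rw [sum_hybridWeights_mul hB] at h4
    exact h4
  refine (measure_mono hsub).trans ?_
  rw [Real.exp_sub, ENNReal.ofReal_div_of_pos (Real.exp_pos _),
    ENNReal.le_div_iff_mul_le (Or.inl (by simp [Real.exp_pos])) (Or.inl ENNReal.ofReal_ne_top),
    mul_comm]
  exact hmarkov

end UniformConvergence

/-! ### Measurability of the algorithm -/

instance (T : ℕ) : MeasurableSpace (Weights T) :=
  MeasurableSpace.comap (fun w => (w.cal, w.sma)) inferInstance

section Weights

variable {T : ℕ} {α : Type*} [MeasurableSpace α]

lemma measurable_cal (v : Fin (T + 1)) (s : ℤˣ) : Measurable fun w : Weights T => w.cal v s := by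
  have h : Measurable fun w : Weights T => (w.cal, w.sma) := comap_measurable _
  exact (measurable_pi_apply s).comp ((measurable_pi_apply v).comp (measurable_fst.comp h))

lemma measurable_sma : Measurable fun w : Weights T => w.sma := by
  have h : Measurable fun w : Weights T => (w.cal, w.sma) := comap_measurable _
  exact measurable_snd.comp h

lemma measurable_weights {f : α → Weights T} (h1 : ∀ v s, Measurable fun a => (f a).cal v s)
    (h2 : Measurable fun a => (f a).sma) : Measurable f :=
  measurable_comap_iff.2 ((measurable_pi_lambda _ fun v => measurable_pi_lambda _ fun s =>
    h1 v s).prodMk h2)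

lemma measurable_f {w : α → Weights T} (hw : Measurable w) {q : α → ℝ} (hq : Measurable q)
    (j : ℕ) : Measurable fun a => (w a).f (q a) j := by
  unfold Weights.f
  refine ((measurable_sma.comp hw).mul hq).add (Finset.measurable_sum _ fun v _ =>
    Finset.measurable_sum _ fun s _ => ?_)
  exact (((measurable_cal v s).comp hw).const_mul _).mul_const _

/-- The index of the grid point chosen by the randomized post-processing map. -/
def Weights.remapIndex (w : Weights T) (ζ : I) (q : ℝ) : ℕ :=
  if (w.minZeroCrossing q).2 < (ζ : ℝ) then (w.minZeroCrossing q).1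
  else min ((w.minZeroCrossing q).1 + 1) T

lemma Weights.minZeroCrossing_fst_le (w : Weights T) (q : ℝ) : (w.minZeroCrossing q).1 ≤ T := by
  unfold Weights.minZeroCrossing
  split_ifs with h1 h2
  · exact Nat.zero_le _
  · exact (Nat.find_spec h2).1.le
  · exact le_rfl

lemma Weights.remapIndex_le (w : Weights T) (ζ : I) (q : ℝ) : w.remapIndex ζ q ≤ T := by
  unfold Weights.remapIndex
  split_ifs
  · exact w.minZeroCrossing_fst_le q
  · exact min_le_right _ _

/-- The grid point `j/T`. -/
def gridPoint (T j : ℕ) : I := Set.projIcc (0 : ℝ) 1 zero_le_one ((j : ℝ) / T)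

lemma coe_gridPoint {j : ℕ} (hj : j ≤ T) : (gridPoint T j : ℝ) = (j : ℝ) / T := by
  have h : (j : ℝ) / T ≤ 1 := div_le_one_of_le₀ (by exact_mod_cast hj) (Nat.cast_nonneg _)
  rw [gridPoint, Set.projIcc_of_mem zero_le_one ⟨by positivity, h⟩]

lemma Weights.remap_eq (w : Weights T) (ζ : I) (q : ℝ) :
    w.remap ζ q = gridPoint T (w.remapIndex ζ q) := by
  unfold Weights.remap Weights.remapIndex gridPoint
  split_ifs <;> rfl

lemma Weights.g_zero (w : Weights T) (q : ℝ) (j : ℕ) : w.g q j 0 = w.f q j := by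
  simp [Weights.g]

lemma Weights.g_one (w : Weights T) (q : ℝ) (j : ℕ) : w.g q j 1 = w.f q (min (j + 1) T) := by
  simp [Weights.g]

open Classical in
lemma measurable_minZeroCrossing {w : α → Weights T} (hw : Measurable w) {q : α → ℝ}
    (hq : Measurable q) : Measurable fun a => (w a).minZeroCrossing (q a) := by
  have hf := fun j => measurable_f hw hq j
  -- The alternative `T ≤ j` makes the search total, as `measurable_find` requires; the value `T`
  -- then signals that there is no crossing.
  have hex : ∀ a, ∃ j, (j < T ∧ (w a).f (q a) j * (w a).f (q a) (min (j + 1) T) ≤ 0) ∨ T ≤ j :=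
    fun a => ⟨T, Or.inr le_rfl⟩
  have hN : Measurable fun a => Nat.find (hex a) := by
    refine measurable_find _ fun j => ?_
    by_cases hj : j < T
    · simp only [hj, true_and, not_le.2 hj, or_false]
      exact measurableSet_le ((hf j).mul (hf _)) measurable_const
    · simp [hj, not_lt.1 hj]
  have hcomp : ∀ m : ℕ → ℕ, Measurable fun a => (w a).f (q a) (m (Nat.find (hex a))) := fun m => by
    have h : Measurable fun p : α × ℕ => (w p.1).f (q p.1) (m p.2) :=
      measurable_from_prod_countable_left fun j => hf (m j)
    exact h.comp (measurable_id.prodMk hN)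
  have heq : (fun a => (w a).minZeroCrossing (q a)) = fun a =>
      if (w a).f (q a) 0 ≤ 0 then (0, 0) else if Nat.find (hex a) < T then
        (Nat.find (hex a), |(w a).f (q a) (Nat.find (hex a))| /
          (|(w a).f (q a) (Nat.find (hex a))| + |(w a).f (q a) (min (Nat.find (hex a) + 1) T)|))
      else (T, 1) := by
    funext a
    unfold Weights.minZeroCrossing
    simp only [Weights.g_zero, Weights.g_one]
    split_ifs with h1 h2 h3 h4
    · rfl
    · have : Nat.find h2 = Nat.find (hex a) := by
        refine (Nat.find_eq_iff h2).2 ⟨?_, fun n hn h => Nat.find_min (hex a) hn (Or.inl h)⟩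
        exact (Nat.find_spec (hex a)).resolve_right (not_le.2 h3)
      rw [this]
    · exact absurd (lt_of_le_of_lt (Nat.find_min' (hex a) (Or.inl h2.choose_spec))
        h2.choose_spec.1) h3
    · exact absurd ⟨_, (Nat.find_spec (hex a)).resolve_right (not_le.2 h4)⟩ h2
    · rfl
  rw [heq]
  refine Measurable.ite (measurableSet_le (hf 0) measurable_const) measurable_const
    (Measurable.ite (measurableSet_lt hN measurable_const) (hN.prodMk ?_) measurable_const)
  have h1 := (hcomp id).abs
  exact h1.div (h1.add (hcomp fun n => min (n + 1) T).abs)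

lemma measurable_remapIndex {w : α → Weights T} (hw : Measurable w) {ζ : α → I}
    (hζ : Measurable ζ) {q : α → ℝ} (hq : Measurable q) :
    Measurable fun a => (w a).remapIndex (ζ a) (q a) := by
  have h := measurable_minZeroCrossing hw hq
  unfold Weights.remapIndex
  refine Measurable.ite (measurableSet_lt (measurable_snd.comp h)
    (measurable_subtype_coe.comp hζ)) (measurable_fst.comp h) ?_
  exact (measurable_from_top (f := fun n : ℕ => min (n + 1) T)).comp (measurable_fst.comp h)

lemma measurable_remap {w : α → Weights T} (hw : Measurable w) {ζ : α → I}
    (hζ : Measurable ζ) {q : α → ℝ} (hq : Measurable q) :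
    Measurable fun a => (w a).remap (ζ a) (q a) := by
  simp_rw [Weights.remap_eq]
  exact (measurable_from_top (f := gridPoint T)).comp (measurable_remapIndex hw hζ hq)

lemma measurable_update {w : α → Weights T} (hw : Measurable w) {p q y : α → ℝ}
    (hp : Measurable p) (hq : Measurable q) (hy : Measurable y) :
    Measurable fun a => (w a).update (p a) (q a) (y a) := by
  have hTh : ∀ θ : ℝ, Measurable fun a => Th θ (p a) := fun θ =>
    Measurable.ite (measurableSet_le measurable_const hp) measurable_const measurable_const
  have hc : ∀ (v : Fin (T + 1)) (s : ℤˣ), Measurable fun a => Real.exp (√(Real.log T / T) *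
      (((s : ℤ) : ℝ) * (y a - p a) * Th ((v : ℕ) / (T : ℝ)) (p a))) * (w a).cal v s := fun v s =>
    (Real.measurable_exp.comp ((((hy.sub hp).const_mul _).mul (hTh _)).const_mul _)).mul
      ((measurable_cal v s).comp hw)
  have hs : Measurable fun a => Real.exp (√(Real.log T / T) * ((y a - p a) * q a)) * (w a).sma :=
    (Real.measurable_exp.comp (((hy.sub hp).mul hq).const_mul _)).mul (measurable_sma.comp hw)
  have hW := hs.add (Finset.measurable_sum Finset.univ fun v _ =>
    Finset.measurable_sum Finset.univ fun s _ => hc v s)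
  refine measurable_weights (fun v s => ?_) ?_
  · exact (hc v s).div hW
  · exact hs.div hW

end Weights

section Run

variable {X Ξ α : Type*} [MeasurableSpace X] [MeasurableSpace Ξ] [MeasurableSpace α]
  {ν : Measure Ξ} (A : Learner X Ξ ν) {T k : ℕ}

lemma measurable_outcome : Measurable outcome := measurable_from_top

lemma measurable_average {t : ℕ} {hist : α → Hist X Ξ t} (hh : Measurable hist)
    {rs : α → Fin k → Ξ} (hr : Measurable rs) {x : α → X} (hx : Measurable x) :
    Measurable fun a => A.average (hist a) (rs a) (x a) := by
  unfold Learner.average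
  refine (Finset.measurable_sum _ fun j _ => ?_).div_const _
  exact (A.measurable_predict t).comp (hh.prodMk (((measurable_pi_apply j).comp hr).prodMk hx))

lemma measurable_mean [SFinite ν] {t : ℕ} {hist : α → Hist X Ξ t} (hh : Measurable hist)
    {x : α → X} (hx : Measurable x) : Measurable fun a => A.mean (hist a) (x a) := by
  have h : Measurable fun z : α × Ξ => A.predict t (hist z.1) z.2 (x z.1) :=
    (A.measurable_predict t).comp ((hh.comp measurable_fst).prodMk
      (measurable_snd.prodMk (hx.comp measurable_fst)))
  exact (h.stronglyMeasurable.integral_prod_right' (ν := ν)).measurable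

lemma measurable_roundQ {t : ℕ} {st : α → State X Ξ T t} (hst : Measurable st)
    {u : α → RoundInput X Ξ k} (hu : Measurable u) {x : α → X} (hx : Measurable x) :
    Measurable fun a => roundQ A (st a) (u a) (x a) :=
  measurable_average A (measurable_snd.comp hst)
    (measurable_snd.comp (measurable_snd.comp (measurable_snd.comp hu))) hx

lemma measurable_roundP {t : ℕ} {st : α → State X Ξ T t} (hst : Measurable st)
    {u : α → RoundInput X Ξ k} (hu : Measurable u) {x : α → X} (hx : Measurable x) :
    Measurable fun a => roundP A (st a) (u a) (x a) :=
  measurable_remap (measurable_fst.comp hst) (measurable_fst.comp (measurable_snd.comp hu))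
    (measurable_roundQ A hst hu hx)

lemma measurable_snoc {β : Type*} [MeasurableSpace β] {n : ℕ} {r : α → Fin n → β}
    (hr : Measurable r) {b : α → β} (hb : Measurable b) :
    Measurable fun a => (Fin.snoc (r a) (b a) : Fin (n + 1) → β) := by
  refine measurable_pi_lambda _ fun i => ?_
  induction i using Fin.lastCases with
  | last => simpa using hb
  | cast i =>
    simp only [Fin.snoc_castSucc]
    exact (measurable_pi_apply i).comp hr

lemma measurable_step {t : ℕ} {st : α → State X Ξ T t} (hst : Measurable st)
    {u : α → RoundInput X Ξ k} (hu : Measurable u) :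
    Measurable fun a => step A (st a) (u a) := by
  have hx : Measurable fun a => (u a).1.1 := measurable_fst.comp (measurable_fst.comp hu)
  have hy : Measurable fun a => outcome (u a).1.2 :=
    measurable_outcome.comp (measurable_snd.comp (measurable_fst.comp hu))
  have hp : Measurable fun a => (roundP A (st a) (u a) (u a).1.1 : ℝ) :=
    measurable_subtype_coe.comp (measurable_roundP A hst hu hx)
  refine Measurable.prodMk ?_ ?_
  · exact measurable_update (measurable_fst.comp hst) hp (measurable_roundQ A hst hu hx) hy
  · exact measurable_snoc (measurable_snd.comp hst) (hx.prodMk ((hy.sub hp).prodMk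
      (measurable_fst.comp (measurable_snd.comp (measurable_snd.comp hu)))))

lemma measurable_run (t : ℕ) : Measurable (run A T k t) := by
  induction t with
  | zero => exact measurable_const
  | succ t ih =>
    exact measurable_step A (ih.comp (measurable_pi_lambda _ fun i : Fin t =>
      measurable_pi_apply i.castSucc)) (measurable_pi_apply (Fin.last t))

end Run

/-! ### Exponential weights -/

section ExpWeights

variable {T : ℕ}

lemma abs_intUnit (s : ℤˣ) : |((s : ℤ) : ℝ)| = 1 := by
  rcases Int.units_eq_one_or s with rfl | rfl <;> simp

lemma abs_Th (θ p : ℝ) : |Th θ p| = 1 := by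
  unfold Th
  split_ifs <;> simp

lemma outcome_mem (y : Bool) : outcome y ∈ Set.Icc (0 : ℝ) 1 := by
  cases y <;> simp [outcome]

lemma abs_outcome_sub_le (y : Bool) (p : I) : |outcome y - p| ≤ 1 := by
  have h1 := outcome_mem y
  have h2 := p.2
  rw [abs_le]
  constructor <;> linarith [h1.1, h1.2, h2.1, h2.2]

/-- The weights form a probability vector with positive entries. -/
structure Weights.IsProb (w : Weights T) : Prop where
  cal_pos : ∀ v s, 0 < w.cal v s
  sma_pos : 0 < w.sma
  total : w.sma + ∑ v, ∑ s, w.cal v s = 1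

lemma Weights.isProb_init (T : ℕ) : (Weights.init T).IsProb where
  cal_pos v s := by
    simp only [Weights.init]
    positivity
  sma_pos := by
    simp only [Weights.init]
    positivity
  total := by
    simp only [Weights.init, Finset.sum_const, Finset.card_univ, Fintype.card_fin,
      show Fintype.card ℤˣ = 2 from rfl, nsmul_eq_mul]
    push_cast
    field_simp
    ring

lemma Weights.IsProb.cal_le_one {w : Weights T} (hw : w.IsProb) (v : Fin (T + 1)) (s : ℤˣ) :
    w.cal v s ≤ 1 := by
  have h1 : w.cal v s ≤ ∑ s, w.cal v s :=
    Finset.single_le_sum (fun s _ => (hw.cal_pos v s).le) (Finset.mem_univ s)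
  have h2 : ∑ s, w.cal v s ≤ ∑ v, ∑ s, w.cal v s :=
    Finset.single_le_sum (f := fun v => ∑ s, w.cal v s)
      (fun v _ => Finset.sum_nonneg fun s _ => (hw.cal_pos v s).le) (Finset.mem_univ v)
  linarith [hw.total, hw.sma_pos]

lemma Weights.IsProb.sma_le_one {w : Weights T} (hw : w.IsProb) : w.sma ≤ 1 := by
  have : 0 ≤ ∑ v, ∑ s, w.cal v s :=
    Finset.sum_nonneg fun v _ => Finset.sum_nonneg fun s _ => (hw.cal_pos v s).le
  linarith [hw.total]

/-- Averages of payoffs bounded by `1`. -/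
lemma Weights.IsProb.abs_average_le {w : Weights T} (hw : w.IsProb) {a : ℝ} (ha : |a| ≤ 1)
    {b : Fin (T + 1) → ℤˣ → ℝ} (hb : ∀ v s, |b v s| ≤ 1) :
    |w.sma * a + ∑ v, ∑ s, w.cal v s * b v s| ≤ 1 := by
  rw [← hw.total]
  refine (abs_add_le _ _).trans (add_le_add ?_ ?_)
  · rw [abs_mul, abs_of_pos hw.sma_pos]
    exact mul_le_of_le_one_right hw.sma_pos.le ha
  · refine (Finset.abs_sum_le_sum_abs _ _).trans (Finset.sum_le_sum fun v _ =>
      (Finset.abs_sum_le_sum_abs _ _).trans (Finset.sum_le_sum fun s _ => ?_))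
    rw [abs_mul, abs_of_pos (hw.cal_pos v s)]
    exact mul_le_of_le_one_right (hw.cal_pos v s).le (hb v s)

lemma Weights.IsProb.abs_f_le {w : Weights T} (hw : w.IsProb) {q : ℝ} (hq : |q| ≤ 1) (j : ℕ) :
    |w.f q j| ≤ 1 := by
  have h := hw.abs_average_le hq
    (b := fun v s => ((s : ℤ) : ℝ) * Th ((v : ℕ) / (T : ℝ)) ((j : ℝ) / T)) fun v s => by
      rw [abs_mul, abs_intUnit, abs_Th, one_mul]
  refine le_of_eq_of_le ?_ h
  unfold Weights.f
  congr 2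
  refine Finset.sum_congr rfl fun v _ => Finset.sum_congr rfl fun s _ => by ring

lemma exp_le_one_add_add_sq {x : ℝ} (hx : |x| ≤ 1) : Real.exp x ≤ 1 + x + x ^ 2 := by
  have := (abs_le.1 (Real.abs_exp_sub_one_sub_id_le hx)).2
  linarith

/-- The learning rate. -/
def rate (T : ℕ) : ℝ := √(Real.log T / T)

/-- One step of exponential weights; `j/T` is the predictor value. -/
lemma Weights.IsProb.update {w : Weights T} (hw : w.IsProb) {p q y : ℝ} {j : ℕ}
    (hp : p = (j : ℝ) / T) (hq : |q| ≤ 1) (hy : |y - p| ≤ 1) (hη : rate T ≤ 1) :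
    (w.update p q y).IsProb ∧
    (∀ (v : Fin (T + 1)) (s : ℤˣ), Real.exp (rate T * (((s : ℤ) : ℝ) * (y - p) * Th ((v : ℕ) / (T : ℝ)) p -
      (y - p) * w.f q j) - rate T ^ 2) * w.cal v s ≤ (w.update p q y).cal v s) ∧
    Real.exp (rate T * ((y - p) * q - (y - p) * w.f q j) - rate T ^ 2) * w.sma ≤
      (w.update p q y).sma := by
  set η := rate T with hηdef
  have hη0 : 0 ≤ η := Real.sqrt_nonneg _
  set a : Fin (T + 1) → ℤˣ → ℝ := fun v s => ((s : ℤ) : ℝ) * (y - p) * Th ((v : ℕ) / (T : ℝ)) p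
    with ha
  set b : ℝ := (y - p) * q with hb
  have ha1 : ∀ v s, |a v s| ≤ 1 := fun v s => by
    simp only [ha]
    rw [abs_mul, abs_mul, abs_intUnit, abs_Th, one_mul, mul_one]
    exact hy
  have hb1 : |b| ≤ 1 := by
    rw [hb, abs_mul]
    exact mul_le_one₀ hy (abs_nonneg _) hq
  set W : ℝ := Real.exp (η * b) * w.sma + ∑ v, ∑ s, Real.exp (η * a v s) * w.cal v s with hW
  have hsum0 : 0 ≤ ∑ v, ∑ s, Real.exp (η * a v s) * w.cal v s :=
    Finset.sum_nonneg fun v _ => Finset.sum_nonneg fun s _ =>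
      mul_nonneg (Real.exp_pos _).le (hw.cal_pos v s).le
  have hWpos : 0 < W := add_pos_of_pos_of_nonneg (mul_pos (Real.exp_pos _) hw.sma_pos) hsum0
  have hcal : ∀ v s, (w.update p q y).cal v s = Real.exp (η * a v s) * w.cal v s / W :=
    fun v s => rfl
  have hsma : (w.update p q y).sma = Real.exp (η * b) * w.sma / W := rfl
  have hmix : w.sma * b + ∑ v, ∑ s, w.cal v s * a v s = (y - p) * w.f q j := by
    unfold Weights.f
    rw [mul_add, Finset.mul_sum, ← hp]
    simp_rw [Finset.mul_sum, ha, hb]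
    congr 1
    · ring
    · exact Finset.sum_congr rfl fun v _ => Finset.sum_congr rfl fun s _ => by ring
  have hexp : ∀ c : ℝ, |c| ≤ 1 → Real.exp (η * c) ≤ 1 + η * c + η ^ 2 := fun c hc => by
    have h1 : |η * c| ≤ 1 := by
      rw [abs_mul, abs_of_nonneg hη0]
      exact mul_le_one₀ hη (abs_nonneg _) hc
    have h2 : (η * c) ^ 2 ≤ η ^ 2 := by
      rw [mul_pow]
      have : c ^ 2 ≤ 1 := by rw [← sq_abs]; exact pow_le_one₀ (abs_nonneg _) hc
      exact mul_le_of_le_one_right (sq_nonneg _) this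
    linarith [exp_le_one_add_add_sq h1]
  -- Since `exp x ≤ 1 + x + x²`, the normaliser is bounded through the average payoff under the
  -- current weights, which by `hmix` is the residual times `f`.
  have hWle : W ≤ Real.exp (η * ((y - p) * w.f q j) + η ^ 2) := by
    have h1 : W ≤ (1 + η * b + η ^ 2) * w.sma +
        ∑ v, ∑ s, (1 + η * a v s + η ^ 2) * w.cal v s := by
      refine add_le_add (mul_le_mul_of_nonneg_right (hexp b hb1) hw.sma_pos.le)
        (Finset.sum_le_sum fun v _ => Finset.sum_le_sum fun s _ =>
          mul_le_mul_of_nonneg_right (hexp _ (ha1 v s)) (hw.cal_pos v s).le)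
    have h2 : (1 + η * b + η ^ 2) * w.sma + ∑ v, ∑ s, (1 + η * a v s + η ^ 2) * w.cal v s =
        (1 + η ^ 2) * (w.sma + ∑ v, ∑ s, w.cal v s) +
          η * (w.sma * b + ∑ v, ∑ s, w.cal v s * a v s) := by
      simp_rw [mul_add, Finset.mul_sum]
      have h3 : ∑ v, ∑ s, (1 + η * a v s + η ^ 2) * w.cal v s =
          ∑ v, ∑ s, (1 + η ^ 2) * w.cal v s + ∑ v, ∑ s, η * (w.cal v s * a v s) := by
        simp_rw [← Finset.sum_add_distrib]
        exact Finset.sum_congr rfl fun v _ => Finset.sum_congr rfl fun s _ => by ring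
      rw [h3]
      ring
    rw [h2, hw.total, hmix] at h1
    have h3 := Real.add_one_le_exp (η * ((y - p) * w.f q j) + η ^ 2)
    linarith
  have hstep : ∀ c x : ℝ, 0 ≤ x → Real.exp (η * (c - (y - p) * w.f q j) - η ^ 2) * x ≤
      Real.exp (η * c) * x / W := fun c x hx => by
    rw [le_div_iff₀ hWpos]
    calc _ ≤ Real.exp (η * (c - (y - p) * w.f q j) - η ^ 2) * x *
          Real.exp (η * ((y - p) * w.f q j) + η ^ 2) :=
          mul_le_mul_of_nonneg_left hWle (mul_nonneg (Real.exp_pos _).le hx)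
      _ = Real.exp (η * c) * x := by
          rw [mul_right_comm, ← Real.exp_add]
          ring_nf
  refine ⟨⟨fun v s => ?_, ?_, ?_⟩, fun v s => ?_, ?_⟩
  · rw [hcal]
    exact div_pos (mul_pos (Real.exp_pos _) (hw.cal_pos v s)) hWpos
  · rw [hsma]
    exact div_pos (mul_pos (Real.exp_pos _) hw.sma_pos) hWpos
  · simp_rw [hcal, hsma, ← Finset.sum_div]
    rw [← add_div]
    exact div_self hWpos.ne'
  · rw [hcal]
    exact hstep _ _ (hw.cal_pos v s).le
  · rw [hsma]
    exact hstep _ _ hw.sma_pos.le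

end ExpWeights

/-! ### Zero crossings -/

section ZeroCrossing

variable {T : ℕ}

lemma integral_ite_lt {m : ℝ} (hm : m ∈ Set.Icc (0 : ℝ) 1) (a b : ℝ) :
    ∫ ζ : I, (if m < (ζ : ℝ) then a else b) = (1 - m) * a + m * b := by
  have h : (fun ζ : I => if m < (ζ : ℝ) then a else b) =
      fun ζ => (Set.Ioi (⟨m, hm⟩ : I)).indicator (fun _ => a - b) ζ + b := by
    funext ζ
    by_cases h : m < (ζ : ℝ)
    · have : ζ ∈ Set.Ioi (⟨m, hm⟩ : I) := h
      simp [h, this]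
    · have : ζ ∉ Set.Ioi (⟨m, hm⟩ : I) := h
      simp [h, this]
  rw [h, integral_add ((integrable_const _).indicator measurableSet_Ioi) (integrable_const _),
    integral_indicator_const _ measurableSet_Ioi, measureReal_def, unitInterval.volume_Ioi,
    ENNReal.toReal_ofReal (by simpa using hm.2)]
  simp
  ring

/-- The randomized zero crossing has expected payoff at most `1/T`. -/
lemma Weights.IsProb.crossing_le {w : Weights T} (hw : w.IsProb) (hT : 0 < T) {q y : ℝ}
    (hq : |q| ≤ 1) (hy : y ∈ Set.Icc (0 : ℝ) 1) :
    (w.minZeroCrossing q).2 ∈ Set.Icc (0 : ℝ) 1 ∧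
    (1 - (w.minZeroCrossing q).2) * ((y - ((w.minZeroCrossing q).1 : ℝ) / T) *
      w.f q (w.minZeroCrossing q).1) + (w.minZeroCrossing q).2 *
      ((y - ((min ((w.minZeroCrossing q).1 + 1) T : ℕ) : ℝ) / T) *
        w.f q (min ((w.minZeroCrossing q).1 + 1) T)) ≤ 1 / T := by
  have hT' : (0 : ℝ) < T := by exact_mod_cast hT
  have hTi : (0 : ℝ) ≤ 1 / T := by positivity
  unfold Weights.minZeroCrossing
  simp only [Weights.g_zero, Weights.g_one]
  split_ifs with h1 h2
  · refine ⟨by simp, ?_⟩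
    have : y * w.f q 0 ≤ 0 := mul_nonpos_of_nonneg_of_nonpos hy.1 h1
    simp
    linarith [inv_nonneg.2 hT'.le]
  · classical
    obtain ⟨hj, hcr⟩ := Nat.find_spec h2
    set j := Nat.find h2 with hjdef
    rw [min_eq_left (show j + 1 ≤ T from hj)] at hcr ⊢
    have hb1 := hw.abs_f_le hq (j + 1)
    generalize w.f q j = a at hcr ⊢
    generalize w.f q (j + 1) = b at hcr hb1 ⊢
    have hm0 : 0 ≤ |a| / (|a| + |b|) := by positivity
    have hm1 : |a| / (|a| + |b|) ≤ 1 :=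
      div_le_one_of_le₀ (by linarith [abs_nonneg b]) (by positivity)
    refine ⟨⟨hm0, hm1⟩, ?_⟩
    have hzero : (1 - |a| / (|a| + |b|)) * a + |a| / (|a| + |b|) * b = 0 := by
      -- If both values vanish, the quotient is `0 / 0 = 0`, and the identity still holds.
      rcases eq_or_ne (|a| + |b|) 0 with h0 | h0
      · have ha : |a| = 0 := by linarith [abs_nonneg a, abs_nonneg b]
        simp [abs_eq_zero.1 ha]
      · field_simp
        rcases le_total 0 a with ha | ha
        · rcases le_total 0 b with hb | hb
          · rcases mul_eq_zero.1 (le_antisymm hcr (mul_nonneg ha hb)) with h | h <;> simp [h]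
          · rw [abs_of_nonneg ha, abs_of_nonpos hb]
            ring
        · rcases le_total 0 b with hb | hb
          · rw [abs_of_nonpos ha, abs_of_nonneg hb]
            ring
          · rcases mul_eq_zero.1 (le_antisymm hcr (mul_nonneg_of_nonpos_of_nonpos ha hb)) with
              h | h <;> simp [h]
    generalize |a| / (|a| + |b|) = m at hm0 hm1 hzero ⊢
    push_cast
    -- The crossing makes `f` vanish on average. What survives is the gap `1/T` between neighbouring
    -- grid points times a value of `f`, and `|f| ≤ 1`.
    have h3 : (1 - m) * ((y - (j : ℝ) / T) * a) + m * ((y - ((j : ℝ) + 1) / T) * b) =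
        (y - (j : ℝ) / T) * ((1 - m) * a + m * b) - m * b * (1 / T) := by
      ring
    rw [h3, hzero, mul_zero, zero_sub, ← neg_mul]
    refine mul_le_of_le_one_left hTi ?_
    have := abs_le.1 hb1
    nlinarith
  · refine ⟨by simp, ?_⟩
    -- Without a crossing, positivity at `0` propagates to the end of the grid, where the prediction
    -- `1` has payoff `(y - 1) f ≤ 0`.
    have hpos : ∀ j, j ≤ T → 0 < w.f q j := fun j => by
      induction j with
      | zero => exact fun _ => not_le.1 h1
      | succ j ih =>
        intro hj
        have h3 := ih (by omega)
        by_contra h4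
        refine h2 ⟨j, hj, ?_⟩
        rw [min_eq_left (show j + 1 ≤ T from hj)]
        exact mul_nonpos_of_nonneg_of_nonpos h3.le (not_lt.1 h4)
    have h3 : (y - 1) * w.f q T ≤ 0 :=
      mul_nonpos_of_nonpos_of_nonneg (by linarith [hy.2]) (hpos T le_rfl).le
    have hmin : min (T + 1) T = T := by omega
    rw [hmin, div_self hT'.ne', sub_self, zero_mul, zero_add, one_mul]
    linarith

lemma Weights.IsProb.integral_crossing_le {w : Weights T} (hw : w.IsProb) (hT : 0 < T) {q y : ℝ}
    (hq : |q| ≤ 1) (hy : y ∈ Set.Icc (0 : ℝ) 1) :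
    ∫ ζ : I, (y - (w.remapIndex ζ q : ℝ) / T) * w.f q (w.remapIndex ζ q) ≤ 1 / T := by
  obtain ⟨h1, h2⟩ := hw.crossing_le hT hq hy
  rw [← integral_ite_lt h1] at h2
  refine le_of_eq_of_le (integral_congr_ae (Filter.Eventually.of_forall fun ζ => ?_)) h2
  simp only [Weights.remapIndex]
  split_ifs <;> rfl

end ZeroCrossing

section Round

variable {X Ξ : Type*} [MeasurableSpace X] [MeasurableSpace Ξ] {ν : Measure Ξ}
  (A : Learner X Ξ ν) (T : ℕ) {k : ℕ}

/-! ### The quantities of one round -/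

/-- `p_t(x_t)`, as a function of the earlier inputs and the inputs of the round. -/
def predVal {t : ℕ} (past : Fin t → RoundInput X Ξ k) (a : RoundInput X Ξ k) : I :=
  roundP A (run A T k t past) a a.1.1

/-- `q_t(x_t)`. -/
def auxVal {t : ℕ} (past : Fin t → RoundInput X Ξ k) (a : RoundInput X Ξ k) : ℝ :=
  roundQ A (run A T k t past) a a.1.1

/-- The index of the grid point `p_t(x_t)`. -/
def predIndex {t : ℕ} (past : Fin t → RoundInput X Ξ k) (a : RoundInput X Ξ k) : ℕ :=
  (run A T k t past).1.remapIndex a.2.1 (auxVal A T past a)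

/-- The residual `y_t - p_t(x_t)`. -/
def resid {t : ℕ} (past : Fin t → RoundInput X Ξ k) (a : RoundInput X Ξ k) : ℝ :=
  outcome a.1.2 - predVal A T past a

/-- The payoff of the expert `(v, s)`. -/
def calPayoff (v : ℕ) (s : ℤˣ) (t : ℕ) (past : Fin t → RoundInput X Ξ k)
    (a : RoundInput X Ξ k) : ℝ :=
  ((s : ℤ) : ℝ) * resid A T past a * Th ((v : ℝ) / T) (predVal A T past a)

/-- The payoff of the weighted average of the experts. -/
def mixPayoff (t : ℕ) (past : Fin t → RoundInput X Ξ k) (a : RoundInput X Ξ k) : ℝ :=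
  resid A T past a * (run A T k t past).1.f (auxVal A T past a) (predIndex A T past a)

variable {A T}

lemma coe_predVal {t : ℕ} (past : Fin t → RoundInput X Ξ k) (a : RoundInput X Ξ k) :
    (predVal A T past a : ℝ) = (predIndex A T past a : ℝ) / T := by
  rw [predVal, roundP, Weights.remap_eq, coe_gridPoint (Weights.remapIndex_le _ _ _)]
  rfl

lemma abs_average_le {t : ℕ} (hist : Hist X Ξ t) (rs : Fin k → Ξ) (x : X) :
    |A.average hist rs x| ≤ 1 := by
  unfold Learner.average
  rw [abs_div, Nat.abs_cast]
  refine div_le_one_of_le₀ ((Finset.abs_sum_le_sum_abs _ _).trans ?_) (Nat.cast_nonneg _)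
  refine (Finset.sum_le_sum fun j _ => abs_le.2 (A.predict_mem t hist (rs j) x)).trans_eq ?_
  simp

lemma abs_auxVal_le {t : ℕ} (past : Fin t → RoundInput X Ξ k) (a : RoundInput X Ξ k) :
    |auxVal A T past a| ≤ 1 :=
  abs_average_le _ _ _

lemma abs_resid_le {t : ℕ} (past : Fin t → RoundInput X Ξ k) (a : RoundInput X Ξ k) :
    |resid A T past a| ≤ 1 :=
  abs_outcome_sub_le _ _

lemma rate_le_one (hT : 2 ≤ T) : rate T ≤ 1 := by
  have hT' : (0 : ℝ) < T := by positivity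
  refine Real.sqrt_le_iff.2 ⟨zero_le_one, ?_⟩
  rw [one_pow, div_le_one hT']
  linarith [Real.log_le_sub_one_of_pos hT']

/-- Regret of exponential weights, in exponential form. -/
lemma run_weights_lower (hT : 2 ≤ T) : ∀ (n : ℕ) (u : Fin n → RoundInput X Ξ k),
    (run A T k n u).1.IsProb ∧
    (∀ (v : Fin (T + 1)) (s : ℤˣ), Real.exp (rate T * ∑ t : Fin n, (calPayoff A T v s t (pre u t) (u t) -
      mixPayoff A T t (pre u t) (u t)) - n * rate T ^ 2) * (1 / (2 * (T : ℝ) + 3)) ≤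
        (run A T k n u).1.cal v s) ∧
    Real.exp (rate T * ∑ t : Fin n, (resid A T (pre u t) (u t) * auxVal A T (pre u t) (u t) -
      mixPayoff A T t (pre u t) (u t)) - n * rate T ^ 2) * (1 / (2 * (T : ℝ) + 3)) ≤
        (run A T k n u).1.sma
  | 0, u => ⟨Weights.isProb_init T, fun v s => by simp [run, Weights.init],
      by simp [run, Weights.init]⟩
  | n + 1, u => by
    obtain ⟨h1, h2, h3⟩ := run_weights_lower hT n (fun i => u i.castSucc)
    set past : Fin n → RoundInput X Ξ k := fun i => u i.castSucc with hpast
    obtain ⟨g1, g2, g3⟩ := h1.update (coe_predVal past (u (Fin.last n)))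
      (abs_auxVal_le (A := A) (T := T) past (u (Fin.last n)))
      (abs_resid_le (A := A) (T := T) past (u (Fin.last n))) (rate_le_one hT)
    have hrun : (run A T k (n + 1) u).1 = (run A T k n past).1.update
      (predVal A T past (u (Fin.last n))) (auxVal A T past (u (Fin.last n)))
      (outcome (u (Fin.last n)).1.2) := rfl
    have hcomb : ∀ S x w w' : ℝ, Real.exp (rate T * S - n * rate T ^ 2) *
        (1 / (2 * (T : ℝ) + 3)) ≤ w → Real.exp (rate T * x - rate T ^ 2) * w ≤ w' →
        Real.exp (rate T * (S + x) - ((n + 1 : ℕ) : ℝ) * rate T ^ 2) *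
        (1 / (2 * (T : ℝ) + 3)) ≤ w' := fun S x w w' hw hw' => by
      refine le_trans ?_ hw'
      refine le_trans (le_of_eq ?_) (mul_le_mul_of_nonneg_left hw (Real.exp_pos _).le)
      rw [← mul_assoc, ← Real.exp_add]
      push_cast
      ring_nf
    refine ⟨g1, fun v s => ?_, ?_⟩
    · rw [hrun, Fin.sum_univ_castSucc]
      exact hcomb _ _ _ _ (h2 v s) (g2 v s)
    · rw [hrun, Fin.sum_univ_castSucc]
      exact hcomb _ _ _ _ h3 g3

lemma isProb_run (hT : 2 ≤ T) (n : ℕ) (u : Fin n → RoundInput X Ξ k) :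
    (run A T k n u).1.IsProb :=
  (run_weights_lower hT n u).1

lemma le_log_of_exp_mul_le {x w N : ℝ} (hN : 0 < N) (h : Real.exp x * (1 / N) ≤ w) (hw : w ≤ 1) :
    x ≤ Real.log N := by
  rw [Real.le_log_iff_exp_le hN]
  have := h.trans hw
  rwa [mul_one_div, div_le_one hN] at this

lemma rate_mul_sum_calPayoff_le (hT : 2 ≤ T) {n : ℕ} (u : Fin n → RoundInput X Ξ k)
    (v : Fin (T + 1)) (s : ℤˣ) :
    rate T * ∑ t : Fin n, (calPayoff A T v s t (pre u t) (u t) - mixPayoff A T t (pre u t) (u t)) ≤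
      Real.log (2 * T + 3) + n * rate T ^ 2 := by
  obtain ⟨h1, h2, -⟩ := run_weights_lower hT n u
  linarith [le_log_of_exp_mul_le (by positivity) (h2 v s) (h1.cal_le_one v s)]

lemma rate_mul_sum_auxPayoff_le (hT : 2 ≤ T) {n : ℕ} (u : Fin n → RoundInput X Ξ k) :
    rate T * ∑ t : Fin n, (resid A T (pre u t) (u t) * auxVal A T (pre u t) (u t) -
      mixPayoff A T t (pre u t) (u t)) ≤ Real.log (2 * T + 3) + n * rate T ^ 2 := by
  obtain ⟨h1, -, h3⟩ := run_weights_lower hT n u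
  linarith [le_log_of_exp_mul_le (by positivity) h3 h1.sma_le_one]

/-! ### Measurability -/

section Measurability

variable {α : Type*} [MeasurableSpace α] {t : ℕ} {past : α → Fin t → RoundInput X Ξ k}
  (hpast : Measurable past) {a : α → RoundInput X Ξ k} (ha : Measurable a)

include hpast ha

lemma measurable_predVal : Measurable fun z => predVal A T (past z) (a z) :=
  measurable_roundP A ((measurable_run A t).comp hpast) ha (measurable_fst.comp
    (measurable_fst.comp ha))

lemma measurable_auxVal : Measurable fun z => auxVal A T (past z) (a z) :=
  measurable_roundQ A ((measurable_run A t).comp hpast) ha (measurable_fst.comp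
    (measurable_fst.comp ha))

lemma measurable_resid : Measurable fun z => resid A T (past z) (a z) :=
  (measurable_outcome.comp (measurable_snd.comp (measurable_fst.comp ha))).sub
    (measurable_subtype_coe.comp (measurable_predVal hpast ha))

lemma measurable_predIndex : Measurable fun z => predIndex A T (past z) (a z) :=
  measurable_remapIndex (measurable_fst.comp ((measurable_run A t).comp hpast))
    (measurable_fst.comp (measurable_snd.comp ha)) (measurable_auxVal hpast ha)

lemma measurable_calPayoff (v : ℕ) (s : ℤˣ) :
    Measurable fun z => calPayoff A T v s t (past z) (a z) :=
  ((measurable_resid hpast ha).const_mul _).mul (Measurable.ite (measurableSet_le measurable_const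
    (measurable_subtype_coe.comp (measurable_predVal hpast ha))) measurable_const measurable_const)

lemma measurable_mixPayoff : Measurable fun z => mixPayoff A T t (past z) (a z) := by
  have hf : Measurable fun p : α × ℕ =>
      (run A T k t (past p.1)).1.f (auxVal A T (past p.1) (a p.1)) p.2 :=
    measurable_from_prod_countable_left fun j => measurable_f
      (measurable_fst.comp ((measurable_run A t).comp hpast)) (measurable_auxVal hpast ha) j
  exact (measurable_resid hpast ha).mul
    (hf.comp (measurable_id.prodMk (measurable_predIndex hpast ha)))

end Measurability

end Round

/-! ### Concentration -/

section Concentration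

lemma lintegral_le_of_forall_le {Y : Type*} [MeasurableSpace Y] {μ : Measure Y}
    [IsProbabilityMeasure μ] {g : Y → ℝ≥0∞} {c : ℝ≥0∞} (h : ∀ y, g y ≤ c) : ∫⁻ y, g y ∂μ ≤ c :=
  (lintegral_mono h).trans_eq (by simp)

lemma lintegral_exp_le_of_abs_le {Y : Type*} [MeasurableSpace Y] (μ : Measure Y)
    [IsProbabilityMeasure μ] {g : Y → ℝ} (hg : Measurable g) (hg1 : ∀ y, |g y| ≤ 1) {m : ℝ}
    (hm : ∫ y, g y ∂μ ≤ m) {θ : ℝ} (hθ : 0 ≤ θ) :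
    ∫⁻ y, ENNReal.ofReal (Real.exp (θ * g y)) ∂μ ≤
      ENNReal.ofReal (Real.exp (θ * m + 2 * θ ^ 2)) := by
  rw [← ofReal_integral_eq_lintegral_ofReal (integrable_exp_of_abs_le hg hg1 θ)
    (Filter.Eventually.of_forall fun _ => (Real.exp_pos _).le)]
  refine ENNReal.ofReal_le_ofReal ((integral_exp_le_of_sub_le μ hg hg1 (c := 2)
    (Filter.Eventually.of_forall fun p => ?_) θ).trans (Real.exp_le_exp.2 ?_))
  · have h1 := abs_le.1 (hg1 p.1)
    have h2 := abs_le.1 (hg1 p.2)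
    rw [abs_le]
    constructor <;> linarith
  · have := mul_le_mul_of_nonneg_left hm hθ
    linarith

section Azuma

variable {Z O : Type*} [MeasurableSpace Z] [MeasurableSpace O] (D : Measure Z)
  [IsProbabilityMeasure D] (P' : Measure O) [IsProbabilityMeasure P']

lemma measurable_integral_fst {W : (t : ℕ) → (Fin t → Z × O) → Z × O → ℝ}
    (hW : ∀ t, Measurable fun z : (Fin t → Z × O) × (Z × O) => W t z.1 z.2) (t : ℕ) :
    Measurable fun p : (Fin t → Z × O) × (Z × O) => ∫ z, W t p.1 (z, p.2.2) ∂D := by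
  have h : Measurable fun q : ((Fin t → Z × O) × (Z × O)) × Z => W t q.1.1 (q.2, q.1.2.2) :=
    (hW t).comp ((measurable_fst.comp measurable_fst).prodMk (measurable_snd.prodMk
      (measurable_snd.comp (measurable_snd.comp measurable_fst))))
  exact (h.stronglyMeasurable.integral_prod_right' (ν := D)).measurable

/-- Concentration of an adapted sum around the sum of its averages over fresh samples. -/
lemma measure_sum_integral_sub_ge_le {W : (t : ℕ) → (Fin t → Z × O) → Z × O → ℝ}
    (hW : ∀ t, Measurable fun z : (Fin t → Z × O) × (Z × O) => W t z.1 z.2)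
    (hW1 : ∀ t p u, |W t p u| ≤ 1) {θ : ℝ} (hθ : 0 < θ) (n : ℕ) (a : ℝ) :
    (Measure.pi fun _ : Fin n => D.prod P') {u | a ≤ ∑ t : Fin n,
      ((∫ z, W t (pre u t) (z, (u t).2) ∂D) - W t (pre u t) (u t))} ≤
      ENNReal.ofReal (Real.exp (n * (2 * θ ^ 2) - θ * a)) := by
  have hF : ∀ t, Measurable fun p : (Fin t → Z × O) × (Z × O) =>
      (∫ z, W t p.1 (z, p.2.2) ∂D) - W t p.1 p.2 := fun t =>
    (measurable_integral_fst D hW t).sub (hW t)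
  refine measure_sum_pre_ge_le (D.prod P') (fun t past u =>
    (∫ z, W t past (z, u.2) ∂D) - W t past u) hF hθ (fun t past => ?_) n a
  have hFp : Measurable fun u : Z × O => ENNReal.ofReal (Real.exp (θ *
      ((∫ z, W t past (z, u.2) ∂D) - W t past u))) := by
    have := (hF t).comp (measurable_prodMk_left (x := past))
    exact (Real.measurable_exp.comp (this.const_mul θ)).ennreal_ofReal
  -- With the past and the other randomness `o` frozen, only the fresh sample varies, and the term
  -- is centred under its law.
  rw [lintegral_prod_symm' _ hFp]
  refine lintegral_le_of_forall_le fun o => ?_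
  have hWo : Measurable fun z : Z => -W t past (z, o) :=
    ((hW t).comp (measurable_const.prodMk (measurable_id.prodMk measurable_const))).neg
  have h1 := lintegral_exp_le_of_abs_le D hWo (fun z => by rw [abs_neg]; exact hW1 _ _ _)
    (integral_neg _).le hθ.le
  set M := ∫ z, W t past (z, o) ∂D
  calc ∫⁻ z, ENNReal.ofReal (Real.exp (θ * (M - W t past (z, o)))) ∂D
      = ∫⁻ z, ENNReal.ofReal (Real.exp (θ * M)) *
          ENNReal.ofReal (Real.exp (θ * -W t past (z, o))) ∂D := by
        refine lintegral_congr fun z => ?_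
        rw [← ENNReal.ofReal_mul (Real.exp_pos _).le, ← Real.exp_add]
        ring_nf
    _ = ENNReal.ofReal (Real.exp (θ * M)) *
          ∫⁻ z, ENNReal.ofReal (Real.exp (θ * -W t past (z, o))) ∂D :=
        lintegral_const_mul _ (Real.measurable_exp.comp (hWo.const_mul θ)).ennreal_ofReal
    _ ≤ ENNReal.ofReal (Real.exp (θ * M)) * ENNReal.ofReal (Real.exp (θ * -M + 2 * θ ^ 2)) := by
        gcongr
    _ = ENNReal.ofReal (Real.exp (2 * θ ^ 2)) := by
        rw [← ENNReal.ofReal_mul (Real.exp_pos _).le, ← Real.exp_add]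
        ring_nf

end Azuma

variable {X Ξ : Type*} [MeasurableSpace X] [MeasurableSpace Ξ] {ν : Measure Ξ}
  [IsProbabilityMeasure ν] (A : Learner X Ξ ν) {T k : ℕ} (D : Measure (X × Bool))
  [IsProbabilityMeasure D]

/-- The law of the random inputs of one round. -/
abbrev roundMeasure (D : Measure (X × Bool)) (ν : Measure Ξ) (k : ℕ) :
    Measure (RoundInput X Ξ k) :=
  D.prod ((volume : Measure I).prod (ν.prod (Measure.pi fun _ : Fin k => ν)))

/-- The payoff of the weighted average of the experts is small. -/
lemma measure_sum_mixPayoff_ge_le (hT : 2 ≤ T) {θ : ℝ} (hθ : 0 < θ) (a : ℝ) :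
    (Measure.pi fun _ : Fin T => roundMeasure D ν k)
      {u | a ≤ ∑ t : Fin T, mixPayoff A T t (pre u t) (u t)} ≤
      ENNReal.ofReal (Real.exp (T * (θ * (1 / T) + 2 * θ ^ 2) - θ * a)) := by
  have hm : ∀ t, Measurable fun p : (Fin t → RoundInput X Ξ k) × RoundInput X Ξ k =>
      mixPayoff A T t p.1 p.2 := fun t => measurable_mixPayoff measurable_fst measurable_snd
  refine measure_sum_pre_ge_le _ (mixPayoff A T) hm hθ (fun t past => ?_) T a
  have hFp : Measurable fun u : RoundInput X Ξ k =>
      ENNReal.ofReal (Real.exp (θ * mixPayoff A T t past u)) := by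
    have := (hm t).comp (measurable_prodMk_left (x := past))
    exact (Real.measurable_exp.comp (this.const_mul θ)).ennreal_ofReal
  rw [lintegral_prod _ hFp.aemeasurable]
  refine lintegral_le_of_forall_le fun z => ?_
  have hFz : Measurable fun o : I × Ξ × (Fin k → Ξ) =>
      ENNReal.ofReal (Real.exp (θ * mixPayoff A T t past (z, o))) :=
    hFp.comp measurable_prodMk_left
  -- This order of integration puts `ζ` innermost: with the sample and all seeds frozen, the zero
  -- crossing bound applies to each outcome.
  rw [lintegral_prod_symm' _ hFz]
  refine lintegral_le_of_forall_le fun r => ?_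
  have hpr := isProb_run (A := A) (k := k) hT t past
  refine lintegral_exp_le_of_abs_le volume ?_ (fun ζ => ?_) ?_ hθ.le
  · exact (hm t).comp (measurable_const.prodMk (measurable_const.prodMk
      (measurable_id.prodMk measurable_const)))
  · rw [mixPayoff, abs_mul]
    exact mul_le_one₀ (abs_resid_le _ _) (abs_nonneg _) (hpr.abs_f_le (abs_auxVal_le _ _) _)
  · refine le_of_eq_of_le ?_ (hpr.integral_crossing_le (by omega)
      (abs_auxVal_le (A := A) (T := T) past (z, (0 : I), r)) (outcome_mem z.2))
    refine integral_congr_ae (Filter.Eventually.of_forall fun ζ => ?_)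
    simp only [mixPayoff, resid, coe_predVal]
    rfl

/-- One seed moves the average by at most `2/k`, so bounded differences give the exponent `2θ²/k ≤
2`. The absolute value costs a factor `2 ≤ e`. -/
lemma lintegral_exp_abs_mean_sub_average_le {t : ℕ} (hist : Hist X Ξ t) (x : X) {θ : ℝ}
    (hθ : 0 < θ) (hk : θ ^ 2 ≤ k) :
    ∫⁻ rs, ENNReal.ofReal (Real.exp (θ * |A.mean hist x - A.average hist rs x|))
      ∂(Measure.pi fun _ : Fin k => ν) ≤ ENNReal.ofReal (Real.exp 3) := by
  set g : (Fin k → Ξ) → ℝ := fun rs => A.average hist rs x with hg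
  have hgm : Measurable g := measurable_average A measurable_const measurable_id measurable_const
  have hg1 : ∀ rs, |g rs| ≤ 1 := fun rs => abs_average_le _ _ _
  have hk0 : (0 : ℝ) < k := lt_of_lt_of_le (by positivity) hk
  have hpm : Measurable fun r => A.predict t hist r x :=
    (A.measurable_predict t).comp (measurable_const.prodMk (measurable_id.prodMk measurable_const))
  have hpB : ∀ r, |A.predict t hist r x| ≤ 1 := fun r => abs_le.2 (A.predict_mem t hist r x)
  have hgi : ∫ rs, g rs ∂(Measure.pi fun _ : Fin k => ν) = A.mean hist x := by
    simp only [hg, Learner.average]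
    have hji : ∀ j : Fin k, Integrable (fun rs : Fin k → Ξ => A.predict t hist (rs j) x)
        (Measure.pi fun _ : Fin k => ν) := fun j =>
      integrable_of_abs_le (hpm.comp (measurable_pi_apply j)) fun rs => hpB (rs j)
    rw [integral_div, integral_finsetSum _ fun j _ => hji j]
    have : ∀ j : Fin k, ∫ rs : Fin k → Ξ, A.predict t hist (rs j) x
        ∂(Measure.pi fun _ : Fin k => ν) = A.mean hist x := fun j => by
      have h2 := measurePreserving_eval (fun _ : Fin k => ν) j
      have h3 := integral_map (μ := Measure.pi fun _ : Fin k => ν) h2.measurable.aemeasurable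
        (f := fun r => A.predict t hist r x) hpm.aestronglyMeasurable
      rw [h2.map_eq] at h3
      exact h3.symm
    simp_rw [this]
    rw [Finset.sum_const, Finset.card_univ, Fintype.card_fin, nsmul_eq_mul]
    field_simp
  have hdiff : ∀ j : Fin k, ∀ rs (r : Ξ), |g rs - g (Function.update rs j r)| ≤ 2 / k :=
    fun j rs r => by
      simp only [hg, Learner.average]
      rw [← sub_div, abs_div, Nat.abs_cast]
      refine div_le_div_of_nonneg_right ?_ hk0.le
      rw [← Finset.sum_sub_distrib, Finset.sum_eq_single j]
      · have h1 := abs_le.1 (hpB (rs j))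
        have h2 := abs_le.1 (hpB r)
        rw [Function.update_self, abs_le]
        constructor <;> linarith
      · intro i _ hij
        rw [Function.update_of_ne hij, sub_self]
      · simp
  have hmc : ∀ θ' : ℝ, θ' ^ 2 ≤ k → ∫⁻ rs, ENNReal.ofReal (Real.exp (θ' * (g rs - A.mean hist x)))
      ∂(Measure.pi fun _ : Fin k => ν) ≤ ENNReal.ofReal (Real.exp 2) := fun θ' hθ' => by
    have h1 := integral_exp_le_of_boundedDifferences ν hgm hg1 (c := 2 / k)
      (fun j => Filter.Eventually.of_forall fun p => hdiff j p.1 p.2) θ'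
    rw [hgi] at h1
    rw [← ofReal_integral_eq_lintegral_ofReal]
    · refine ENNReal.ofReal_le_ofReal ?_
      have h2 : ∀ rs, Real.exp (θ' * (g rs - A.mean hist x)) =
          Real.exp (θ' * g rs) * Real.exp (-(θ' * A.mean hist x)) := fun rs => by
        rw [← Real.exp_add]
        ring_nf
      simp_rw [h2]
      rw [integral_mul_const]
      refine (mul_le_mul_of_nonneg_right h1 (Real.exp_pos _).le).trans ?_
      rw [← Real.exp_add]
      refine Real.exp_le_exp.2 ?_
      have h3 : (k : ℝ) * (θ' ^ 2 * (2 / (k : ℝ)) ^ 2 / 2) = 2 * (θ' ^ 2 / k) := by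
        field_simp
      have h4 : θ' ^ 2 / k ≤ 1 := (div_le_one hk0).2 hθ'
      rw [h3]
      linarith
    · refine integrable_exp_of_abs_le (g := fun rs => g rs - A.mean hist x)
        (hgm.sub_const _) (B := 1 + |A.mean hist x|) (fun rs => ?_) θ'
      exact (abs_sub _ _).trans (add_le_add (hg1 rs) le_rfl)
    · exact Filter.Eventually.of_forall fun _ => (Real.exp_pos _).le
  have hmeas : ∀ θ' : ℝ, Measurable fun rs =>
      ENNReal.ofReal (Real.exp (θ' * (g rs - A.mean hist x))) := fun θ' =>
    (Real.measurable_exp.comp ((hgm.sub_const _).const_mul θ')).ennreal_ofReal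
  calc ∫⁻ rs, ENNReal.ofReal (Real.exp (θ * |A.mean hist x - A.average hist rs x|))
        ∂(Measure.pi fun _ : Fin k => ν)
      ≤ ∫⁻ rs, ENNReal.ofReal (Real.exp (θ * (g rs - A.mean hist x))) +
          ENNReal.ofReal (Real.exp (-θ * (g rs - A.mean hist x)))
        ∂(Measure.pi fun _ : Fin k => ν) := by
        refine lintegral_mono fun rs => ?_
        simp only
        rw [← ENNReal.ofReal_add (Real.exp_pos _).le (Real.exp_pos _).le]
        refine ENNReal.ofReal_le_ofReal ?_
        have : A.average hist rs x = g rs := rfl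
        rw [this]
        rcases abs_cases (A.mean hist x - g rs) with ⟨h, -⟩ | ⟨h, -⟩
        · rw [h, show θ * (A.mean hist x - g rs) = -θ * (g rs - A.mean hist x) by ring]
          linarith [Real.exp_pos (θ * (g rs - A.mean hist x))]
        · rw [h, show θ * -(A.mean hist x - g rs) = θ * (g rs - A.mean hist x) by ring]
          linarith [Real.exp_pos (-θ * (g rs - A.mean hist x))]
    _ ≤ ENNReal.ofReal (Real.exp 2) + ENNReal.ofReal (Real.exp 2) := by
        rw [lintegral_add_left (hmeas θ)]
        exact add_le_add (hmc θ hk) (hmc (-θ) (by rwa [neg_sq]))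
    _ ≤ ENNReal.ofReal (Real.exp 3) := by
        rw [← ENNReal.ofReal_add (Real.exp_pos _).le (Real.exp_pos _).le]
        refine ENNReal.ofReal_le_ofReal ?_
        have h1 : Real.exp 3 = Real.exp 2 * Real.exp 1 := by
          rw [← Real.exp_add]
          norm_num
        have h2 := Real.add_one_le_exp 1
        have h3 := Real.exp_pos 2
        rw [h1]
        nlinarith

lemma lintegral_roundMeasure_le (D : Measure (X × Bool)) [IsProbabilityMeasure D]
    {G : RoundInput X Ξ k → ℝ≥0∞} (hG : Measurable G) {c : ℝ≥0∞}
    (h : ∀ z ζ r, ∫⁻ rs, G (z, ζ, r, rs) ∂(Measure.pi fun _ : Fin k => ν) ≤ c) :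
    ∫⁻ u, G u ∂roundMeasure D ν k ≤ c := by
  rw [lintegral_prod _ hG.aemeasurable]
  refine lintegral_le_of_forall_le fun z => ?_
  have h1 : Measurable fun o => G (z, o) := hG.comp measurable_prodMk_left
  rw [lintegral_prod _ h1.aemeasurable]
  refine lintegral_le_of_forall_le fun ζ => ?_
  have h2 : Measurable fun o => G (z, ζ, o) := h1.comp measurable_prodMk_left
  rw [lintegral_prod _ h2.aemeasurable]
  exact lintegral_le_of_forall_le fun r => h z ζ r

/-- The resampled predictor is close to the mean of the strategy. -/
lemma measure_sum_abs_mean_sub_ge_le {θ : ℝ} (hθ : 0 < θ) (hk : θ ^ 2 ≤ k) (n : ℕ) (a : ℝ) :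
    (Measure.pi fun _ : Fin n => roundMeasure D ν k)
      {u | a ≤ ∑ t : Fin n, |A.mean (run A T k t (pre u t)).2 (u t).1.1 -
        auxVal A T (pre u t) (u t)|} ≤ ENNReal.ofReal (Real.exp (n * 3 - θ * a)) := by
  have hm : ∀ t, Measurable fun p : (Fin t → RoundInput X Ξ k) × RoundInput X Ξ k =>
      |A.mean (run A T k t p.1).2 p.2.1.1 - auxVal A T p.1 p.2| := fun t =>
    ((measurable_mean A (measurable_snd.comp ((measurable_run A t).comp measurable_fst))
      (measurable_fst.comp (measurable_fst.comp measurable_snd))).sub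
      (measurable_auxVal measurable_fst measurable_snd)).abs
  refine measure_sum_pre_ge_le _ (fun t past u => |A.mean (run A T k t past).2 u.1.1 -
    auxVal A T past u|) hm hθ (fun t past => ?_) n a
  have hFp : Measurable fun u : RoundInput X Ξ k => ENNReal.ofReal (Real.exp (θ *
      |A.mean (run A T k t past).2 u.1.1 - auxVal A T past u|)) := by
    have := (hm t).comp (measurable_prodMk_left (x := past))
    exact (Real.measurable_exp.comp (this.const_mul θ)).ennreal_ofReal
  refine lintegral_roundMeasure_le D hFp fun z ζ r => ?_
  exact lintegral_exp_abs_mean_sub_average_le A (run A T k t past).2 z.1 hθ hk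

end Concentration

/-! ### The guarantee of the learner along the run -/

section Oracle

variable {X Ξ : Type*} [MeasurableSpace X] [MeasurableSpace Ξ] {ν : Measure Ξ}
  {A : Learner X Ξ ν} {T k : ℕ}

lemma run_hist : ∀ (n : ℕ) (u : Fin n → RoundInput X Ξ k) (s : Fin n),
    (run A T k n u).2 s = ((u s).1.1, resid A T (pre u s) (u s), (u s).2.2.1)
  | 0, _, s => s.elim0
  | n + 1, u, s => by
    have hrun : (run A T k (n + 1) u).2 = Fin.snoc (α := fun _ => X × ℝ × Ξ)
      (run A T k n (fun i => u i.castSucc)).2 ((u (Fin.last n)).1.1,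
        resid A T (fun i : Fin n => u i.castSucc) (u (Fin.last n)), (u (Fin.last n)).2.2.1) := rfl
    rw [hrun]
    induction s using Fin.lastCases with
    | last =>
      rw [Fin.snoc_last]
      rfl
    | cast s =>
      rw [Fin.snoc_castSucc, run_hist n]
      rfl

/-- The inputs of a round except the learner's own seed. -/
abbrev EnvInput (X Ξ : Type*) (k : ℕ) := (X × Bool) × I × (Fin k → Ξ)

/-- Insert the learner's own seed. -/
def joinSeed (p : EnvInput X Ξ k × Ξ) : RoundInput X Ξ k := (p.1.1, p.1.2.1, p.2, p.1.2.2)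

lemma measurable_joinSeed : Measurable (joinSeed (X := X) (Ξ := Ξ) (k := k)) := by
  unfold joinSeed
  fun_prop

lemma measurePreserving_joinSeed (D : Measure (X × Bool)) [IsProbabilityMeasure D]
    [IsProbabilityMeasure ν] :
    MeasurePreserving (joinSeed (X := X) (Ξ := Ξ) (k := k))
      ((D.prod ((volume : Measure I).prod (Measure.pi fun _ : Fin k => ν))).prod ν)
      (roundMeasure D ν k) := by
  have a1 := measurePreserving_prodAssoc D
    ((volume : Measure I).prod (Measure.pi fun _ : Fin k => ν)) ν
  have a2 := (MeasurePreserving.id D).prod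
    (measurePreserving_prodAssoc (volume : Measure I) (Measure.pi fun _ : Fin k => ν) ν)
  have a3 := (MeasurePreserving.id D).prod ((MeasurePreserving.id (volume : Measure I)).prod
    (Measure.measurePreserving_swap (μ := Measure.pi fun _ : Fin k => ν) (ν := ν)))
  exact a3.comp (a2.comp a1)

/-- The inputs of all rounds, assembled from the environment and the learner's seeds. -/
def joinSeeds (p : (Fin T → EnvInput X Ξ k) × (Fin T → Ξ)) : Fin T → RoundInput X Ξ k :=
  fun i => joinSeed (p.1 i, p.2 i)

lemma measurePreserving_joinSeeds (D : Measure (X × Bool)) [IsProbabilityMeasure D]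
    [IsProbabilityMeasure ν] :
    MeasurePreserving (joinSeeds (X := X) (Ξ := Ξ) (T := T) (k := k))
      ((Measure.pi fun _ => D.prod ((volume : Measure I).prod (Measure.pi fun _ : Fin k => ν))).prod
        (Measure.pi fun _ => ν)) (Measure.pi fun _ => roundMeasure D ν k) := by
  have h1 := (measurePreserving_arrowProdEquivProdArrow (EnvInput X Ξ k) Ξ (Fin T)
    (fun _ => D.prod ((volume : Measure I).prod (Measure.pi fun _ : Fin k => ν)))
    (fun _ => ν)).symm
  have h2 := measurePreserving_pi (ι := Fin T) _ _
    (fun _ => measurePreserving_joinSeed (ν := ν) (k := k) D)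
  exact h2.comp h1

/-- The adversary which plays the samples and the residuals of the run, for fixed values of all
random inputs except the learner's own seeds. -/
def runAdversary (A : Learner X Ξ ν) (hT : 0 < T) (e : Fin T → EnvInput X Ξ k) (r₀ : Ξ) :
    Adversary X Ξ where
  -- The seed `r₀` fills the slot of the learner's current seed, on which the residual does not
  -- depend, so only earlier seeds are used. Rounds from `T` on are never played.
  move t r := if h : t < T then ((e ⟨t, h⟩).1.1,
      resid A T (fun i => joinSeed (e (Fin.castLE h.le i), r i)) (joinSeed (e ⟨t, h⟩, r₀)))
    else ((e ⟨0, hT⟩).1.1, 0)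
  label_mem t r := by
    split_ifs with h
    · exact abs_le.1 (abs_resid_le _ _)
    · simp
  measurable_move t := by
    by_cases h : t < T
    · simp only [h, dif_pos]
      refine measurable_const.prodMk (measurable_resid (measurable_pi_lambda _ fun i => ?_)
        measurable_const)
      exact measurable_joinSeed.comp (measurable_const.prodMk (measurable_pi_apply i))
    · simp only [h, dif_neg, not_false_eq_true]
      exact measurable_const

lemma runAdversary_move (hT : 0 < T) (e : Fin T → EnvInput X Ξ k) (r₀ : Ξ) (r : Fin T → Ξ)
    (t : Fin T) : (runAdversary A hT e r₀).move t (pre r t) =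
      ((joinSeeds (e, r) t).1.1, resid A T (pre (joinSeeds (e, r)) t) (joinSeeds (e, r) t)) := by
  simp only [runAdversary, t.isLt, dif_pos]
  rfl

/-- Hence the strategies in the learner's guarantee are those of the run. -/
lemma runAdversary_hist (hT : 0 < T) (e : Fin T → EnvInput X Ξ k) (r₀ : Ξ) (r : Fin T → Ξ)
    (t : Fin T) : (runAdversary A hT e r₀).hist (pre r t) =
      (run A T k t (pre (joinSeeds (e, r)) t)).2 := by
  funext s
  rw [run_hist]
  have h := runAdversary_move (A := A) hT e r₀ r (Fin.castLE t.isLt.le s)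
  have h1 : (runAdversary A hT e r₀).move s (pre (pre r t) s) =
      (runAdversary A hT e r₀).move (Fin.castLE t.isLt.le s) (pre r (Fin.castLE t.isLt.le s)) := rfl
  simp only [Adversary.hist, h1, h]
  rfl

/-- The regret bound of the learner along the run of the algorithm. -/
lemma measure_oracle_fail_le [IsProbabilityMeasure ν] (D : Measure (X × Bool))
    [IsProbabilityMeasure D] {C : Set (X → ℝ)} (hne : C.Nonempty)
    (hC : ∀ c ∈ C, ∀ x, |c x| ≤ 2) (hS : SupMeasurable (D.map Prod.fst) C T) (hT : 0 < T)
    {δ reg : ℝ} (hA : A.IsOWAL (signed C) T δ reg) :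
    (Measure.pi fun _ : Fin T => roundMeasure D ν k) {u | ¬ ∀ c ∈ signed C,
      ∑ t : Fin T, c (u t).1.1 * resid A T (pre u t) (u t) ≤
        ∑ t : Fin T, A.mean (run A T k t (pre u t)).2 (u t).1.1 * resid A T (pre u t) (u t) + reg}
      ≤ ENNReal.ofReal δ := by
  have : IsProbabilityMeasure (D.map Prod.fst) :=
    Measure.isProbabilityMeasure_map measurable_fst.aemeasurable
  obtain ⟨G, hG, hGae, hGm⟩ := exists_measurable_indicator_supSum hne hC hS
  set P : Measure (Fin T → RoundInput X Ξ k) := Measure.pi fun _ => roundMeasure D ν k with hP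
  set xs : (Fin T → RoundInput X Ξ k) → Fin T → X := fun u i => (u i).1.1 with hxs
  set R : (Fin T → RoundInput X Ξ k) → ℝ := fun u => ∑ t : Fin T,
    A.mean (run A T k t (pre u t)).2 (u t).1.1 * resid A T (pre u t) (u t) with hR
  set w : ℤˣ → (Fin T → RoundInput X Ξ k) → Fin T → ℝ := fun s u t =>
    ((s : ℤ) : ℝ) * resid A T (pre u t) (u t) with hw
  set bad : Set (Fin T → RoundInput X Ξ k) := {u | ¬ ∀ c ∈ signed C,
      ∑ t : Fin T, c (u t).1.1 * resid A T (pre u t) (u t) ≤ R u + reg} with hbad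
  -- The failure event quantifies over the class and may fail to be measurable. On `G` it agrees
  -- with this measurable set, to which Fubini applies.
  set M : Set (Fin T → RoundInput X Ξ k) := {u | xs u ∈ G} ∩
    ⋃ s : ℤˣ, {u | R u + reg < G.indicator (supSum C (w s u)) (xs u)} with hM
  have hmpx : MeasurePreserving xs P (Measure.pi fun _ => D.map Prod.fst) := by
    refine measurePreserving_pi (fun _ : Fin T => roundMeasure D ν k) (fun _ => D.map Prod.fst)
      (f := fun _ a => a.1.1) fun _ => ?_
    have h1 : MeasurePreserving (Prod.fst : X × Bool → X) D (D.map Prod.fst) :=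
      ⟨measurable_fst, rfl⟩
    exact h1.comp measurePreserving_fst
  have hresm : ∀ t : Fin T, Measurable fun u : Fin T → RoundInput X Ξ k =>
      resid A T (pre u t) (u t) := fun t =>
    measurable_resid (measurable_pre t) (measurable_pi_apply t)
  have hRm : Measurable R := Finset.measurable_sum _ fun t _ =>
    (measurable_mean A (measurable_snd.comp ((measurable_run A t).comp (measurable_pre t)))
      (measurable_fst.comp (measurable_fst.comp (measurable_pi_apply t)))).mul (hresm t)
  have hwm : ∀ s, Measurable (w s) := fun s =>
    measurable_pi_lambda _ fun t => (hresm t).const_mul _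
  have hMm : MeasurableSet M := (hmpx.measurable hG).inter (MeasurableSet.iUnion fun s =>
    measurableSet_lt (hRm.add_const reg) (hGm.comp ((hwm s).prodMk hmpx.measurable)))
  have hiff : ∀ u, xs u ∈ G → (u ∈ M ↔ u ∈ bad) := fun u hu => by
    have := hne.to_subtype
    simp only [hM, hbad, Set.mem_inter_iff, Set.mem_iUnion, Set.mem_ofPred_eq, hu, true_and,
      Set.indicator_of_mem hu]
    push Not
    constructor
    · rintro ⟨s, hs⟩
      obtain ⟨c, hc⟩ := exists_lt_of_lt_ciSup hs
      refine ⟨_, ⟨s, c.1, c.2, rfl⟩, hc.trans_eq (Finset.sum_congr rfl fun t _ => ?_)⟩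
      simp only [hw, hxs]
      ring
    · rintro ⟨_, ⟨s, c, hc, rfl⟩, h⟩
      refine ⟨s, h.trans_le (le_of_eq_of_le (Finset.sum_congr rfl fun t _ => ?_)
        (le_supSum hC hc (w s u) (xs u)))⟩
      simp only [hw, hxs]
      ring
  have hsub : bad ⊆ M ∪ {u | ¬ xs u ∈ G} := fun u hu => by
    by_cases h : xs u ∈ G
    · exact Or.inl ((hiff u h).2 hu)
    · exact Or.inr h
  have hnull : P {u | ¬ xs u ∈ G} = 0 := hmpx.quasiMeasurePreserving.ae hGae
  have hMle : P M ≤ ENNReal.ofReal δ := by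
    have hj := measurePreserving_joinSeeds (X := X) (T := T) (k := k) (ν := ν) D
    rw [hP, ← hj.measure_preimage hMm.nullMeasurableSet,
      Measure.prod_apply (hj.measurable hMm)]
    -- Given everything but the learner's own seeds, the run is a play against a fixed adversary.
    -- The seeds of the resamples count as environment, being independent of the learner's own.
    refine lintegral_le_of_forall_le fun e => ?_
    obtain ⟨r₀⟩ : Nonempty Ξ := nonempty_of_isProbabilityMeasure ν
    by_cases he : (fun i => (e i).1.1) ∈ G
    · refine (measure_mono fun r hr => ?_).trans (hA (runAdversary A hT e r₀))
      have h1 : joinSeeds (e, r) ∈ bad := (hiff _ he).1 hr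
      simp only [Set.mem_ofPred_eq, runAdversary_move, runAdversary_hist]
      exact h1
    · have : Prod.mk e ⁻¹' (joinSeeds ⁻¹' M) = ∅ := by
        ext r
        simp only [Set.mem_preimage, Set.mem_empty_iff_false, iff_false]
        exact fun h => he h.1
      rw [this, measure_empty]
      exact zero_le
  calc P bad ≤ P M + P {u | ¬ xs u ∈ G} := (measure_mono hsub).trans (measure_union_le _ _)
    _ ≤ ENNReal.ofReal δ := by rw [hnull, add_zero]; exact hMle

end Oracle

/-! ### From calibration and multiaccuracy to omniprediction -/

section Losses

/-- The loss is affine in the binary outcome with slope `l.delta q`, and its mean under `Ber(p)` is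
the value at outcome `p`. -/
lemma Loss.eq_berRisk_add (l : Loss) (p q : I) (y : Bool) :
    l q y = l.berRisk p q + (outcome y - p) * l.delta q := by
  cases y <;> simp [Loss.berRisk, Loss.delta, outcome] <;> ring

lemma Loss.IsBounded.abs_le {l : Loss} (hl : l.IsBounded) (q : I) (y : Bool) : |l q y| ≤ 1 :=
  _root_.abs_le.2 (hl q y)

lemma Loss.IsBounded.abs_delta_le {l : Loss} (hl : l.IsBounded) (q : I) : |l.delta q| ≤ 2 := by
  have h1 := hl q true
  have h2 := hl q false
  rw [Loss.delta, _root_.abs_le]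
  constructor <;> linarith [h1.1, h1.2, h2.1, h2.2]

/-- The discrete derivative of a proper loss is antitone. -/
lemma Loss.IsBestResponse.antitone_delta {l : Loss} {κ : I → I} (hκ : l.IsBestResponse κ) :
    Antitone fun p => l.delta (κ p) := by
  intro p p' hpp
  rcases hpp.eq_or_lt with rfl | hlt
  · exact le_rfl
  -- Each best response beats the other at its own parameter. In the sum only `p' - p` times the
  -- increment of `delta` remains.
  have h1 := hκ p (κ p')
  have h2 := hκ p' (κ p)
  have hlt' : (p : ℝ) < p' := hlt
  simp only [Loss.berRisk, Loss.delta] at *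
  by_contra h
  rw [not_le] at h
  nlinarith

/-- The part of a loss that the outcomes do not explain is at most that of any competitor. -/
lemma Loss.IsBestResponse.sub_le {l : Loss} {κ : I → I} (hκ : l.IsBestResponse κ) (p q : I)
    (y : Bool) : l (κ p) y - l q y ≤
      (outcome y - p) * l.delta (κ p) - (outcome y - p) * l.delta q := by
  rw [l.eq_berRisk_add p (κ p) y, l.eq_berRisk_add p q y]
  linarith [hκ p q]

end Losses

/-! ### Antitone functions on the grid as combinations of thresholds -/

section Thresholds

lemma Th_grid {T : ℕ} (hT : 0 < T) (v j : ℕ) :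
    Th ((v : ℝ) / T) ((j : ℝ) / T) = if v ≤ j then 1 else -1 := by
  have hT' : (0 : ℝ) < T := by exact_mod_cast hT
  unfold Th
  simp only [div_le_div_iff_of_pos_right hT', Nat.cast_le]

/-- A bounded antitone function on the grid is a combination of thresholds with bounded
coefficients. -/
lemma exists_threshold_coeff {T : ℕ} (hT : 0 < T) {a : ℕ → ℝ}
    (ha : ∀ i j, i ≤ j → j ≤ T → a j ≤ a i) (ha2 : ∀ j, j ≤ T → |a j| ≤ 2) :
    ∃ α : Fin (T + 1) → ℝ, ∑ v, |α v| ≤ 4 ∧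
      ∀ j, j ≤ T → ∑ v : Fin (T + 1), α v * Th ((v : ℕ) / (T : ℝ)) ((j : ℝ) / T) = a j := by
  -- Thresholds jump by `2`, so each carries half the jump of `a`; the threshold at `0` is
  -- constantly `1` on the grid and carries the mean of the end values. By monotonicity the jumps
  -- have total size `(a 0 - a T)/2 ≤ 2`, and the constant adds at most `2`.
  refine ⟨Fin.cons ((a 0 + a T) / 2) fun v : Fin T => (a (v + 1) - a v) / 2, ?_, fun j hj => ?_⟩
  · rw [Fin.sum_univ_succ]
    simp only [Fin.cons_zero, Fin.cons_succ]
    have h1 : ∑ v : Fin T, |(a (v + 1) - a v) / 2| = (a 0 - a T) / 2 := by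
      have h2 : ∀ v : Fin T, |(a (v + 1) - a v) / 2| = (fun i => -(a (i + 1) - a i) / 2) v :=
        fun v => by
          have := ha v (v + 1) (by omega) v.isLt
          rw [abs_of_nonpos (by linarith)]
          ring
      simp_rw [h2]
      rw [Fin.sum_univ_eq_sum_range (fun i => -(a (i + 1) - a i) / 2) T, ← Finset.sum_div,
        Finset.sum_neg_distrib, Finset.sum_range_sub]
      ring
    rw [h1]
    have h3 := abs_le.1 (ha2 0 (Nat.zero_le _))
    have h4 := abs_le.1 (ha2 T le_rfl)
    have h5 : |(a 0 + a T) / 2| ≤ 2 := by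
      rw [abs_le]
      constructor <;> linarith
    linarith
  · rw [Fin.sum_univ_succ]
    simp only [Th_grid hT, Fin.cons_zero, Fin.cons_succ, Fin.val_zero, Fin.val_succ,
      Nat.zero_le, if_true]
    have h1 : ∀ n, ∑ v ∈ Finset.range n, (a (v + 1) - a v) / 2 *
        (if v + 1 ≤ j then (1 : ℝ) else -1) =
        if n ≤ j then (a n - a 0) / 2 else (2 * a j - a 0 - a n) / 2 := fun n => by
      induction n with
      | zero => simp
      | succ n ih =>
        rw [Finset.sum_range_succ, ih]
        by_cases h : n + 1 ≤ j
        · rw [if_pos (by omega), if_pos h, if_pos h]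
          ring
        · rw [if_neg h, if_neg h]
          split_ifs with h2
          · have : n = j := by omega
            subst this
            ring
          · ring
    rw [Fin.sum_univ_eq_sum_range (fun v => (a (v + 1) - a v) / 2 *
      (if v + 1 ≤ j then (1 : ℝ) else -1)) T, h1 T]
    split_ifs with h
    · have : T = j := le_antisymm h hj
      subst this
      ring
    · ring

end Thresholds

section Omniprediction

variable {X : Type*} [MeasurableSpace X] {D : Measure (X × Bool)} [IsProbabilityMeasure D] {T : ℕ}
  {p : Fin T → X → I} {J : Fin T → X → ℕ}

/-- Best responses are not assumed measurable. Since predictions lie on the grid, everything factors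
through the countable space `ℕ × Bool`. -/
lemma measurable_comp_grid (hJ : ∀ t, Measurable (J t)) (hJT : ∀ t x, p t x = gridPoint T (J t x))
    {β : Type*} [MeasurableSpace β] (f : I → Bool → β) (t : Fin T) :
    Measurable fun z : X × Bool => f (p t z.1) z.2 := by
  have h : (fun z : X × Bool => f (p t z.1) z.2) =
      (fun q : ℕ × Bool => f (gridPoint T q.1) q.2) ∘ fun z : X × Bool => (J t z.1, z.2) := by
    funext z
    simp [hJT]
  rw [h]
  exact (measurable_of_countable _).comp ((hJ t).comp measurable_fst |>.prodMk measurable_snd)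

/-- The contribution of the calibration error to the regret. -/
lemma sum_integral_delta_le (hT : 0 < T) (hJ : ∀ t, Measurable (J t))
    (hJT : ∀ t x, p t x = gridPoint T (J t x)) (hJle : ∀ t x, J t x ≤ T) {l : Loss}
    (hl : l.IsBounded) {κ : I → I} (hκ : l.IsBestResponse κ) {a : ℝ}
    (ha : ∀ (v : Fin (T + 1)) (s : ℤˣ), ∑ t, ∫ z, ((s : ℤ) : ℝ) * (outcome z.2 - p t z.1) *
      Th ((v : ℕ) / (T : ℝ)) (p t z.1) ∂D ≤ a) :
    ∑ t, ∫ z, (outcome z.2 - p t z.1) * l.delta (κ (p t z.1)) ∂D ≤ 4 * a := by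
  obtain ⟨α, hα, hαe⟩ := exists_threshold_coeff hT (a := fun j => l.delta (κ (gridPoint T j)))
    (fun i j hij hjT => hκ.antitone_delta (by
      rw [← Subtype.coe_le_coe, coe_gridPoint (hij.trans hjT), coe_gridPoint hjT]
      gcongr)) (fun j _ => hl.abs_delta_le _)
  set N : Fin (T + 1) → ℝ := fun v => ∑ t, ∫ z, (outcome z.2 - p t z.1) *
      Th ((v : ℕ) / (T : ℝ)) (p t z.1) ∂D with hN
  have hNa : ∀ v, |N v| ≤ a := fun v => by
    rw [abs_le]
    have h1 := ha v 1
    have h2 := ha v (-1)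
    simp only [Units.val_one, Int.cast_one, one_mul, Units.val_neg, Int.cast_neg, neg_mul,
      integral_neg, Finset.sum_neg_distrib] at h1 h2
    constructor <;> simp only [hN] <;> linarith
  have hint : ∀ (t : Fin T) (v : Fin (T + 1)), Integrable (fun z => (outcome z.2 - p t z.1) *
      Th ((v : ℕ) / (T : ℝ)) (p t z.1)) D := fun t v =>
    integrable_of_abs_le (measurable_comp_grid hJ hJT (fun q y => (outcome y - q) *
      Th ((v : ℕ) / (T : ℝ)) q) t) (B := 1) fun z => by
        rw [abs_mul, abs_Th, mul_one]
        exact abs_outcome_sub_le _ _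
  have h1 : ∀ t, ∫ z, (outcome z.2 - p t z.1) * l.delta (κ (p t z.1)) ∂D =
      ∑ v, α v * ∫ z, (outcome z.2 - p t z.1) * Th ((v : ℕ) / (T : ℝ)) (p t z.1) ∂D := fun t => by
    simp_rw [← integral_const_mul]
    rw [← integral_finsetSum _ fun v _ => (hint t v).const_mul _]
    refine integral_congr_ae (Filter.Eventually.of_forall fun z => ?_)
    simp only
    have h2 := hαe (J t z.1) (hJle t z.1)
    rw [← coe_gridPoint (hJle t z.1), ← hJT] at h2
    rw [← h2, Finset.mul_sum]
    exact Finset.sum_congr rfl fun v _ => by ring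
  simp_rw [h1]
  rw [Finset.sum_comm]
  calc ∑ v, ∑ t, α v * ∫ z, (outcome z.2 - p t z.1) * Th ((v : ℕ) / (T : ℝ)) (p t z.1) ∂D
      = ∑ v, α v * N v := by simp only [hN, Finset.mul_sum]
    _ ≤ ∑ v, |α v| * a := Finset.sum_le_sum fun v _ => by
        refine (le_abs_self _).trans ?_
        rw [abs_mul]
        exact mul_le_mul_of_nonneg_left (hNa v) (abs_nonneg _)
    _ ≤ 4 * a := by
        rw [← Finset.sum_mul]
        exact mul_le_mul_of_nonneg_right hα ((abs_nonneg _).trans (hNa 0))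

/-- The contribution of the multiaccuracy error to the regret. -/
lemma neg_sum_integral_delta_le (hJ : ∀ t, Measurable (J t))
    (hJT : ∀ t x, p t x = gridPoint T (J t x)) {Ω : Type*} [MeasurableSpace Ω] {g : Ω → Loss}
    (hg : ∀ ω, (g ω).IsBounded) (hgm : ∀ y, Measurable fun z : Ω × I => g z.1 z.2 y) {l : Loss}
    (hl : l.IsBounded) (hlm : ∀ y, Measurable fun q => l q y) {h : X → I} (hh : Measurable h)
    {c : SignedMeasure Ω} {ε lam : ℝ} (hlam : 0 ≤ lam)
    (hc : c.totalVariation Set.univ ≤ ENNReal.ofReal lam)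
    (hcl : ∀ x, |l.uncurried x - signedIntegral c (fun ω => (g ω).uncurried x)| ≤ ε) {b : ℝ}
    (hb : ∀ (s : ℤˣ) ω, ∑ t, ∫ z, ((s : ℤ) : ℝ) * (outcome z.2 - p t z.1) *
      (g ω).delta (h z.1) ∂D ≤ b) (hb0 : 0 ≤ b) :
    -∑ t, ∫ z, (outcome z.2 - p t z.1) * l.delta (h z.1) ∂D ≤ T * (2 * ε) + lam * b := by
  -- The rounds are summed before integrating over `Ω`, because `b` bounds only the sum over rounds.
  set ψ : X × Bool → ℝ := fun z => ∑ t, (outcome z.2 - p t z.1) with hψ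
  have hψm : Measurable ψ := Finset.measurable_sum _ fun t _ =>
    measurable_comp_grid hJ hJT (fun q y => outcome y - q) t
  have hψB : ∀ z, |ψ z| ≤ T := fun z => by
    refine (Finset.abs_sum_le_sum_abs _ _).trans ((Finset.sum_le_sum fun t _ =>
      abs_outcome_sub_le _ _).trans_eq ?_)
    simp
  have hsum : ∀ {d : X → ℝ}, Measurable d → (∀ x, |d x| ≤ 2) →
      ∑ t, ∫ z, (outcome z.2 - p t z.1) * d z.1 ∂D = ∫ z, ψ z * d z.1 ∂D := fun {d} hd hd2 => by
    rw [← integral_finsetSum]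
    · simp_rw [hψ, Finset.sum_mul]
    · refine fun t _ => integrable_of_abs_le (B := 2) ((measurable_comp_grid hJ hJT
        (fun q y => outcome y - (q : ℝ)) t).mul (hd.comp measurable_fst)) fun z => ?_
      rw [abs_mul]
      calc _ ≤ 1 * (2 : ℝ) :=
            mul_le_mul (abs_outcome_sub_le _ _) (hd2 _) (abs_nonneg _) zero_le_one
        _ = 2 := one_mul _
  have hdg : Measurable fun q : Ω × X => (g q.1).delta (h q.2) := by
    have hq : Measurable fun q : Ω × X => (q.1, h q.2) :=
      measurable_fst.prodMk (hh.comp measurable_snd)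
    exact ((hgm true).comp hq).sub ((hgm false).comp hq)
  have hdl : Measurable fun x => l.delta (h x) := ((hlm true).comp hh).sub ((hlm false).comp hh)
  rw [hsum hdl fun x => hl.abs_delta_le _]
  have hN : ∀ ω, |∫ z, ψ z * (g ω).delta (h z.1) ∂D| ≤ b := fun ω => by
    have h1 := hb 1 ω
    have h2 := hb (-1) ω
    simp only [Units.val_one, Int.cast_one, one_mul, Units.val_neg, Int.cast_neg, neg_mul,
      integral_neg, Finset.sum_neg_distrib] at h1 h2
    have hd : Measurable fun x => (g ω).delta (h x) := hdg.comp measurable_prodMk_left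
    rw [hsum (d := fun x => (g ω).delta (h x)) hd fun x => (hg ω).abs_delta_le _] at h1 h2
    rw [abs_le]
    constructor <;> linarith
  set I' : X → ℝ := fun x => signedIntegral c fun ω => (g ω).delta (h x) with hI'
  set m₁ := c.toJordanDecomposition.posPart with hm₁
  set m₂ := c.toJordanDecomposition.negPart with hm₂
  have hgint : ∀ (m : Measure Ω) [IsFiniteMeasure m] (q : I) (y : Bool),
      Integrable (fun ω => g ω q y) m := fun m _ q y =>
    integrable_of_abs_le ((hgm y).comp (measurable_id.prodMk measurable_const)) fun ω =>
      (hg ω).abs_le q y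
  have hIe : ∀ x, I' x = signedIntegral c (fun ω => g ω (h x) true) -
      signedIntegral c (fun ω => g ω (h x) false) := fun x => by
    simp only [hI', signedIntegral, Loss.delta]
    rw [integral_sub (hgint _ _ _) (hgint _ _ _), integral_sub (hgint _ _ _) (hgint _ _ _)]
    ring
  have hdI : ∀ x, |l.delta (h x) - I' x| ≤ 2 * ε := fun x => by
    have h1 := abs_le.1 (hcl (h x, true))
    have h2 := abs_le.1 (hcl (h x, false))
    simp only [Loss.uncurried] at h1 h2
    rw [hIe, Loss.delta, abs_le]
    constructor <;> linarith [h1.1, h1.2, h2.1, h2.2]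
  -- Fubini brings the bound `b`, uniform in `ω`, inside, so that each Jordan part contributes only
  -- its mass.
  have hFub : ∀ (m : Measure Ω) [IsFiniteMeasure m],
      Integrable (fun z : X × Bool => ψ z * ∫ ω, (g ω).delta (h z.1) ∂m) D ∧
      |∫ z, ψ z * ∫ ω, (g ω).delta (h z.1) ∂m ∂D| ≤ b * m.real Set.univ := fun m _ => by
    have hF : Measurable fun q : (X × Bool) × Ω => ψ q.1 * (g q.2).delta (h q.1.1) :=
      (hψm.comp measurable_fst).mul (hdg.comp (measurable_snd.prodMk
        (measurable_fst.comp measurable_fst)))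
    have hFi : Integrable (fun q : (X × Bool) × Ω => ψ q.1 * (g q.2).delta (h q.1.1))
        (D.prod m) := integrable_of_abs_le hF (B := T * 2) fun q => by
      rw [abs_mul]
      exact mul_le_mul (hψB _) ((hg _).abs_delta_le _) (abs_nonneg _) (Nat.cast_nonneg _)
    simp_rw [← integral_const_mul]
    refine ⟨hFi.integral_prod_left, ?_⟩
    rw [integral_integral_swap hFi]
    have := norm_integral_le_of_norm_le_const (μ := m)
      (f := fun ω => ∫ z, ψ z * (g ω).delta (h z.1) ∂D) (C := b)
      (Filter.Eventually.of_forall fun ω => hN ω)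
    exact this
  obtain ⟨hi₁, hB₁⟩ := hFub m₁
  obtain ⟨hi₂, hB₂⟩ := hFub m₂
  have hψI : ∀ z, ψ z * I' z.1 = ψ z * (∫ ω, (g ω).delta (h z.1) ∂m₁) -
      ψ z * ∫ ω, (g ω).delta (h z.1) ∂m₂ := fun z => by
    simp only [hI', signedIntegral]
    ring
  have hψIi : Integrable (fun z => ψ z * I' z.1) D := by
    simp_rw [hψI]
    exact hi₁.sub hi₂
  have hψI' : |∫ z, ψ z * I' z.1 ∂D| ≤ lam * b := by
    simp_rw [hψI]
    rw [integral_sub hi₁ hi₂]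
    have h1 : m₁.real Set.univ + m₂.real Set.univ ≤ lam := by
      have h2 : c.totalVariation Set.univ = m₁ Set.univ + m₂ Set.univ := rfl
      rw [h2] at hc
      rw [measureReal_def, measureReal_def, ← ENNReal.toReal_add (measure_ne_top _ _)
        (measure_ne_top _ _)]
      exact ENNReal.toReal_le_of_le_ofReal hlam hc
    calc _ ≤ b * m₁.real Set.univ + b * m₂.real Set.univ := (abs_sub _ _).trans (add_le_add hB₁ hB₂)
      _ = (m₁.real Set.univ + m₂.real Set.univ) * b := by ring
      _ ≤ lam * b := mul_le_mul_of_nonneg_right h1 hb0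
  have hψl : Integrable (fun z => ψ z * l.delta (h z.1)) D :=
    integrable_of_abs_le (B := T * 2) (hψm.mul (hdl.comp measurable_fst)) fun z => by
      rw [abs_mul]
      exact mul_le_mul (hψB _) (hl.abs_delta_le _) (abs_nonneg _) (Nat.cast_nonneg _)
  have hlast : |∫ z, (ψ z * l.delta (h z.1) - ψ z * I' z.1) ∂D| ≤ T * (2 * ε) := by
    have := norm_integral_le_of_norm_le_const (μ := D)
      (f := fun z => ψ z * l.delta (h z.1) - ψ z * I' z.1) (C := T * (2 * ε))
      (Filter.Eventually.of_forall fun z => by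
        rw [← mul_sub, Real.norm_eq_abs, abs_mul]
        exact mul_le_mul (hψB z) (hdI z.1) (abs_nonneg _) (Nat.cast_nonneg _))
    simpa using this
  rw [integral_sub hψl hψIi] at hlast
  have h1 := abs_le.1 hlast
  have h2 := abs_le.1 hψI'
  linarith [h1.1, h2.1]

/-- Small calibration and multiaccuracy errors give an omnipredictor. -/
lemma sum_risk_sub_le (hT : 0 < T) (hJ : ∀ t, Measurable (J t))
    (hJT : ∀ t x, p t x = gridPoint T (J t x)) (hJle : ∀ t x, J t x ≤ T)
    {Ω : Type*} [MeasurableSpace Ω] {g : Ω → Loss}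
    (hg : ∀ ω, (g ω).IsBounded) (hgm : ∀ y, Measurable fun z : Ω × I => g z.1 z.2 y) {l : Loss}
    (hl : l.IsBounded) (hlm : ∀ y, Measurable fun q => l q y) {κ : I → I}
    (hκ : l.IsBestResponse κ) {h : X → I} (hh : Measurable h)
    {c : SignedMeasure Ω} {ε lam : ℝ} (hlam : 0 ≤ lam)
    (hc : c.totalVariation Set.univ ≤ ENNReal.ofReal lam)
    (hcl : ∀ x, |l.uncurried x - signedIntegral c (fun ω => (g ω).uncurried x)| ≤ ε) {a b : ℝ}
    (ha : ∀ (v : Fin (T + 1)) (s : ℤˣ), ∑ t, ∫ z, ((s : ℤ) : ℝ) * (outcome z.2 - p t z.1) *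
      Th ((v : ℕ) / (T : ℝ)) (p t z.1) ∂D ≤ a)
    (hb : ∀ (s : ℤˣ) ω, ∑ t, ∫ z, ((s : ℤ) : ℝ) * (outcome z.2 - p t z.1) *
      (g ω).delta (h z.1) ∂D ≤ b) (hb0 : 0 ≤ b) :
    mixtureRisk D l κ p ≤ risk D l h + (4 * a + T * (2 * ε) + lam * b) / T := by
  have hT' : (0 : ℝ) < T := by exact_mod_cast hT
  have h1 := sum_integral_delta_le hT hJ hJT hJle hl hκ ha
  have h2 := neg_sum_integral_delta_le hJ hJT hg hgm hl hlm hh hlam hc hcl hb hb0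
  have hprod : ∀ {d : X × Bool → ℝ}, Measurable d → (∀ x, |d x| ≤ 2) → ∀ t,
      Integrable (fun z => (outcome z.2 - p t z.1) * d z) D := fun {d} hd hd2 t =>
    integrable_of_abs_le (B := 2) ((measurable_comp_grid hJ hJT
        (fun q y => outcome y - (q : ℝ)) t).mul hd) fun z => by
      rw [abs_mul]
      calc _ ≤ 1 * (2 : ℝ) :=
            mul_le_mul (abs_outcome_sub_le _ _) (hd2 _) (abs_nonneg _) zero_le_one
        _ = 2 := one_mul _
  have hlh : Measurable fun z : X × Bool => l (h z.1) z.2 := by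
    have h3 : Measurable fun q : I × Bool => l q.1 q.2 := measurable_from_prod_countable_left hlm
    exact h3.comp ((hh.comp measurable_fst).prodMk measurable_snd)
  have hterm : ∀ t, risk D l (fun x => κ (p t x)) - risk D l h ≤
      (∫ z, (outcome z.2 - p t z.1) * l.delta (κ (p t z.1)) ∂D) -
        ∫ z, (outcome z.2 - p t z.1) * l.delta (h z.1) ∂D := fun t => by
    have i1 := hprod (measurable_comp_grid hJ hJT (fun q _ => l.delta (κ q)) t)
      (fun z => hl.abs_delta_le _) t
    have i2 := hprod (d := fun z => l.delta (h z.1)) ((((hlm true).comp hh).sub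
      ((hlm false).comp hh)).comp measurable_fst) (fun z => hl.abs_delta_le _) t
    have i3 : Integrable (fun z : X × Bool => l (κ (p t z.1)) z.2) D :=
      integrable_of_abs_le (measurable_comp_grid hJ hJT (fun q y => l (κ q) y) t)
        fun z => hl.abs_le _ _
    have i4 : Integrable (fun z : X × Bool => l (h z.1) z.2) D :=
      integrable_of_abs_le hlh fun z => hl.abs_le _ _
    rw [risk, risk, ← integral_sub i3 i4, ← integral_sub i1 i2]
    exact integral_mono (i3.sub i4) (i1.sub i2) fun z => hκ.sub_le _ _ _
  have hsum := Finset.sum_le_sum fun t (_ : t ∈ Finset.univ) => hterm t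
  rw [Finset.sum_sub_distrib, Finset.sum_sub_distrib, Finset.sum_const, Finset.card_univ,
    Fintype.card_fin, nsmul_eq_mul] at hsum
  rw [mixtureRisk, one_div, inv_mul_le_iff₀ hT', mul_add, mul_div_cancel₀ _ hT'.ne']
  linarith

end Omniprediction

/-! ### The regret of the algorithm -/

section Regret

variable {X Ξ : Type*} [MeasurableSpace X] [MeasurableSpace Ξ] {ν : Measure Ξ}
  {A : Learner X Ξ ν} {T k : ℕ}

/-- The rate satisfies `T η² = log T`, and `2T + 3 ≤ T³` for `T ≥ 2`. So the right side is at most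
`4 T η²`; dividing by `η` gives `4 T η = 4 √(T log T)`. -/
lemma le_of_rate_mul_le (hT : 2 ≤ T) {x : ℝ}
    (h : rate T * x ≤ Real.log (2 * T + 3) + T * rate T ^ 2) : x ≤ 4 * √(T * Real.log T) := by
  have hT2 : (2 : ℝ) ≤ T := by exact_mod_cast hT
  have hlog : 0 < Real.log T := Real.log_pos (by linarith)
  have hr : 0 < rate T := Real.sqrt_pos.2 (by positivity)
  have hr2 : T * rate T ^ 2 = Real.log T := by
    rw [rate, Real.sq_sqrt (by positivity)]
    field_simp
  have hTr : √(T * Real.log T) = T * rate T := by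
    rw [← Real.sqrt_sq (by positivity : 0 ≤ T * rate T), mul_pow, sq (T : ℝ), mul_assoc, hr2]
  have hlog3 : Real.log (2 * T + 3) ≤ 3 * Real.log T := by
    rw [show 3 * Real.log T = Real.log ((T : ℝ) ^ 3) by rw [Real.log_pow]; norm_num]
    refine Real.log_le_log (by positivity) ?_
    nlinarith [mul_nonneg (sub_nonneg.2 hT2) (sub_nonneg.2 hT2), pow_pos (by linarith : (0:ℝ) < T) 2]
  rw [hTr]
  refine le_of_mul_le_mul_left ?_ hr
  calc rate T * x ≤ 4 * (T * rate T ^ 2) := by linarith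
    _ = _ := by ring

lemma sum_calPayoff_le (hT : 2 ≤ T) (u : Fin T → RoundInput X Ξ k) (v : Fin (T + 1)) (s : ℤˣ) :
    ∑ t : Fin T, calPayoff A T v s t (pre u t) (u t) ≤
      ∑ t : Fin T, mixPayoff A T t (pre u t) (u t) + 4 * √(T * Real.log T) := by
  have := le_of_rate_mul_le hT (rate_mul_sum_calPayoff_le (A := A) hT u v s)
  rw [Finset.sum_sub_distrib] at this
  linarith

lemma sum_auxPayoff_le (hT : 2 ≤ T) (u : Fin T → RoundInput X Ξ k) :
    ∑ t : Fin T, resid A T (pre u t) (u t) * auxVal A T (pre u t) (u t) ≤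
      ∑ t : Fin T, mixPayoff A T t (pre u t) (u t) + 4 * √(T * Real.log T) := by
  have := le_of_rate_mul_le hT (rate_mul_sum_auxPayoff_le (A := A) hT u)
  rw [Finset.sum_sub_distrib] at this
  linarith

/-- Regret of the oracle along the run, in terms of the payoffs of the calibrator. -/
lemma sum_mul_resid_le (hT : 2 ≤ T) (u : Fin T → RoundInput X Ξ k) {c : X → ℝ} {reg m r : ℝ}
    (hmix : ∑ t : Fin T, mixPayoff A T t (pre u t) (u t) ≤ m)
    (hres : ∑ t : Fin T, |A.mean (run A T k t (pre u t)).2 (u t).1.1 - auxVal A T (pre u t) (u t)|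
      ≤ r)
    (horc : ∑ t : Fin T, c (u t).1.1 * resid A T (pre u t) (u t) ≤
      ∑ t : Fin T, A.mean (run A T k t (pre u t)).2 (u t).1.1 * resid A T (pre u t) (u t) + reg) :
    ∑ t : Fin T, c (u t).1.1 * resid A T (pre u t) (u t) ≤
      r + (m + 4 * √(T * Real.log T)) + reg := by
  have h1 : ∑ t : Fin T, A.mean (run A T k t (pre u t)).2 (u t).1.1 * resid A T (pre u t) (u t) ≤
      ∑ t : Fin T, |A.mean (run A T k t (pre u t)).2 (u t).1.1 - auxVal A T (pre u t) (u t)| +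
      ∑ t : Fin T, resid A T (pre u t) (u t) * auxVal A T (pre u t) (u t) := by
    rw [← Finset.sum_add_distrib]
    refine Finset.sum_le_sum fun t _ => ?_
    have h2 := abs_resid_le (A := A) (T := T) (pre u t) (u t)
    have h3 : (A.mean (run A T k t (pre u t)).2 (u t).1.1 - auxVal A T (pre u t) (u t)) *
        resid A T (pre u t) (u t) ≤
        |A.mean (run A T k t (pre u t)).2 (u t).1.1 - auxVal A T (pre u t) (u t)| := by
      refine (le_abs_self _).trans ?_
      rw [abs_mul]
      exact mul_le_of_le_one_right (abs_nonneg _) h2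
    linarith
  linarith [sum_auxPayoff_le (A := A) hT u]

/-- Sums over all rounds, from sums over the rounds of the first and of the second half. -/
lemma sum_le_of_halves {f : Fin T → ℝ} {R B : ℝ} (hB : 0 ≤ B) (hf : ∀ i, f i ≤ B)
    (h1 : ∑ i, (if i < i.rev then f i else 0) ≤ R) (h2 : ∑ i, (if i.rev < i then f i else 0) ≤ R) :
    ∑ i, f i ≤ 2 * R + B := by
  -- The middle round, present for odd `T`, belongs to neither half.
  have h3 : ∑ i : Fin T, (if i = i.rev then f i else 0) ≤ B := by
    rw [← Finset.sum_filter]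
    refine (Finset.sum_le_card_nsmul _ _ B fun i _ => hf i).trans ?_
    have hc : (Finset.univ.filter fun i : Fin T => i = i.rev).card ≤ 1 := by
      rw [Finset.card_le_one]
      intro i hi j hj
      rw [Finset.mem_filter, Fin.ext_iff, Fin.val_rev] at hi hj
      have := i.isLt
      ext
      omega
    rw [nsmul_eq_mul]
    exact mul_le_of_le_one_left hB (by exact_mod_cast hc)
  have h4 : ∀ i : Fin T, f i = (if i < i.rev then f i else 0) + (if i.rev < i then f i else 0) +
      if i = i.rev then f i else 0 := fun i => by
    rcases lt_trichotomy i i.rev with h | h | h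
    · simp [h, h.not_gt, h.ne]
    · simp [← h]
    · simp [h, h.not_gt, h.ne']
  rw [Finset.sum_congr rfl fun i _ => h4 i, Finset.sum_add_distrib, Finset.sum_add_distrib]
  linarith

end Regret

/-- Rademacher complexities are nonnegative. -/
lemma rad_nonneg {X : Type*} [MeasurableSpace X] (μ : Measure X) {C : Set (X → ℝ)}
    (hne : C.Nonempty) (hC : ∀ c ∈ C, ∀ x, |c x| ≤ 2) (m : ℕ) : 0 ≤ rad μ C m := by
  refine integral_nonneg fun x => div_nonneg ?_ (by positivity)
  obtain ⟨c₀, hc₀⟩ := hne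
  refine le_trans (le_of_eq ?_) (Finset.sum_le_sum fun (s : Fin m → ℤˣ) _ =>
    le_ciSup (f := fun c : C => 1 / (m : ℝ) * ∑ i, ((s i : ℤ) : ℝ) * c.1 (x i))
      ⟨1 / (m : ℝ) * ∑ _i : Fin m, 2, ?_⟩ ⟨c₀, hc₀⟩)
  · set f : (Fin m → ℤˣ) → ℝ := fun s => 1 / (m : ℝ) * ∑ i, ((s i : ℤ) : ℝ) * c₀ (x i) with hf
    have h1 : ∑ s, f (-s) = ∑ s, f s := Equiv.sum_comp (Equiv.neg _) f
    have h2 : ∀ s, f (-s) = -f s := fun s => by simp [hf, Finset.sum_neg_distrib]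
    simp_rw [h2, Finset.sum_neg_distrib] at h1
    change 0 = ∑ s, f s
    linarith
  · rintro _ ⟨c, rfl⟩
    refine mul_le_mul_of_nonneg_left (Finset.sum_le_sum fun i _ => ?_) (by positivity)
    refine (le_abs_self _).trans ?_
    rw [abs_mul, abs_intUnit, one_mul]
    exact hC _ c.2 _

section Class

variable {X Ω : Type*} [MeasurableSpace X] [MeasurableSpace Ω] {g : Ω → Loss} {H : Set (X → I)}

omit [MeasurableSpace X] [MeasurableSpace Ω] in
lemma abs_le_of_mem_deltaComp (hg : ∀ ω, (g ω).IsBounded) {c : X → ℝ} (hc : c ∈ deltaComp g H)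
    (x : X) : |c x| ≤ 2 := by
  obtain ⟨ω, h, -, rfl⟩ := hc
  exact (hg ω).abs_delta_le _

lemma measurable_of_mem_deltaComp (hH : ∀ h ∈ H, Measurable h)
    (hgm : ∀ y, Measurable fun z : Ω × I => g z.1 z.2 y) {c : X → ℝ} (hc : c ∈ deltaComp g H) :
    Measurable c := by
  obtain ⟨ω, h, hh, rfl⟩ := hc
  have h1 : Measurable fun x => (ω, h x) := measurable_const.prodMk (hH h hh)
  exact ((hgm true).comp h1).sub ((hgm false).comp h1)

end Class

/-! ### Good runs and the union bound -/

section Main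

variable {X Ξ : Type*} [MeasurableSpace X] [MeasurableSpace Ξ] {ν : Measure Ξ}
  [IsProbabilityMeasure ν] {A : Learner X Ξ ν} {T k : ℕ} (D : Measure (X × Bool))
  [IsProbabilityMeasure D]

/-- The events on which the algorithm is analysed; `S` is the scale of the deviations and `R` the
uniform convergence bound for `C`. -/
structure GoodRun (A : Learner X Ξ ν) (C : Set (X → ℝ)) (reg S R : ℝ)
    (u : Fin T → RoundInput X Ξ k) : Prop where
  cal : ∀ (v : Fin (T + 1)) (s : ℤˣ), ∑ t : Fin T,
    ((∫ z, calPayoff A T v s t (pre u t) (z, (u t).2) ∂D) -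
      calPayoff A T v s t (pre u t) (u t)) ≤ 7 * S
  mix : ∑ t : Fin T, mixPayoff A T t (pre u t) (u t) ≤ 7 * S + 1
  res : ∑ t : Fin T, |A.mean (run A T k t (pre u t)).2 (u t).1.1 - auxVal A T (pre u t) (u t)| ≤
    7 * S
  fst : ∀ s : ℤˣ, ∀ c ∈ C, ∑ t : Fin T, (if t < t.rev then
    (∫ z, ((s : ℤ) : ℝ) * resid A T (pre u t) (z, (u t).2) * c z.1 ∂D) -
      ((s : ℤ) : ℝ) * resid A T (pre u t) (u t) * c (u t).1.1 else 0) ≤ R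
  snd : ∀ s : ℤˣ, ∀ c ∈ C, ∑ t : Fin T, (if t.rev < t then
    (∫ z, ((s : ℤ) : ℝ) * resid A T (pre u t) (z, (u t).2) * c z.1 ∂D) -
      ((s : ℤ) : ℝ) * resid A T (pre u t) (u t) * c (u t).1.1 else 0) ≤ R
  oracle : ∀ c ∈ signed C, ∑ t : Fin T, c (u t).1.1 * resid A T (pre u t) (u t) ≤
    ∑ t : Fin T, A.mean (run A T k t (pre u t)).2 (u t).1.1 * resid A T (pre u t) (u t) + reg

variable {D} {C : Set (X → ℝ)} {reg S R : ℝ} {u : Fin T → RoundInput X Ξ k}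

omit [IsProbabilityMeasure ν] [IsProbabilityMeasure D] in
-- The constant is `7 + 7 + 4`: passage to the population, payoff of the average expert (with the
-- extra `1`), and regret of exponential weights. The predictor `p_t` is fixed before its sample, so
-- integrating over a fresh sample gives the population error.
lemma GoodRun.calibration_le (hu : GoodRun D A C reg S R u) (hT : 2 ≤ T)
    (hS : √(T * Real.log T) ≤ S) (v : Fin (T + 1)) (s : ℤˣ) :
    ∑ t, ∫ z, ((s : ℤ) : ℝ) * (outcome z.2 - outP A u t z.1) *
      Th ((v : ℕ) / (T : ℝ)) (outP A u t z.1) ∂D ≤ 18 * S + 1 := by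
  have h1 := hu.cal v s
  rw [Finset.sum_sub_distrib] at h1
  have h2 := sum_calPayoff_le (A := A) hT u v s
  have h3 : ∑ t, ∫ z, ((s : ℤ) : ℝ) * (outcome z.2 - outP A u t z.1) *
      Th ((v : ℕ) / (T : ℝ)) (outP A u t z.1) ∂D =
      ∑ t : Fin T, ∫ z, calPayoff A T v s t (pre u t) (z, (u t).2) ∂D := rfl
  rw [h3]
  linarith [hu.mix]

omit [IsProbabilityMeasure ν] in
-- The two halves and the middle round cost `2R + 4`. On the sample, resampling costs `7S`, the
-- average expert `7S + 1`, the regret against the expert `sma` at most `4S`, and the learner `reg`.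
lemma GoodRun.multiaccuracy_le (hu : GoodRun D A C reg S R u) (hT : 2 ≤ T)
    (hS : √(T * Real.log T) ≤ S) {c : X → ℝ} (hc : c ∈ C) (hC : ∀ x, |c x| ≤ 2) (s : ℤˣ) :
    ∑ t, ∫ z, ((s : ℤ) : ℝ) * (outcome z.2 - outP A u t z.1) * c z.1 ∂D ≤
      2 * R + 18 * S + 5 + reg := by
  have hW : ∀ (t : Fin T) (a : RoundInput X Ξ k),
      |((s : ℤ) : ℝ) * resid A T (pre u t) a * c a.1.1| ≤ 2 := fun t a => by
    rw [abs_mul, abs_mul, abs_intUnit, one_mul]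
    calc _ ≤ 1 * (2 : ℝ) := mul_le_mul (abs_resid_le _ _) (hC _) (abs_nonneg _) zero_le_one
      _ = 2 := one_mul _
  have h1 := sum_le_of_halves (B := 4) (by norm_num) (fun t => by
    have h2 : |∫ z, ((s : ℤ) : ℝ) * resid A T (pre u t) (z, (u t).2) * c z.1 ∂D| ≤ 2 := by
      simpa using norm_integral_le_of_norm_le_const (μ := D) (C := 2)
        (f := fun z => ((s : ℤ) : ℝ) * resid A T (pre u t) (z, (u t).2) * c z.1)
        (Filter.Eventually.of_forall fun z => hW t (z, (u t).2))
    have h3 := abs_le.1 (hW t (u t))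
    have h4 := abs_le.1 h2
    linarith [h3.1, h4.2]) (hu.fst s c hc) (hu.snd s c hc)
  rw [Finset.sum_sub_distrib] at h1
  have h2 := sum_mul_resid_le (A := A) hT u hu.mix hu.res (hu.oracle _ ⟨s, c, hc, rfl⟩)
  have h3 : ∑ t : Fin T, ((s : ℤ) : ℝ) * c (u t).1.1 * resid A T (pre u t) (u t) =
      ∑ t : Fin T, ((s : ℤ) : ℝ) * resid A T (pre u t) (u t) * c (u t).1.1 :=
    Finset.sum_congr rfl fun t _ => by ring
  have h4 : ∑ t, ∫ z, ((s : ℤ) : ℝ) * (outcome z.2 - outP A u t z.1) * c z.1 ∂D =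
      ∑ t : Fin T, ∫ z, ((s : ℤ) : ℝ) * resid A T (pre u t) (z, (u t).2) * c z.1 ∂D := rfl
  rw [h3] at h2
  rw [h4]
  linarith

omit [IsProbabilityMeasure ν] in
/-- Good runs give omnipredictors. -/
lemma GoodRun.mixtureRisk_le {Ω : Type*} [MeasurableSpace Ω] [Nonempty Ω] {g : Ω → Loss}
    {H : Set (X → I)} (hu : GoodRun D A (deltaComp g H) reg S R u) (hT : 2 ≤ T)
    (hS : √(T * Real.log T) ≤ S) (hg : ∀ ω, (g ω).IsBounded)
    (hgm : ∀ y, Measurable fun z : Ω × I => g z.1 z.2 y) {l : Loss}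
    (hl : l.IsBounded) (hlm : ∀ y, Measurable fun q => l q y) {κ : I → I}
    (hκ : l.IsBestResponse κ) {h : X → I} (hh : Measurable h) (hhH : h ∈ H)
    {c : SignedMeasure Ω} {ε lam : ℝ} (hlam : 0 ≤ lam)
    (hc : c.totalVariation Set.univ ≤ ENNReal.ofReal lam)
    (hcl : ∀ x, |l.uncurried x - signedIntegral c (fun ω => (g ω).uncurried x)| ≤ ε) :
    mixtureRisk D l κ (outP A u) ≤ risk D l h +
      (4 * (18 * S + 1) + T * (2 * ε) + lam * (2 * R + 18 * S + 5 + reg)) / T := by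
  have hb : ∀ (s : ℤˣ) ω, ∑ t, ∫ z, ((s : ℤ) : ℝ) * (outcome z.2 - outP A u t z.1) *
      (g ω).delta (h z.1) ∂D ≤ 2 * R + 18 * S + 5 + reg := fun s ω =>
    hu.multiaccuracy_le hT hS (c := fun x => (g ω).delta (h x)) ⟨ω, h, hhH, rfl⟩
      (fun x => (hg ω).abs_delta_le _) s
  -- The same number bounds a quantity and its negative, so no sign of `reg` has to be assumed.
  have hb0 : 0 ≤ 2 * R + 18 * S + 5 + reg := by
    obtain ⟨ω⟩ := ‹Nonempty Ω›
    have h1 := hb 1 ω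
    have h2 := hb (-1) ω
    simp only [Units.val_one, Int.cast_one, one_mul, Units.val_neg, Int.cast_neg, neg_mul,
      integral_neg, Finset.sum_neg_distrib] at h1 h2
    linarith
  refine sum_risk_sub_le (by omega) (J := fun t x =>
    (run A T k t (pre u t)).1.remapIndex (u t).2.1 (outQ A u t x)) (fun t => ?_)
    (fun t x => Weights.remap_eq _ _ _) (fun t x => Weights.remapIndex_le _ _ _) hg hgm hl hlm hκ hh
    hlam hc hcl (hu.calibration_le hT hS) hb hb0
  exact measurable_remapIndex measurable_const measurable_const
    (measurable_roundQ A measurable_const measurable_const measurable_id)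

/-- Runs are good with high probability. -/
lemma measure_not_goodRun_le (hT : 2 ≤ T) (hne : C.Nonempty) (hC : ∀ c ∈ C, ∀ x, |c x| ≤ 2)
    (hCm : ∀ c ∈ C, Measurable c) (hSup : SupMeasurable (D.map Prod.fst) C T) {δ L : ℝ}
    (hA : A.IsOWAL (signed C) T δ reg) (hL : 2 / 3 ≤ L) (hS : 0 < S) (hSL : S ^ 2 = T * L)
    (hk : T * L ≤ k) :
    runMeasure D ν T k {u | ¬ GoodRun D A C reg S (2 * (T * rad (D.map Prod.fst) C T) + 37 * S) u} ≤
      (2 * T + 8) * ENNReal.ofReal (Real.exp (-(5 * L))) + ENNReal.ofReal δ := by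
  have hT2 : (2 : ℝ) ≤ T := by exact_mod_cast hT
  have hT0 : (0 : ℝ) < T := by linarith
  -- Then `θ S = T θ² = L`, and the constants `7` and `37` leave the exponent `-5L`, as `2 - 7` and
  -- as `32 - 37`.
  set θ : ℝ := S / T with hθ
  have hθ0 : 0 < θ := by positivity
  have hθS : θ * S = L := by
    rw [hθ, div_mul_eq_mul_div, ← sq, hSL]
    field_simp
  have hθ2 : T * θ ^ 2 = L := by
    rw [hθ, div_pow, hSL]
    field_simp
  set P := runMeasure D ν T k with hP
  set Q : ℝ≥0∞ := ENNReal.ofReal (Real.exp (-(5 * L))) with hQ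
  set r : ℝ := T * rad (D.map Prod.fst) C T with hr
  have hexp : ∀ x, x ≤ -(5 * L) → ENNReal.ofReal (Real.exp x) ≤ Q := fun x hx =>
    ENNReal.ofReal_le_ofReal (Real.exp_le_exp.2 hx)
  let P' : Measure (I × Ξ × (Fin k → Ξ)) :=
    (volume : Measure I).prod (ν.prod (Measure.pi fun _ : Fin k => ν))
  have hfst : ∀ t, Measurable fun z : (Fin t → RoundInput X Ξ k) × RoundInput X Ξ k => z.1 :=
    fun t => measurable_fst
  have hsnd : ∀ t, Measurable fun z : (Fin t → RoundInput X Ξ k) × RoundInput X Ξ k => z.2 :=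
    fun t => measurable_snd
  have hcal : ∀ (v : Fin (T + 1)) (s : ℤˣ), P {u | 7 * S ≤ ∑ t : Fin T,
      ((∫ z, calPayoff A T v s t (pre u t) (z, (u t).2) ∂D) -
        calPayoff A T v s t (pre u t) (u t))} ≤ Q := fun v s => by
    refine (measure_sum_integral_sub_ge_le D P' (W := fun t past a => calPayoff A T v s t past a)
      (fun t => measurable_calPayoff (hfst t) (hsnd t) v s) (fun t p a => ?_) hθ0 T (7 * S)).trans
      (hexp _ (by linarith))
    rw [calPayoff, abs_mul, abs_mul, abs_intUnit, abs_Th, one_mul, mul_one]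
    exact abs_resid_le _ _
  have hmix : P {u | 7 * S + 1 ≤ ∑ t : Fin T, mixPayoff A T t (pre u t) (u t)} ≤ Q := by
    refine (measure_sum_mixPayoff_ge_le A D hT hθ0 (7 * S + 1)).trans (hexp _ (le_of_eq ?_))
    have : T * (θ * (1 / T) + 2 * θ ^ 2) = θ + 2 * (T * θ ^ 2) := by
      field_simp
    rw [this]
    linarith
  have hres : P {u | 7 * S ≤ ∑ t : Fin T, |A.mean (run A T k t (pre u t)).2 (u t).1.1 -
      auxVal A T (pre u t) (u t)|} ≤ Q := by
    -- Here the parameter is `S` itself, admissible since `S² = T L ≤ k`. The exponent `3T - 7TL` is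
    -- at most `-5L` because `L ≥ 2/3` and `T ≥ 2`.
    refine (measure_sum_abs_mean_sub_ge_le A D hS (by rw [hSL]; exact hk) T (7 * S)).trans
      (hexp _ ?_)
    have h1 : S * (7 * S) = 7 * (T * L) := by rw [← hSL]; ring
    rw [h1]
    nlinarith
  have huc : ∀ (B : Fin T → Prop) [DecidablePred B], (∀ i, B i → ¬ B i.rev) → ∀ s : ℤˣ,
      P {u | ∃ c ∈ C, 2 * r + 37 * S ≤ ∑ t : Fin T, if B t then
        (∫ z, ((s : ℤ) : ℝ) * resid A T (pre u t) (z, (u t).2) * c z.1 ∂D) -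
        ((s : ℤ) : ℝ) * resid A T (pre u t) (u t) * c (u t).1.1 else 0} ≤ Q := fun B _ hB s => by
    refine (measure_exists_sum_ge_le D P' (by omega) hne hC hCm measurable_fst hSup
      (W := fun t past a => ((s : ℤ) : ℝ) * resid A T past a)
      (fun t => (measurable_resid (hfst t) (hsnd t)).const_mul _) (fun t p a => ?_) hB hθ0.le
      (2 * r + 37 * S)).trans (hexp _ (le_of_eq ?_))
    · rw [abs_mul, abs_intUnit, one_mul]
      exact abs_resid_le _ _
    · have : T * (32 * θ ^ 2) = 32 * L := by rw [← hθ2]; ring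
      rw [← hr, this]
      linarith
  have hB1 : ∀ i : Fin T, i < i.rev → ¬ i.rev < i.rev.rev := fun i hi => by
    rw [Fin.rev_rev]
    exact hi.not_gt
  have hB2 : ∀ i : Fin T, i.rev < i → ¬ i.rev.rev < i.rev := fun i hi => by
    rw [Fin.rev_rev]
    exact hi.not_gt
  have horc := measure_oracle_fail_le (k := k) D hne hC hSup (by omega) hA
  -- There are `2(T + 1)` calibration events, one for the average expert, one for resampling and two
  -- for each half: `2T + 8` in all, besides the learner's failure.
  refine (measure_mono (t := (⋃ v : Fin (T + 1), ⋃ s : ℤˣ, _) ∪ _ ∪ _ ∪ (⋃ s : ℤˣ, _) ∪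
    (⋃ s : ℤˣ, _) ∪ _) ?_).trans (((measure_union_le _ _).trans (add_le_add ((measure_union_le _ _).trans
      (add_le_add ((measure_union_le _ _).trans (add_le_add ((measure_union_le _ _).trans
      (add_le_add ((measure_union_le _ _).trans (add_le_add
        ((measure_iUnion_fintype_le _ _).trans (Finset.sum_le_sum fun v _ =>
          (measure_iUnion_fintype_le _ _).trans (Finset.sum_le_sum fun s _ => hcal v s)))
        hmix)) hres)) ((measure_iUnion_fintype_le _ _).trans (Finset.sum_le_sum fun s _ =>
          huc (fun i => i < i.rev) hB1 s)))) ((measure_iUnion_fintype_le _ _).trans (Finset.sum_le_sum fun s _ =>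
          huc (fun i => i.rev < i) hB2 s)))) horc)).trans ?_)
  · intro u hu
    by_contra hcon
    simp only [Set.mem_union, Set.mem_iUnion, Set.mem_ofPred_eq, not_or, not_exists, not_and,
      not_le, not_not] at hcon
    obtain ⟨⟨⟨⟨⟨c1, c2⟩, c3⟩, c4⟩, c5⟩, c6⟩ := hcon
    exact hu ⟨fun v s => (c1 v s).le, c2.le, c3.le, fun s c hc => (c4 s c hc).le,
      fun s c hc => (c5 s c hc).le, c6⟩
  · refine add_le_add (le_of_eq ?_) le_rfl
    simp only [Finset.sum_const, Finset.card_univ, Fintype.card_fin, Fintype.card_units_int,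
      nsmul_eq_mul]
    push_cast
    ring

end Main

/-- Each event has probability at most `(δ/T)⁵`, and `2(2T + 8) ≤ T⁵` for `T ≥ 2`, so together they
use at most `δ/2`. -/
lemma failure_probability_le {T : ℕ} (hT : 2 ≤ T) {δ : ℝ} (h0 : 0 < δ) (h1 : δ < 1) :
    (2 * T + 8) * ENNReal.ofReal (Real.exp (-(5 * Real.log (T / δ)))) + ENNReal.ofReal (δ / 2) ≤
      ENNReal.ofReal δ := by
  have hT2 : (2 : ℝ) ≤ T := by exact_mod_cast hT
  have hT0 : (0 : ℝ) < T := by linarith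
  have he : Real.exp (-(5 * Real.log (T / δ))) = (δ / T) ^ 5 := by
    have : -(5 * Real.log (T / δ)) = Real.log ((δ / T) ^ 5) := by
      rw [Real.log_pow, ← inv_div, Real.log_inv]
      push_cast
      ring
    rw [this, Real.exp_log (by positivity)]
  have hcast : (2 * T + 8 : ℝ≥0∞) = ENNReal.ofReal (2 * T + 8) := by
    rw [ENNReal.ofReal_add (by positivity) (by positivity), ENNReal.ofReal_mul (by positivity),
      ENNReal.ofReal_natCast]
    norm_num
  rw [he, hcast, ← ENNReal.ofReal_mul (by positivity),
    ← ENNReal.ofReal_add (by positivity) (by positivity)]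
  refine ENNReal.ofReal_le_ofReal ?_
  have h5 : (2 * T + 8) * (δ / T) ^ 5 ≤ δ / 2 := by
    rw [div_pow, mul_div_assoc', div_le_iff₀ (by positivity)]
    have hδ : δ ^ 5 ≤ δ := by
      simpa using pow_le_pow_of_le_one h0.le h1.le (show 1 ≤ 5 by norm_num)
    have hT4 : (16 : ℝ) ≤ (T : ℝ) ^ 4 := by
      calc (16 : ℝ) = 2 ^ 4 := by norm_num
        _ ≤ (T : ℝ) ^ 4 := pow_le_pow_left₀ (by norm_num) hT2 4
    have hT5 : 2 * (2 * T + 8 : ℝ) ≤ (T : ℝ) ^ 5 := by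
      have : (16 : ℝ) * T ≤ (T : ℝ) ^ 4 * T := mul_le_mul_of_nonneg_right hT4 hT0.le
      rw [pow_succ]
      linarith
    calc (2 * T + 8) * δ ^ 5 ≤ (2 * T + 8) * δ := by gcongr
      _ = δ / 2 * (2 * (2 * T + 8)) := by ring
      _ ≤ δ / 2 * (T : ℝ) ^ 5 := by gcongr
  linarith

end Omni

end

theorem mainTheorem11 :
    ∃ K : ℝ, 0 < K ∧
    ∀ (X : Type*) [MeasurableSpace X] (D : Measure (X × Bool)) [IsProbabilityMeasure D]
      (H : Set (X → I)) (_ : ∀ h ∈ H, Measurable h)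
      -- the basis class `G = (g_ω)` of losses
      (Ω : Type*) [MeasurableSpace Ω] [Nonempty Ω] (g : Ω → Loss)
      (_ : ∀ ω, (g ω).IsBounded)
      (_ : ∀ y, Measurable fun z : Ω × I => g z.1 z.2 y)
      -- the loss class `L` with post-processings `k_ℓ`
      (L : Set Loss) (_ : ∀ l ∈ L, l.IsBounded) (_ : ∀ l ∈ L, ∀ y, Measurable fun p => l p y)
      (post : Loss → I → I) (_ : ∀ l ∈ L, l.IsBestResponse (post l))
      (T : ℕ) (_ : 2 ≤ T) (δ : ℝ) (_ : 0 < δ) (_ : δ < 1)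
      (_ : SupMeasurable (D.map Prod.fst) (deltaComp g H) T)
      (ε lam : ℝ) (_ : ε ≤ 1 / √(T : ℝ)) (_ : 1 ≤ lam)
      (_ : IsSpanned (Loss.uncurried '' L) (fun ω => (g ω).uncurried) ε lam)
      -- the online weak agnostic learner, and the number of resamples per round
      (Ξ : Type*) [MeasurableSpace Ξ] (ν : Measure Ξ) [IsProbabilityMeasure ν]
      (A : Learner X Ξ ν) (reg : ℝ)
      (_ : A.IsOWAL (signed (deltaComp g H)) T (δ / 2) reg)
      (k : ℕ) (_ : (T : ℝ) * Real.log (T / δ) ≤ k),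
      runMeasure D ν T k {u | ¬ ∀ l ∈ L, ∀ h ∈ H,
          mixtureRisk D l (post l) (outP A u) ≤
            risk D l h
              + K * (lam * rad (D.map Prod.fst) (deltaComp g H) T
                  + lam * √(Real.log (T / δ) / T))
              + lam / T * reg} ≤ ENNReal.ofReal δ ∧
      ∀ (u : Fin T → RoundInput X Ξ k) (t : Fin T),
        (∀ x, outQ A u t x ∈ Set.Icc (-1 : ℝ) 1) ∧
        ∃ v : Set.Icc (-1 : ℝ) 1 → I, ∀ (x : X) (hx : outQ A u t x ∈ Set.Icc (-1 : ℝ) 1),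
          outP A u t x = v ⟨outQ A u t x, hx⟩ := by
  refine ⟨200, by norm_num, ?_⟩
  intro X _ D _ H hH Ω _ _ g hg hgm L hLb hLm post hpost T hT δ hδ0 hδ1 hSup ε lam hε hlam hspan
    Ξ _ ν _ A reg hA k hk
  refine ⟨?_, fun u t => ⟨fun x => abs_le.1 (abs_average_le _ _ _),
    fun q => (run A T k t (pre u t)).1.remap (u t).2.1 q.1, fun x hx => rfl⟩⟩
  -- Without hypotheses the bound is vacuous; otherwise the class is nonempty, as the supremum
  -- lemmas need.
  rcases H.eq_empty_or_nonempty with rfl | ⟨h₀, hh₀⟩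
  · simp
  have hT2 : (2 : ℝ) ≤ T := by exact_mod_cast hT
  have hT0 : (0 : ℝ) < T := by linarith
  obtain ⟨ω₀⟩ := ‹Nonempty Ω›
  have hne : (deltaComp g H).Nonempty := ⟨_, ω₀, h₀, hh₀, rfl⟩
  have hC : ∀ c ∈ deltaComp g H, ∀ x, |c x| ≤ 2 := fun c hc => abs_le_of_mem_deltaComp hg hc
  have hlogT : Real.log T ≤ Real.log (T / δ) :=
    Real.log_le_log hT0 ((le_div_iff₀ hδ0).2 (mul_le_of_le_one_right hT0.le hδ1.le))
  have hlog : 2 / 3 ≤ Real.log (T / δ) := by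
    have := Real.log_le_log (by norm_num) hT2
    linarith [Real.log_two_gt_d9]
  set ℓ : ℝ := Real.log (T / δ) with hℓ
  set S : ℝ := √(T * ℓ) with hS
  have hSsq : S ^ 2 = T * ℓ := Real.sq_sqrt (by positivity)
  have hS1 : 1 ≤ S := Real.one_le_sqrt.2 (by nlinarith)
  have hρ : √(ℓ / T) = S / T := by
    rw [eq_div_iff hT0.ne', hS]
    nth_rewrite 2 [← Real.sqrt_sq hT0.le]
    rw [← Real.sqrt_mul (by positivity)]
    congr 1
    field_simp
  have hTε : T * ε ≤ 2 * S := by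
    have h1 : T * (1 / √(T : ℝ)) = √(T : ℝ) := by
      rw [mul_one_div, Real.div_sqrt]
    have h2 : √(T : ℝ) ≤ 2 * S := by
      rw [Real.sqrt_le_left (by positivity), mul_pow, hSsq]
      nlinarith
    exact (mul_le_mul_of_nonneg_left hε hT0.le).trans (h1.trans_le h2)
  refine (measure_mono fun u hu => ?_).trans ((measure_not_goodRun_le hT hne hC
    (fun c hc => measurable_of_mem_deltaComp hH hgm hc) hSup hA hlog (by positivity) hSsq hk).trans
    (failure_probability_le hT hδ0 hδ1))
  intro hgood
  refine hu fun l hl h hh => ?_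
  obtain ⟨c, hc, hcl⟩ := hspan _ ⟨l, hl, rfl⟩
  have : Nonempty Ω := ⟨ω₀⟩
  refine (hgood.mixtureRisk_le hT (Real.sqrt_le_sqrt (by gcongr)) hg hgm (hLb l hl) (hLm l hl)
    (hpost l hl) (hH h hh) hh (by linarith) hc hcl).trans ?_
  rw [hρ, add_assoc (risk D l h)]
  refine add_le_add le_rfl ?_
  have hrad := rad_nonneg (D.map Prod.fst) hne hC T
  rw [div_le_iff₀ hT0]
  have hlS : 0 ≤ (lam - 1) * S := mul_nonneg (by linarith) (by linarith)
  have hl1 : 0 ≤ lam * (S - 1) := mul_nonneg (by linarith) (by linarith)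
  have hlr : 0 ≤ lam * (T * rad (D.map Prod.fst) (deltaComp g H) T) :=
    mul_nonneg (by linarith) (by positivity)
  have : (200 * (lam * rad (D.map Prod.fst) (deltaComp g H) T + lam * (S / T)) + lam / T * reg) * T =
      200 * (lam * (T * rad (D.map Prod.fst) (deltaComp g H) T)) + 200 * (lam * S) + lam * reg := by
    field_simp
  rw [this]
  -- As `1 ≤ lam` and `1 ≤ S`, the terms free of `rad` and `reg` add up to at most `(76 + 4 + 92 +
  -- 5) lam S`, and `rad` enters with coefficient `4`; so `200` is ample.
  nlinarith
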